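/- **Setting.** Let $H$ be a (real or complex) separable Hilbert space and $A$ the generator of an analytic $C_0$-semigroup $(S_t)_{t\ge 0}$ on $H$. Assume that $H$ has an orthonormal basis $(e_k)_{k\in\mathbb N}$ of eigenvectors, $Ae_k=\lambda_ke_k$, where finitely many (at least one), say $N$, of the $\lambda_k$ have positive real part and all others have negative real part. Let $H_u$ be the span of the $N$ unstable eigenvectors, $\pi^u$ the orthogonal projection onto $H_u$, $\pi^s=1-\pi^u$, $S^u_r=e^{rA}\pi^u$ ($r\in\mathbb R$; $H_u$ is finite-dimensional and invariant), $S^s_r=S_r\pi^s$ ($r\ge0$), and assume that for some $0<\beta<\alpha$ $$\|S^u_tx\|\le e^{\alpha t}\|x\|\ (t\le 0,\ x\in H_u),\qquad \|S^s_tx\|\le e^{-\beta t}\|x\|\ (t\ge 0,\ x\in\pi^sH).$$ Put $\delta=\frac{\alpha-\beta}2$ and let $H_\theta=\mathrm{Dom}((-A)^\theta)$, with norm $\|x\|_\theta=(\sum_k|\lambda_k|^{2\theta}|\langle e_k,x\rangle|^2)^{1/2}$, $\theta\in\mathbb R$ (a completion of $H$ for $\theta<0$); $\|T\|_\theta$ also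 denotes the norm of $T$ in $L(\mathbb R^d,H_\theta)$. Let $\frac13<\gamma\le\frac12$ and $0\le\eta<\gamma$. Let $f:H\to H$ and $g:H\to L(\mathbb R^d,H)$ be such that for every $\theta\ge-2\gamma$ they extend or restrict to maps $H_\theta\to H_\theta$, resp. $H_\theta\to L(\mathbb R^d,H_\theta)$, which are (real) $C^1$, resp. $C^3$, with bounded derivatives of the orders $1$, resp. $1,2,3$; and $f(0)=0$, $Df(0)=0$, $g(0)=0$, $Dg(0)=0$, $D^2g(0)=0$. Let $\varphi:[0,\infty)\to[0,1]$ be $C^3$ with $\varphi=1$ on $[0,\frac12]$ and $\varphi=0$ on $[1,\infty)$. A $\gamma$-Hölder rough path on $\mathbb R$ is a pair $\mathbf w=(w,w^2)$, $w_t\in\mathbb R^d$, $w^2_{t,s}\in\mathbb R^d\otimes\mathbb R^d$ ($s\le t$), with $w^2_{t,s}-w^2_{t,u}-w^2_{u,s}=(w_u-w_s)\otimes(w_t-w_u)$ for $s\le u\le t$, such that on every compact interval $w$ is $\gamma$-Hölder and $\|w^2_{t,s}\|\lesssim|t-s|^{2\gamma}$. Let $|w|_\gamma,|w^2|_{2\gamma}$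 be the Hölder constants on $[0,1]$, and $\Theta_\tau\mathbf w=(w_{\cdot+\tau}-w_\tau,\,w^2_{\cdot+\tau,\cdot+\tau})$. $\mathcal D_w=\mathcal D^{2\gamma,\eta}_w([0,1];H)$ is the space of pairs $(y,y')$, $y:[0,1]\to H$ continuous, $y':[0,1]\to L(\mathbb R^d,H)$ continuous in $\|\cdot\|_{-2\gamma}$, for which $y$ is $\gamma$-Hölder in $\|\cdot\|_{-2\gamma}$ with respect to $\hat\delta$ and the following norm is finite: with $\hat\delta y_{t,s}=y_t-S_{t-s}y_s$ and $R^y_{t,s}=\hat\delta y_{t,s}-S_{t-s}y'_s(w_t-w_s)$, $$\|y,y'\|_{\mathcal D_w}=\|y_0\|+\|y'_0\|_{-2\gamma}+\sup_{s<t}\tfrac{\|\hat\delta y_{t,s}\|}{|t-s|^\eta}+\sup_t\|y'_t\|+\sup_{s<t}\tfrac{\|\hat\delta y'_{t,s}\|_{-2\gamma}}{|t-s|^\gamma}+\sup_{s<t}\tfrac{\|R^y_{t,s}\|_{-2\gamma}}{|t-s|^{2\gamma}} .$$ For $R>0$ put $\chi_R(y,y')=\varphi(\|y,y'\|_{\mathcal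 D_w}/R)\,(y,y')=:(\chi_R(y),\chi_R'(y))$, $f_R(y)=f(\chi_R(y))$, $g_R(y)=g(\chi_R(y))$, $(g_R(y))'=Dg(\chi_R(y))\chi_R'(y)$. Rough integrals $\int Q_ug_R(y_u)\,d\mathbf w_u$ are limits in $H_{-2\gamma}$ of $\sum_{[u,v]}Q_u\big(g_R(y)_u(w_v-w_u)+(g_R(y))'_uw^2_{v,u}\big)$ as the mesh tends to $0$. Let $$T_R(w,y,y')=\Big(\int_0^\cdot S_{\cdot-u}f_R(y_u)\,du+\int_0^\cdot S_{\cdot-u}g_R(y_u)\,d\mathbf w_u,\ g_R(y)\Big).$$ $BC_\delta(\mathcal D_w)$ is the space of sequences $(\mathbf y,\mathbf y')=(y^{i-1},(y^{i-1})')_{i\in\mathbb Z,\,i\le 0}$ with $(y^{i-1},(y^{i-1})')\in\mathcal D_{\Theta_{i-1}w}$, $y^{i-1}_0=y^{i-2}_1$ and finite norm $\sup_{i\le 0}e^{-\delta(i-1)}\|y^{i-1},(y^{i-1})'\|_{\mathcal D_{\Theta_{i-1}w}}$. For a radius function $R(\cdot)>0$ on rough paths, $\xi\in H_u$, $i\le0$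 and $t\in[0,1]$, write $R_k=R(\Theta_{k-1}\mathbf w)$, $F^k_u=f_{R_k}(y^{k-1})_u$, $G^k_u=g_{R_k}(y^{k-1})_u$ (cut-off with respect to the norm of $\mathcal D_{\Theta_{k-1}w}$) and define $J_{R,d}(w,\mathbf y,\xi)=(J^1,J^2)$ by $$\begin{aligned}J^1[i-1,t]=\ &S^u_{t+i-1}\xi-\sum_{k=i+1}^{0}S^u_{t+i-1-k}\Big(\int_0^1S^u_{1-u}F^k_u\,du+\int_0^1S^u_{1-u}G^k_u\,d\Theta_{k-1}\mathbf w_u\Big)\\&-\int_t^1S^u_{t-u}F^i_u\,du-\int_t^1S^u_{t-u}G^i_u\,d\Theta_{i-1}\mathbf w_u\\&+\sum_{k=-\infty}^{i-1}S^s_{t+i-1-k}\Big(\int_0^1S^s_{1-u}F^k_u\,du+\int_0^1S^s_{1-u}G^k_u\,d\Theta_{k-1}\mathbf w_u\Big)\\&+\int_0^tS^s_{t-u}F^i_u\,du+\int_0^tS^s_{t-u}G^i_u\,d\Theta_{i-1}\mathbf w_u,\qquad J^2[i-1,t]=G^i_t .\end{aligned}$$ **Theorem.** There are constants $C_f(\rho,R)$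 and $C_g(\rho,R)$ ($\rho\ge0$, $R\ge0$), the first depending on $f$ and not on $g$, the second on $g$ and not on $f$ (and both on $A,\gamma,\eta,d,\varphi$), which are continuous and strictly increasing in $R$, vanish at $R=0$ and tend to $\infty$ as $R\to\infty$, such that the following holds. With $$\Lambda_w(R)=C_f(|w|_\gamma,R)+C_g(|w|_\gamma,R)\,(1+|w|_\gamma+|w^2|_{2\gamma})(1+|w|_\gamma)^2,$$ for every $\mathbf w$ and $0<R\le1$ the map $T_R(w,\cdot)$ sends $\mathcal D_w$ into itself and is Lipschitz with constant $\Lambda_w(R)$. For every $K>0$ and every $\mathbf w$ the equation $\Lambda_w(\tilde R)=K$ has a unique solution $\tilde R(w)>0$; let $R(w)=\min\{\tilde R(w),1\}$. If $K$ satisfies, for some constant $C\ge1$, the gap condition $$K\left(\frac{e^{\beta+\delta}(Ce^{-\delta}+1)}{1-e^{-(\beta+\delta)}}+\frac{(e^{-(\alpha-\delta)}-1)(Ce^{-\delta}+e^{\alpha-\delta})}{1-e^{\alpha-\delta}}\right)\le\frac12,$$ then for every $\gamma$-Hölder rough path $\mathbf w$ on $\mathbb R$ and every $\xi\in H_u$: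 all integrals and series in $J_{R,d}(w,\mathbf y,\xi)$ converge for $\mathbf y\in BC_\delta(\mathcal D_w)$, and $J_{R,d}(w,\cdot,\xi)$ maps $BC_\delta(\mathcal D_w)$ into itself and satisfies $$\|J_{R,d}(w,\mathbf y,\xi)-J_{R,d}(w,\mathbf v,\xi)\|_{BC_\delta}\le\tfrac12\|\mathbf y-\mathbf v,(\mathbf y-\mathbf v)'\|_{BC_\delta};$$ hence it has a unique fixed point $\Gamma(\xi,w)\in BC_\delta(\mathcal D_w)$. The map $H_u\ni\xi\mapsto\Gamma(\xi,w)\in BC_\delta(\mathcal D_w)$ is Lipschitz continuous. -/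

import Mathlib

open Set Filter Topology

noncomputable section

namespace REE

/-! ## The linear part: generator, semigroup, spectral splitting, interpolation spaces -/

section Linear

variable {𝕜 H : Type*} [RCLike 𝕜] [NormedAddCommGroup H] [InnerProductSpace 𝕜 H]

/-- Orthogonal projection `π^u` onto the span of the first `N` vectors of an orthonormal basis. -/
def projU (b : HilbertBasis ℕ 𝕜 H) (N : ℕ) : H →L[𝕜] H :=
  ∑ k ∈ Finset.range N, (innerSL 𝕜 (b k)).smulRight (b k)

/-- The group `e^{r A_u} π^u`, `r ∈ ℝ`, for an operator with `A b_k = lam_k b_k`, where the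
unstable space is the span of the first `N` eigenvectors. -/
def expU (b : HilbertBasis ℕ 𝕜 H) (lam : ℕ → 𝕜) (N : ℕ) (r : ℝ) : H →L[𝕜] H :=
  ∑ k ∈ Finset.range N, NormedSpace.exp ((r : 𝕜) * lam k) • (innerSL 𝕜 (b k)).smulRight (b k)

variable (𝕜 H) in
/-- The standing assumptions on the linear part: `A` generates the analytic `C₀`-semigroup `S`
on `H`, `H` has an orthonormal basis of eigenvectors of `A`, finitely many (at least one) of the
eigenvalues have positive real part, the others have negative real part, and the exponential
dichotomy with rates `0 < β < α` holds. -/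
structure LinearPart where
  /-- the generator, an unbounded operator -/
  A : H →ₗ.[𝕜] H
  /-- the semigroup; only the values at times `t ≥ 0` matter -/
  S : ℝ → H →L[𝕜] H
  S_zero : S 0 = 1
  S_add : ∀ s t : ℝ, 0 ≤ s → 0 ≤ t → S (s + t) = (S s).comp (S t)
  S_continuous : ∀ x : H, Tendsto (fun t : ℝ => S t x) (𝓝[>] 0) (𝓝 x)
  /-- `A` is the infinitesimal generator of `S` -/
  generator : ∀ x y : H, (x, y) ∈ A.graph ↔
    Tendsto (fun t : ℝ => ((t⁻¹ : ℝ) : 𝕜) • (S t x - x)) (𝓝[>] 0) (𝓝 y)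
  /-- analyticity of `S`: `S t` maps `H` into the domain of `A` and `t ‖A S_t‖` is bounded for
  small `t`; this characterization makes sense over `ℝ` and over `ℂ` -/
  analytic : ∃ M : ℝ, ∀ t : ℝ, 0 < t → t ≤ 1 → ∀ x : H, ∃ y : H,
    (S t x, y) ∈ A.graph ∧ t * ‖y‖ ≤ M * ‖x‖
  /-- the orthonormal basis of eigenvectors and the eigenvalues -/
  b : HilbertBasis ℕ 𝕜 H
  lam : ℕ → 𝕜
  eigen : ∀ k, (b k, lam k • b k) ∈ A.graph
  /-- number of unstable eigenvalues -/
  N : ℕ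
  N_pos : 0 < N
  unstable : ∀ k, k < N → 0 < RCLike.re (lam k)
  stable : ∀ k, N ≤ k → RCLike.re (lam k) < 0
  α : ℝ
  β : ℝ
  β_pos : 0 < β
  β_lt_α : β < α
  dichotomy_u : ∀ t : ℝ, t ≤ 0 → ∀ x : H, projU b N x = x →
    ‖expU b lam N t x‖ ≤ Real.exp (α * t) * ‖x‖
  dichotomy_s : ∀ t : ℝ, 0 ≤ t → ∀ x : H, projU b N x = 0 →
    ‖S t x‖ ≤ Real.exp (-β * t) * ‖x‖

namespace LinearPart

variable (L : LinearPart 𝕜 H)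

theorem lam_ne_zero (k : ℕ) : L.lam k ≠ 0 := by
  intro h
  rcases lt_or_ge k L.N with hk | hk
  · have := L.unstable k hk
    simp [h] at this
  · have := L.stable k hk
    simp [h] at this

/-- `π^u`. -/
def πu : H →L[𝕜] H := projU L.b L.N

/-- The unstable space `H_u`. -/
def Hu : Submodule 𝕜 H := LinearMap.range (L.πu : H →ₗ[𝕜] H)

/-- `S^u_r π^u = e^{r A_u} π^u` for all `r ∈ ℝ`. -/
def Su (r : ℝ) : H →L[𝕜] H := expU L.b L.lam L.N r

/-- `S^s_r π^s = S_r (1 - π^u)` for `r ≥ 0`. -/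
def Ss (r : ℝ) : H →L[𝕜] H := (L.S r).comp (1 - L.πu)

/-- The weight `δ = (α - β) / 2` of the sequence space. -/
def δ : ℝ := (L.α - L.β) / 2

/-- The coefficients of a vector in the eigenbasis. -/
def coef (x : H) : ℕ → 𝕜 := fun k => L.b.repr x k

/-- The norm `‖(-A)^θ x‖` of `H_θ` for (the coefficients of) a vector of `H`; it is used below
only for `θ ≤ 0`, where `H ⊆ H_θ`, so that the sum is finite. -/
def nrm (θ : ℝ) (x : H) : ℝ :=
  Real.sqrt (∑' k, (‖L.lam k‖ ^ θ * ‖L.coef x k‖) ^ 2)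

/-- The norm of `L(ℝ^d, H_θ)`. -/
def nrmOp {d : ℕ} (θ : ℝ) (T : EuclideanSpace ℝ (Fin d) → H) : ℝ :=
  ⨆ a : Metric.closedBall (0 : EuclideanSpace ℝ (Fin d)) 1, L.nrm θ (T a)

/-- The interpolation space `H_θ = Dom((-A)^θ)`, `θ ∈ ℝ` (the completion of `H` for `θ < 0`), in
coordinates with respect to the eigenbasis: the sequences `x` with
`∑ (|lam_k|^θ |x_k|)² < ∞`, as a real vector space. -/
def HsSub (θ : ℝ) : Submodule ℝ (ℕ → 𝕜) where
  carrier := {x | Memℓp (fun k => (‖L.lam k‖ ^ θ) • x k) 2}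
  zero_mem' := by
    have : (fun k => (‖L.lam k‖ ^ θ) • (0 : ℕ → 𝕜) k) = 0 := by ext k; simp
    simp only [mem_ofPred_eq, this]
    exact zero_memℓp
  add_mem' := by
    intro x y hx hy
    have : (fun k => (‖L.lam k‖ ^ θ) • (x + y) k)
        = (fun k => (‖L.lam k‖ ^ θ) • x k) + (fun k => (‖L.lam k‖ ^ θ) • y k) := by
      ext k; simp [smul_add]
    simp only [mem_ofPred_eq, this] at *
    exact hx.add hy
  smul_mem' := by
    intro c x hx
    have : (fun k => (‖L.lam k‖ ^ θ) • (c • x) k)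
        = c • (fun k => (‖L.lam k‖ ^ θ) • x k) := by
      ext k; simp [smul_comm c]
    simp only [mem_ofPred_eq, this] at *
    exact hx.const_smul c

/-- `H_θ` as a type of its own, carrying the norm `‖x‖ = (∑ (|lam_k|^θ |x_k|)²)^{1/2}`. -/
def Hs (θ : ℝ) : Type _ := L.HsSub θ

instance (θ : ℝ) : AddCommGroup (L.Hs θ) := inferInstanceAs (AddCommGroup (L.HsSub θ))

instance (θ : ℝ) : Module ℝ (L.Hs θ) := inferInstanceAs (Module ℝ (L.HsSub θ))

/-- The coefficient sequence of an element of `H_θ`. -/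
def Hs.coef {L : LinearPart 𝕜 H} {θ : ℝ} (x : L.Hs θ) : ℕ → 𝕜 := x.1

/-- The isometry `x ↦ (|lam_k|^θ x_k)_k` of `H_θ` into `ℓ²` that defines the norm. -/
def Hs.toLp (θ : ℝ) : L.Hs θ →ₗ[ℝ] lp (fun _ : ℕ => 𝕜) 2 where
  toFun x := ⟨fun k => (‖L.lam k‖ ^ θ) • x.1 k, x.2⟩
  map_add' x y := by
    apply Subtype.ext
    funext k
    exact smul_add _ (x.1 k) (y.1 k)
  map_smul' c x := by
    apply Subtype.ext
    funext k
    exact smul_comm _ c (x.1 k)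

theorem Hs.toLp_injective (θ : ℝ) : Function.Injective (Hs.toLp L θ) := by
  intro x y h
  apply Subtype.ext
  funext k
  have h1 : (‖L.lam k‖ ^ θ) • x.1 k = (‖L.lam k‖ ^ θ) • y.1 k :=
    congrFun (congrArg Subtype.val h) k
  have h2 : ‖L.lam k‖ ^ θ ≠ 0 := (Real.rpow_pos_of_pos (norm_pos_iff.2 (L.lam_ne_zero k)) θ).ne'
  exact smul_right_injective 𝕜 h2 h1

instance (θ : ℝ) : NormedAddCommGroup (L.Hs θ) :=
  NormedAddCommGroup.induced (L.Hs θ) (lp (fun _ : ℕ => 𝕜) 2) (Hs.toLp L θ) (Hs.toLp_injective L θ)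

instance (θ : ℝ) : NormedSpace ℝ (L.Hs θ) :=
  NormedSpace.induced ℝ (L.Hs θ) (lp (fun _ : ℕ => 𝕜) 2) (Hs.toLp L θ)

end LinearPart

end Linear

/-! ## Rough paths on the real line -/

/-- A `γ`-Hölder rough path over `ℝ^d` on `ℝ`: `path t = w_t`, `area t s = w²_{t,s}` for `s ≤ t`,
with Chen's relation, and with the Hölder bounds on every compact interval (these and Chen's
relation imply continuity). -/
structure RoughPath (γ : ℝ) (d : ℕ) where
  path : ℝ → EuclideanSpace ℝ (Fin d)
  area : ℝ → ℝ → EuclideanSpace ℝ (Fin d × Fin d)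
  chen : ∀ s u t : ℝ, s ≤ u → u ≤ t → ∀ i j : Fin d,
    area t s (i, j) - area t u (i, j) - area u s (i, j)
      = (path u - path s) i * (path t - path u) j
  path_holder : ∀ T : ℝ, 0 < T → ∃ M : ℝ, ∀ s t : ℝ, -T ≤ s → s ≤ t → t ≤ T →
    ‖path t - path s‖ ≤ M * (t - s) ^ γ
  area_holder : ∀ T : ℝ, 0 < T → ∃ M : ℝ, ∀ s t : ℝ, -T ≤ s → s ≤ t → t ≤ T →
    ‖area t s‖ ≤ M * (t - s) ^ (2 * γ)

/-- The unit time interval. -/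
abbrev I01 : Type := Icc (0 : ℝ) 1

/-- The simplex of pairs `(t, s)` with `s ≤ t` in `[0,1]`. -/
abbrev Simplex : Type := {q : I01 × I01 // q.2 ≤ q.1}

/-- `sup_{s ≤ t} q(t,s) / (t-s)^r` over the simplex (pairs with `s = t` contribute `0` if
`q(t,t) = 0`). -/
def holderSup (r : ℝ) (q : I01 → I01 → ℝ) : ℝ :=
  ⨆ z : Simplex, q z.1.1 z.1.2 / ((z.1.1 : ℝ) - (z.1.2 : ℝ)) ^ r

/-- The supremum in `holderSup` is finite. -/
def HolderFinite (r : ℝ) (q : I01 → I01 → ℝ) : Prop :=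
  BddAbove (range fun z : Simplex => q z.1.1 z.1.2 / ((z.1.1 : ℝ) - (z.1.2 : ℝ)) ^ r)

namespace RoughPath

variable {γ : ℝ} {d : ℕ}

/-- `|w|_γ` on `[0,1]`. -/
def norm1 (w : RoughPath γ d) : ℝ := holderSup γ fun t s => ‖w.path t - w.path s‖

/-- `|w²|_{2γ}` on `[0,1]`. -/
def norm2 (w : RoughPath γ d) : ℝ := holderSup (2 * γ) fun t s => ‖w.area t s‖

/-- The time shift `Θ_τ`: `(θ_τ w)_t = w_{t+τ} - w_τ`, `(θ_τ w²)_{t,s} = w²_{t+τ,s+τ}`. -/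
def shift (τ : ℝ) (w : RoughPath γ d) : RoughPath γ d where
  path t := w.path (t + τ) - w.path τ
  area t s := w.area (t + τ) (s + τ)
  chen s u t h1 h2 i j := by
    have := w.chen (s + τ) (u + τ) (t + τ) (by linarith) (by linarith) i j
    simpa using this
  path_holder T hT := by
    obtain ⟨M, hM⟩ := w.path_holder (T + |τ|) (by positivity)
    refine ⟨M, fun s t h1 h2 h3 => ?_⟩
    have a1 := neg_abs_le τ
    have a2 := le_abs_self τ
    have := hM (s + τ) (t + τ) (by linarith) (by linarith) (by linarith)
    simpa using this
  area_holder T hT := by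
    obtain ⟨M, hM⟩ := w.area_holder (T + |τ|) (by positivity)
    refine ⟨M, fun s t h1 h2 h3 => ?_⟩
    have a1 := neg_abs_le τ
    have a2 := le_abs_self τ
    have := hM (s + τ) (t + τ) (by linarith) (by linarith) (by linarith)
    simpa using this

end RoughPath

/-! ## Nonlinearities, mildly controlled rough paths, integrals -/

section Main

variable {𝕜 H : Type*} [RCLike 𝕜] [NormedAddCommGroup H] [InnerProductSpace 𝕜 H]
  [NormedSpace ℝ H] {d : ℕ}

/-- The drift: `f ∈ C¹_{-2γ,0}(H, H)`, that is, for every `θ ≥ -2γ`, `f` extends (`θ < 0`) or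
restricts (`θ > 0`) to a `C¹` map of `H_θ` with bounded derivative (in particular it is globally
Lipschitz there); moreover `f(0) = 0` and `Df(0) = 0`. Derivatives are real ones. -/
structure IsDrift (L : LinearPart 𝕜 H) (γ : ℝ) (f : H → H) : Prop where
  scale : ∀ θ : ℝ, -2 * γ ≤ θ → ∃ F : L.Hs θ → L.Hs θ,
    ContDiff ℝ 1 F ∧ (∃ M : ℝ, ∀ x, ‖fderiv ℝ F x‖ ≤ M) ∧
    ∀ (x : H) (x' : L.Hs θ), x'.coef = L.coef x → (F x').coef = L.coef (f x)
  map_zero : f 0 = 0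
  fderiv_zero : fderiv ℝ f 0 = 0

/-- The diffusion coefficient: `g ∈ C³_{-2γ,0}(H, L(ℝ^d, H))` in the same sense, with
`g(0) = 0`, `Dg(0) = 0` and `D²g(0) = 0`. -/
structure IsDiffusion (L : LinearPart 𝕜 H) (γ : ℝ)
    (g : H → EuclideanSpace ℝ (Fin d) →L[ℝ] H) : Prop where
  scale : ∀ θ : ℝ, -2 * γ ≤ θ → ∃ G : L.Hs θ → EuclideanSpace ℝ (Fin d) →L[ℝ] L.Hs θ,
    ContDiff ℝ 3 G ∧
    (∀ i : ℕ, 1 ≤ i → i ≤ 3 → ∃ M : ℝ, ∀ x, ‖iteratedFDeriv ℝ i G x‖ ≤ M) ∧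
    ∀ (x : H) (x' : L.Hs θ), x'.coef = L.coef x → ∀ a, (G x' a).coef = L.coef (g x a)
  map_zero : g 0 = 0
  fderiv_zero : fderiv ℝ g 0 = 0
  fderiv2_zero : iteratedFDeriv ℝ 2 g 0 = 0

/-- The scalar cut-off function `φ : [0,∞) → [0,1]`: `C³`, equal to `1` on `[0,1/2]` and to `0`
on `[1,∞)` (hence with bounded derivatives). -/
structure IsCutoff (φ : ℝ → ℝ) : Prop where
  contDiff : ContDiffOn ℝ 3 φ (Ici 0)
  mem_Icc : ∀ r, 0 ≤ r → φ r ∈ Icc (0 : ℝ) 1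
  eq_one : ∀ r, 0 ≤ r → r ≤ 1 / 2 → φ r = 1
  eq_zero : ∀ r, 1 ≤ r → φ r = 0

variable (H d) in
/-- Pairs `(y, y')` of functions on `[0,1]` with values in `H` and in `L(ℝ^d, H)`. -/
abbrev Pair : Type _ := (I01 → H) × (I01 → EuclideanSpace ℝ (Fin d) →L[ℝ] H)

/-- `(δ̂y)_{t,s} = y_t - S_{t-s} y_s`. -/
def hatDelta (L : LinearPart 𝕜 H) (y : I01 → H) (t s : I01) : H :=
  y t - L.S ((t : ℝ) - s) (y s)

/-- `(δ̂y')_{t,s}` for `y'` with values in `L(ℝ^d, H)`, as a function on `ℝ^d`. -/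
def hatDeltaOp (L : LinearPart 𝕜 H) (y' : I01 → EuclideanSpace ℝ (Fin d) →L[ℝ] H) (t s : I01) :
    EuclideanSpace ℝ (Fin d) → H :=
  fun a => y' t a - L.S ((t : ℝ) - s) (y' s a)

/-- The remainder `R^y_{t,s} = (δ̂y)_{t,s} - S_{t-s} y'_s (w_t - w_s)`. -/
def remainder (L : LinearPart 𝕜 H) {γ : ℝ} (w : RoughPath γ d) (p : Pair H d) (t s : I01) : H :=
  hatDelta L p.1 t s - L.S ((t : ℝ) - s) (p.2 s (w.path t - w.path s))

/-- Membership of `(y, y')` in the space `D^{2γ,η}_w([0,1]; H)`: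
`y` and `y'` are in the `γ`-Hölder spaces (with respect to `δ̂`) over `H_{-2γ}`,
`R^y` is `2γ`-Hölder in `H_{-2γ}`, `y` is continuous in `H` and `η`-Hölder
(with respect to `δ̂`) in `H`, and `y'` is bounded in `L(ℝ^d, H)`. (As `y'` is continuous in
`H_{-2γ}`, its essential supremum in `H` is a supremum. Continuity of `y` in `H_{-2γ}` follows
from continuity in `H`, and continuity of `R^y` follows from that of `y`, `y'` and `w`.) -/
structure MemD (L : LinearPart 𝕜 H) {γ : ℝ} (η : ℝ) (w : RoughPath γ d) (p : Pair H d) : Prop where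
  cont : Continuous p.1
  cont' : ∀ t : I01, Tendsto (fun s => L.nrmOp (-2 * γ) (fun a => p.2 s a - p.2 t a)) (𝓝 t) (𝓝 0)
  holder : HolderFinite γ fun t s => L.nrm (-2 * γ) (hatDelta L p.1 t s)
  holder' : HolderFinite γ fun t s => L.nrmOp (-2 * γ) (hatDeltaOp L p.2 t s)
  rem : HolderFinite (2 * γ) fun t s => L.nrm (-2 * γ) (remainder L w p t s)
  holder_eta : HolderFinite η fun t s => ‖hatDelta L p.1 t s‖
  bdd' : BddAbove (range fun t => ‖p.2 t‖)

/-- The norm of `D^{2γ,η}_w([0,1]; H)`: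
`‖y_0‖ + ‖y'_0‖_{-2γ} + ‖y‖_{η,0} + ‖y'‖_{∞,0} + ‖y'‖_{γ,-2γ} + |R^y|_{2γ,-2γ}`. -/
def normD (L : LinearPart 𝕜 H) {γ : ℝ} (η : ℝ) (w : RoughPath γ d) (p : Pair H d) : ℝ :=
  ‖p.1 0‖ + L.nrmOp (-2 * γ) (fun a => p.2 0 a)
    + holderSup η (fun t s => ‖hatDelta L p.1 t s‖)
    + (⨆ t, ‖p.2 t‖)
    + (holderSup γ (fun t s => L.nrmOp (-2 * γ) (hatDeltaOp L p.2 t s))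
      + holderSup (2 * γ) (fun t s => L.nrm (-2 * γ) (remainder L w p t s)))

/-- `z' w² = ∑_{i,j} w²^{ij} z'(e_i)(e_j)` for `z' ∈ L(ℝ^d, L(ℝ^d, H)) = L(ℝ^d ⊗ ℝ^d, H)`. -/
def contract
    (z' : EuclideanSpace ℝ (Fin d) →L[ℝ] EuclideanSpace ℝ (Fin d) →L[ℝ] H)
    (m : EuclideanSpace ℝ (Fin d × Fin d)) : H :=
  ∑ i : Fin d, ∑ j : Fin d,
    m (i, j) • z' (EuclideanSpace.single i (1 : ℝ)) (EuclideanSpace.single j (1 : ℝ))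

/-- The extension of a function on `[0,1]` to `ℝ` by constants (only the values on `[0,1]` are
used). -/
abbrev ext01 {X : Type*} (y : I01 → X) : ℝ → X := IccExtend zero_le_one y

/-- `I = ∫_s^t Q_u z_u d𝐰_u` as the limit in `H_{-2γ}`, as the mesh of the partition
`s = τ_0 ≤ … ≤ τ_n = t` tends to `0`, of the sums
`∑_j Q_{τ_j} (z_{τ_j} (w_{τ_{j+1}} - w_{τ_j}) + z'_{τ_j} w²_{τ_{j+1}, τ_j})`. -/
def IsRoughIntegral (L : LinearPart 𝕜 H) {γ : ℝ} (w : RoughPath γ d) (Q : ℝ → H →L[𝕜] H)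
    (z : I01 → EuclideanSpace ℝ (Fin d) →L[ℝ] H)
    (z' : I01 → EuclideanSpace ℝ (Fin d) →L[ℝ] EuclideanSpace ℝ (Fin d) →L[ℝ] H)
    (s t : ℝ) (I : H) : Prop :=
  ∀ ε : ℝ, 0 < ε → ∃ ρ : ℝ, 0 < ρ ∧ ∀ (n : ℕ) (τ : ℕ → ℝ), Monotone τ → τ 0 = s → τ n = t →
    (∀ j < n, τ (j + 1) - τ j < ρ) →
    L.nrm (-2 * γ) ((∑ j ∈ Finset.range n, Q (τ j)
      (ext01 z (τ j) (w.path (τ (j + 1)) - w.path (τ j))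
        + contract (ext01 z' (τ j)) (w.area (τ (j + 1)) (τ j)))) - I) < ε

open Classical in
/-- The rough integral (with the value `0` where the limit does not exist). -/
def roughIntegral (L : LinearPart 𝕜 H) {γ : ℝ} (w : RoughPath γ d) (Q : ℝ → H →L[𝕜] H)
    (z : I01 → EuclideanSpace ℝ (Fin d) →L[ℝ] H)
    (z' : I01 → EuclideanSpace ℝ (Fin d) →L[ℝ] EuclideanSpace ℝ (Fin d) →L[ℝ] H)
    (s t : ℝ) : H :=
  if h : ∃ I, IsRoughIntegral L w Q z z' s t I then h.choose else 0

/-- The data of the truncated problem apart from the noise. -/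
structure Data (𝕜 H : Type*) [RCLike 𝕜] [NormedAddCommGroup H] [InnerProductSpace 𝕜 H]
    [NormedSpace ℝ H] (d : ℕ) where
  L : LinearPart 𝕜 H
  η : ℝ
  φ : ℝ → ℝ
  f : H → H
  g : H → EuclideanSpace ℝ (Fin d) →L[ℝ] H

namespace Data

variable {γ : ℝ} (D : Data 𝕜 H d)

/-- The cut-off `χ_R(y, y') = φ(‖y, y'‖_{D_w} / R) (y, y')` of a controlled path. -/
def χ (w : RoughPath γ d) (R : ℝ) (p : Pair H d) : Pair H d :=
  D.φ (normD D.L D.η w p / R) • p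

/-- `f_R(y)_t = f(χ_R(y)_t)`. -/
def fR (w : RoughPath γ d) (R : ℝ) (p : Pair H d) : I01 → H :=
  fun t => D.f ((D.χ w R p).1 t)

/-- `g_R(y)_t = g(χ_R(y)_t)`. -/
def gR (w : RoughPath γ d) (R : ℝ) (p : Pair H d) : I01 → EuclideanSpace ℝ (Fin d) →L[ℝ] H :=
  fun t => D.g ((D.χ w R p).1 t)

/-- The mild Gubinelli derivative `(g_R(y))'_t = Dg(χ_R(y)_t) χ_R'(y)_t`. -/
def gR' (w : RoughPath γ d) (R : ℝ) (p : Pair H d) :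
    I01 → EuclideanSpace ℝ (Fin d) →L[ℝ] EuclideanSpace ℝ (Fin d) →L[ℝ] H :=
  fun t => (fderiv ℝ D.g ((D.χ w R p).1 t)).comp ((D.χ w R p).2 t)

/-- `∫_s^t Q_{r-u} f_R(y_u) du + ∫_s^t Q_{r-u} g_R(y_u) d𝐰_u`. -/
def conv (w : RoughPath γ d) (R : ℝ) (p : Pair H d) (Q : ℝ → H →L[𝕜] H) (r s t : ℝ) : H :=
  (∫ u in s..t, Q (r - u) (ext01 (D.fR w R p) u))
    + roughIntegral D.L w (fun u => Q (r - u)) (D.gR w R p) (D.gR' w R p) s t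

/-- Both integrals in `conv` exist. -/
def ConvExists (w : RoughPath γ d) (R : ℝ) (p : Pair H d) (Q : ℝ → H →L[𝕜] H) (r s t : ℝ) :
    Prop :=
  IntervalIntegrable (fun u => Q (r - u) (ext01 (D.fR w R p) u)) MeasureTheory.volume s t
    ∧ ∃ I, IsRoughIntegral D.L w (fun u => Q (r - u)) (D.gR w R p) (D.gR' w R p) s t I

/-- The truncated solution map
`T_R(w, y, y') = (∫_0^· S_{·-u} f_R(y_u) du + ∫_0^· S_{·-u} g_R(y_u) d𝐰_u, g_R(y))`. -/
def TR (w : RoughPath γ d) (R : ℝ) (p : Pair H d) : Pair H d :=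
  (fun t => D.conv w R p D.L.S t 0 t, D.gR w R p)

end Data

/-! ## The random cut-off and the discretized Lyapunov–Perron map -/

/-- The left-hand side, as a function of `r`, of the equation for the cut-off radius:
`C_f(|w|_γ, r) + C_g(|w|_γ, r) (1 + |w|_γ + |w²|_{2γ}) (1 + |w|_γ)²`. -/
def cutoffBound (Cf Cg : ℝ → ℝ → ℝ) {γ : ℝ} (w : RoughPath γ d) (r : ℝ) : ℝ :=
  Cf w.norm1 r + Cg w.norm1 r * (1 + w.norm1 + w.norm2) * (1 + w.norm1) ^ 2

/-- Lipschitz constants depending on the cut-off radius `r ≥ 0`: continuous, strictly increasing,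
zero at `r = 0`, and unbounded. -/
structure IsRadiusConst (h : ℝ → ℝ) : Prop where
  cont : ContinuousOn h (Ici 0)
  mono : StrictMonoOn h (Ici 0)
  zero : h 0 = 0
  top : Tendsto h atTop atTop

variable (H d) in
/-- Sequences `(y^{i-1}, (y^{i-1})')_{i ∈ ℤ, i ≤ 0}`; the index `n : ℕ` stands for `i = -n`. -/
abbrev LPSeq : Type _ := ℕ → Pair H d

/-- The noise on the `n`-th unit interval: `Θ_{i-1} 𝐰` with `i = -n`. -/
def noise {γ : ℝ} (w : RoughPath γ d) (n : ℕ) : RoughPath γ d := w.shift (-((n : ℝ) + 1))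

/-- Membership in `BC_δ(D^{2γ,η}_w)`: `(y^{i-1}, (y^{i-1})')` is controlled by `Θ_{i-1} 𝐰`,
`y^{i-1}_0 = y^{i-2}_1`, and `sup_i e^{-δ(i-1)} ‖y^{i-1}, (y^{i-1})'‖ < ∞`. -/
structure MemBC (L : LinearPart 𝕜 H) {γ : ℝ} (η : ℝ) (w : RoughPath γ d) (p : LPSeq H d) :
    Prop where
  memD : ∀ n, MemD L η (noise w n) (p n)
  glue : ∀ n, (p n).1 0 = (p (n + 1)).1 1
  bdd : BddAbove (range fun n : ℕ => Real.exp (L.δ * (n + 1)) * normD L η (noise w n) (p n))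

/-- The norm of `BC_δ(D^{2γ,η}_w)`. -/
def normBC (L : LinearPart 𝕜 H) {γ : ℝ} (η : ℝ) (w : RoughPath γ d) (p : LPSeq H d) : ℝ :=
  ⨆ n : ℕ, Real.exp (L.δ * (n + 1)) * normD L η (noise w n) (p n)

namespace Data

variable {γ : ℝ} (D : Data 𝕜 H d)

/-- `conv` on the `n`-th unit interval, with noise `Θ_{i-1} 𝐰` and radius `R(Θ_{i-1} 𝐰)`. -/
def convN (R : RoughPath γ d → ℝ) (w : RoughPath γ d) (p : LPSeq H d) (n : ℕ)
    (Q : ℝ → H →L[𝕜] H) (r s t : ℝ) : H :=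
  D.conv (noise w n) (R (noise w n)) (p n) Q r s t

/-- The discretized Lyapunov–Perron map `J_{R,d}(w, 𝐲, ξ)`. With `i = -n`, and `k = -m` in the
finite sum, `k = -(n+1+m)` in the series:
`J¹[i-1,t] = S^u_{t+i-1} ξ^u - ∑_{k=i+1}^0 S^u_{t+i-1-k} T^u(Θ_{k-1}𝐰, y^{k-1})[1]
  - T̃^u(Θ_{i-1}𝐰, y^{i-1})[t]
  + ∑_{k=-∞}^{i-1} S^s_{t+i-1-k} T^s(Θ_{k-1}𝐰, y^{k-1})[1] + T^s(Θ_{i-1}𝐰, y^{i-1})[t]`,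
and `J²[i-1,t] = g_R(y^{i-1})_t` is its mild Gubinelli derivative. -/
def J (R : RoughPath γ d → ℝ) (w : RoughPath γ d) (ξ : H) (p : LPSeq H d) : LPSeq H d :=
  fun n =>
    (fun t =>
      D.L.Su ((t : ℝ) - (n + 1)) ξ
      - ∑ m ∈ Finset.range n, D.L.Su ((t : ℝ) - (n + 1) + m) (D.convN R w p m D.L.Su 1 0 1)
      - D.convN R w p n D.L.Su t t 1
      + ∑' m : ℕ, D.L.Ss ((t : ℝ) + m) (D.convN R w p (n + 1 + m) D.L.Ss 1 0 1)
      + D.convN R w p n D.L.Ss t 0 t,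
     D.gR (noise w n) (R (noise w n)) (p n))

/-- All integrals and the series in the definition of `J` converge. -/
def JConverges (R : RoughPath γ d → ℝ) (w : RoughPath γ d) (p : LPSeq H d) : Prop :=
  (∀ (n : ℕ) (t : I01),
    D.ConvExists (noise w n) (R (noise w n)) (p n) D.L.Su 1 0 1 ∧
    D.ConvExists (noise w n) (R (noise w n)) (p n) D.L.Su t t 1 ∧
    D.ConvExists (noise w n) (R (noise w n)) (p n) D.L.Ss t 0 t) ∧
  ∀ (n : ℕ) (t : I01),
    Summable fun m : ℕ => D.L.Ss ((t : ℝ) + m) (D.convN R w p (n + 1 + m) D.L.Ss 1 0 1)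

end Data

/-- The gap condition. -/
def GapCondition (L : LinearPart 𝕜 H) (K C : ℝ) : Prop :=
  K * (Real.exp (L.β + L.δ) * (C * Real.exp (-L.δ) + 1) / (1 - Real.exp (-(L.β + L.δ)))
      + (Real.exp (-(L.α - L.δ)) - 1) * (C * Real.exp (-L.δ) + Real.exp (L.α - L.δ))
        / (1 - Real.exp (L.α - L.δ))) ≤ 1 / 2

end Main

end REE

end

set_option linter.unusedSectionVars false

noncomputable section

set_option maxSynthPendingDepth 3

namespace REE

/-! ### Semigroup and interpolation estimates in eigencoordinates. -/

section LinearTheory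

variable {𝕜 H : Type*} [RCLike 𝕜] [NormedAddCommGroup H] [InnerProductSpace 𝕜 H]

namespace LinearPart

variable (L : LinearPart 𝕜 H)

/-! The theorem is a contraction argument. The cut-off makes the nonlinear one-step map as
contractive as desired on every unit interval, and the exponential dichotomy sums the steps.

Linear part. The semigroup is diagonal in the eigenbasis, so every estimate between `H` and
`H_{-2γ}` is a bound on the multipliers `e^{tλ_k}`. Interpolation gives smoothing `H_{-2γ} → H` at
the cost `t^{-2γ}`, and `S_t - 1 : H → H_{-2γ}` of size `t^{2γ}` (`exists_semigroupBounds`).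

Rough convolution. By Chen's relation the local approximation of `∫ S_{t-u} z_u d𝐰_u` on `[u,v]` has
additivity defect `S_{t-m} x` with `x` of order `(v-u)^{3γ}` in `H_{-2γ}`. As `3γ > 1`, the sewing
lemma compares all partitions in `H_{-2γ}`. Smoothing turns the same defect into an `H`-bound with
weight `(t-m)^{-2γ}`, and dyadic sums still converge in `H` because `γ > 1/3`
(`exists_dyadic_limit`). Together they give `Ctrl.exists_isRoughIntegral`.

Truncation. Since `g` vanishes to third order, the difference of two compositions with `g` is a
controlled integrand of size `m B² E`, where `B` bounds the paths and `E` their distance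
(`Plain.ctrl_comp_sub`). After the cut-off `B` is of order `R`. The drift contributes the supremum
of `‖Df‖` on a small ball. Hence the Lipschitz constant of `T_R` tends to zero with `R`
(`normD_TR_sub_le`), and the radius can be tuned to any prescribed `K`.

Lyapunov–Perron. On each unit interval the map is the local solution `T_R`, which starts at zero,
plus the semigroup orbit of an initial value (`jConverges_and_eq`, `perronSeq`). An orbit costs only
the norm of its initial value, and the initial values are sums of the local end points `T_R[1]`,
propagated backwards along `H_u` and forwards along the stable part. In the weighted norm both sums
are geometric with ratio `e^{-(α-δ)} = e^{-(β+δ)}`. The gap condition makes the total constant at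
most `1/2` (`gap_le`). Completeness of the sequence space gives the fixed point, and the linear
dependence on `ξ` gives the Lipschitz bound. -/

theorem S_comm {s t : ℝ} (hs : 0 ≤ s) (ht : 0 ≤ t) (x : H) : L.S s (L.S t x) = L.S (s + t) x := by
  rw [L.S_add s t hs ht]; rfl

theorem tendsto_S_nhdsGE (x : H) : Tendsto (fun t : ℝ => L.S t x) (𝓝[≥] 0) (𝓝 x) := by
  have h : (𝓝[≥] (0 : ℝ)) = 𝓝[>] 0 ⊔ pure 0 := by
    rw [← Ioi_insert, nhdsWithin_insert, sup_comm]
  rw [h, tendsto_sup]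
  refine ⟨L.S_continuous x, ?_⟩
  rw [tendsto_pure_left]
  intro s hs
  simpa [L.S_zero] using mem_of_mem_nhds hs

/-- Uniform boundedness: otherwise there are times `t_n → 0` with `‖S_{t_n}‖ → ∞`, although `S_{t_n}
x` converges for every `x`. -/
theorem exists_norm_S_le_near [CompleteSpace H] :
    ∃ δ : ℝ, 0 < δ ∧ ∃ M : ℝ, 1 ≤ M ∧ ∀ t : ℝ, 0 ≤ t → t ≤ δ → ‖L.S t‖ ≤ M := by
  by_contra hcon
  push Not at hcon
  have h1 : ∀ n : ℕ, ∃ t : ℝ, 0 ≤ t ∧ t ≤ 1 / ((n : ℝ) + 1) ∧ (n : ℝ) + 1 < ‖L.S t‖ := by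
    intro n
    exact hcon (1 / ((n : ℝ) + 1)) (by positivity) ((n : ℝ) + 1) (by simp)
  choose t ht0 ht1 ht2 using h1
  have hlim : Tendsto t atTop (𝓝[≥] 0) := by
    refine tendsto_nhdsWithin_iff.2 ⟨?_, Eventually.of_forall ht0⟩
    exact squeeze_zero ht0 ht1 tendsto_one_div_add_atTop_nhds_zero_nat
  obtain ⟨C, hC⟩ := banach_steinhaus (g := fun n => L.S (t n)) (by
    intro x
    have := ((L.tendsto_S_nhdsGE x).comp hlim).norm.bddAbove_range
    obtain ⟨C, hC⟩ := this
    exact ⟨C, fun n => hC ⟨n, rfl⟩⟩)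
  obtain ⟨n, hn⟩ := exists_nat_gt C
  have := hC n
  have := ht2 n
  linarith

theorem exists_norm_S_le_Icc [CompleteSpace H] (T : ℝ) :
    ∃ M : ℝ, 1 ≤ M ∧ ∀ t : ℝ, 0 ≤ t → t ≤ T → ‖L.S t‖ ≤ M := by
  obtain ⟨δ, hδ, M, hM, h⟩ := L.exists_norm_S_le_near
  have key : ∀ n : ℕ, ∀ t : ℝ, 0 ≤ t → t ≤ (n + 1) * δ → ‖L.S t‖ ≤ M ^ (n + 1) := by
    intro n
    induction n with
    | zero => intro t h0 h1; simpa using h t h0 (by simpa using h1)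
    | succ n ih =>
      intro t h0 h1
      rcases le_total t δ with h2 | h2
      · refine (h t h0 h2).trans ?_
        calc M = M ^ 1 := (pow_one M).symm
          _ ≤ M ^ (n + 1 + 1) := pow_le_pow_right₀ hM (by omega)
      · have e : L.S t = (L.S δ).comp (L.S (t - δ)) := by
          rw [← L.S_add _ _ hδ.le (by linarith)]; congr 1; ring
        rw [e, pow_succ']
        refine (ContinuousLinearMap.opNorm_comp_le _ _).trans ?_
        have h3 := ih (t - δ) (by linarith) (by push_cast at h1; linarith)
        exact mul_le_mul (h δ hδ.le le_rfl) h3 (norm_nonneg _) (by linarith)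
  obtain ⟨n, hn⟩ := exists_nat_gt (T / δ)
  refine ⟨M ^ (n + 1), one_le_pow₀ hM, fun t h0 h1 => key n t h0 ?_⟩
  rw [div_lt_iff₀ hδ] at hn
  nlinarith

/-- For `s` on either side of `t`, the later value is the operator at the earlier time applied to
`S_{|s-t|} x`. A local norm bound therefore reduces everything to strong continuity at `0`. -/
theorem continuousOn_S [CompleteSpace H] (x : H) : ContinuousOn (fun t => L.S t x) (Ici 0) := by
  intro t ht
  obtain ⟨M, hM, hb⟩ := L.exists_norm_S_le_Icc (t + 1)
  have ht : 0 ≤ t := ht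
  rw [ContinuousWithinAt, tendsto_iff_norm_sub_tendsto_zero]
  have hlim' : Tendsto (fun s => |s - t|) (𝓝[Ici 0] t) (𝓝[≥] 0) := by
    refine tendsto_nhdsWithin_iff.2 ⟨?_, Eventually.of_forall fun s => mem_Ici.2 (abs_nonneg _)⟩
    have : Tendsto (fun s => |s - t|) (𝓝 t) (𝓝 |t - t|) := by
      apply Continuous.tendsto; fun_prop
    simp only [sub_self, abs_zero] at this
    exact this.mono_left nhdsWithin_le_nhds
  have h1 : Tendsto (fun s => M * ‖L.S |s - t| x - x‖) (𝓝[Ici 0] t) (𝓝 0) := by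
    have := (((L.tendsto_S_nhdsGE x).comp hlim').sub_const x).norm.const_mul M
    simpa using this
  refine squeeze_zero' (Eventually.of_forall fun s => norm_nonneg _) ?_ h1
  have h2 : ∀ᶠ s in 𝓝[Ici 0] t, s ≤ t + 1 :=
    nhdsWithin_le_nhds (Iic_mem_nhds (by linarith))
  filter_upwards [h2, self_mem_nhdsWithin] with s hs hs0
  have hs0 : 0 ≤ s := hs0
  rcases le_total s t with h | h
  · have e : L.S t x = L.S s (L.S |s - t| x) := by
      rw [abs_of_nonpos (by linarith), L.S_comm hs0 (by linarith)]; congr 2; ring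
    rw [e, norm_sub_rev, ← map_sub]
    exact (L.S s).le_of_opNorm_le (hb s hs0 hs) _
  · have e : L.S s x = L.S t (L.S |s - t| x) := by
      rw [abs_of_nonneg (by linarith), L.S_comm ht (by linarith)]; congr 2; ring
    rw [e, ← map_sub]
    exact (L.S t).le_of_opNorm_le (hb t ht (by linarith)) _

variable [NormedSpace ℝ H] [IsScalarTower ℝ 𝕜 H]

theorem ofReal_smul (r : ℝ) (x : H) : ((r : ℝ) : 𝕜) • x = r • x := by
  rw [← RCLike.algebraMap_eq_ofReal, algebraMap_smul]

theorem hasDerivWithinAt_S_basis (k : ℕ) {t : ℝ} (ht : 0 ≤ t) :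
    HasDerivWithinAt (fun t => L.S t (L.b k)) (L.lam k • L.S t (L.b k)) (Ici t) t := by
  rw [← hasDerivWithinAt_Ioi_iff_Ici, hasDerivWithinAt_iff_tendsto_slope' (by simp)]
  have h := (L.generator _ _).1 (L.eigen k)
  have h2 := ((L.S t).continuous.tendsto _).comp h
  have h3 : Tendsto (fun s => s - t) (𝓝[>] t) (𝓝[>] 0) := by
    refine tendsto_nhdsWithin_iff.2 ⟨?_, ?_⟩
    · have : Tendsto (fun s => s - t) (𝓝 t) (𝓝 (t - t)) := by
        apply Continuous.tendsto; fun_prop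
      rw [sub_self] at this
      exact this.mono_left nhdsWithin_le_nhds
    · filter_upwards [self_mem_nhdsWithin] with s hs
      exact mem_Ioi.2 (sub_pos.2 (mem_Ioi.1 hs))
  have h4 := h2.comp h3
  rw [map_smul] at h4
  refine h4.congr' ?_
  filter_upwards [self_mem_nhdsWithin] with s hs
  have hs : t < s := hs
  simp only [Function.comp, map_smul, map_sub, slope, vsub_eq_sub]
  rw [L.S_comm ht (by linarith), ofReal_smul]
  congr 4; ring

/-- The function `e^{-tλ_k} S_t b_k` has right derivative zero, hence is constant. The generator
supplies right derivatives only, which together with continuity are enough. -/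
theorem S_basis [CompleteSpace H] (k : ℕ) {t : ℝ} (ht : 0 ≤ t) :
    L.S t (L.b k) = NormedSpace.exp ((t : 𝕜) * L.lam k) • L.b k := by
  let _ : NormedAlgebra ℚ 𝕜 := .restrictScalars ℚ ℝ 𝕜
  have hder : ∀ s : ℝ, HasDerivAt (fun s : ℝ => NormedSpace.exp (s • (-L.lam k)))
      (NormedSpace.exp (s • (-L.lam k)) * (-L.lam k)) s := fun s =>
    hasDerivAt_exp_smul_const (𝕂 := ℝ) (-L.lam k) s
  have hcont : ContinuousOn (fun s : ℝ => NormedSpace.exp (s • (-L.lam k)) • L.S s (L.b k))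
      (Icc 0 t) := by
    refine ContinuousOn.smul ?_ ((L.continuousOn_S _).mono Icc_subset_Ici_self)
    exact fun s _ => (hder s).continuousAt.continuousWithinAt
  have hconst := constant_of_has_deriv_right_zero hcont (by
    intro s hs
    have h1 := ((hder s).hasDerivWithinAt (s := Ici s)).smul (L.hasDerivWithinAt_S_basis k hs.1)
    refine h1.congr_deriv ?_
    rw [smul_smul, mul_neg, neg_smul, add_neg_cancel]) t ⟨ht, le_rfl⟩
  simp only [zero_smul, NormedSpace.exp_zero, L.S_zero, one_smul,
    one_apply_eq_self] at hconst
  have e : (t : 𝕜) * L.lam k = t • L.lam k := by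
    rw [← RCLike.real_smul_eq_coe_mul]
  rw [e]
  conv_rhs => rw [← hconst]
  rw [smul_smul, ← NormedSpace.exp_add_of_commute ((Commute.refl (L.lam k)).smul_left t |>.smul_right t |>.neg_right |> fun h => by simp)]
  simp

/-! ### Coefficients -/

theorem coef_eq (x : H) (k : ℕ) : L.coef x k = inner 𝕜 (L.b k) x := L.b.repr_apply_apply x k

theorem coef_add (x y : H) (k : ℕ) : L.coef (x + y) k = L.coef x k + L.coef y k := by
  simp [coef]

theorem coef_sub (x y : H) (k : ℕ) : L.coef (x - y) k = L.coef x k - L.coef y k := by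
  simp [coef]

theorem coef_smul (c : 𝕜) (x : H) (k : ℕ) : L.coef (c • x) k = c * L.coef x k := by
  simp [coef]

theorem coef_rsmul (c : ℝ) (x : H) (k : ℕ) : L.coef (c • x) k = c • L.coef x k := by
  rw [← ofReal_smul (𝕜 := 𝕜), coef_smul, RCLike.real_smul_eq_coe_mul]

theorem coef_injective {x y : H} (h : ∀ k, L.coef x k = L.coef y k) : x = y := by
  apply L.b.repr.injective
  ext k
  exact h k

theorem hasSum_coef (x : H) : HasSum (fun k => L.coef x k • L.b k) x := L.b.hasSum_repr x

theorem hasSum_norm_coef_sq (x : H) : HasSum (fun k => ‖L.coef x k‖ ^ 2) (‖x‖ ^ 2) := by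
  have h := lp.hasSum_norm (p := 2) (by norm_num) (L.b.repr x)
  simp only [ENNReal.toReal_ofNat, Real.rpow_ofNat, LinearIsometryEquiv.norm_map] at h
  exact h

/-- Continuous linear maps that are diagonal on the basis are diagonal on coefficients. -/
theorem coef_of_diagonal (P : H →L[𝕜] H) (c : ℕ → 𝕜) (h : ∀ k, P (L.b k) = c k • L.b k)
    (x : H) (k : ℕ) : L.coef (P x) k = c k * L.coef x k := by
  have h1 := (L.hasSum_coef x).mapL P
  have h2 := h1.mapL (innerSL 𝕜 (L.b k))
  rw [coef_eq]
  refine h2.unique ?_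
  have h3 := hasSum_ite_eq k (c k * L.coef x k)
  refine h3.congr_fun fun j => ?_
  rw [innerSL_apply_apply, map_smul, inner_smul_right, h j, inner_smul_right,
    orthonormal_iff_ite.1 L.b.orthonormal]
  by_cases hj : j = k
  · subst hj; simp [mul_comm]
  · simp [hj, Ne.symm hj]

theorem coef_S [CompleteSpace H] {t : ℝ} (ht : 0 ≤ t) (x : H) (k : ℕ) :
    L.coef (L.S t x) k = NormedSpace.exp ((t : 𝕜) * L.lam k) * L.coef x k :=
  L.coef_of_diagonal _ _ (fun k => L.S_basis k ht) x k

/-! ### The norms of the interpolation spaces of nonpositive order -/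

theorem S_basis_sub_le [CompleteSpace H] {M : ℝ} (hM : ∀ t : ℝ, 0 ≤ t → t ≤ 1 → ‖L.S t‖ ≤ M)
    (k : ℕ) {t : ℝ} (ht : 0 ≤ t) (ht1 : t ≤ 1) :
    ‖L.S t (L.b k) - L.b k‖ ≤ M * ‖L.lam k‖ * t := by
  have hb : ‖L.b k‖ = 1 := L.b.orthonormal.1 k
  have h := norm_image_sub_le_of_norm_deriv_right_le_segment (a := 0) (b := t)
    (f := fun t => L.S t (L.b k)) (f' := fun t => L.lam k • L.S t (L.b k))
    (C := M * ‖L.lam k‖) ((L.continuousOn_S _).mono Icc_subset_Ici_self)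
    (fun s hs => L.hasDerivWithinAt_S_basis k hs.1) (fun s hs => by
      rw [norm_smul, mul_comm]
      gcongr
      have := (L.S s).le_of_opNorm_le (hM s hs.1 (by linarith [hs.2])) (L.b k)
      simpa [hb] using this) t ⟨ht, le_rfl⟩
  simpa [L.S_zero] using h

/-- This is what makes `|λ_k|^θ` bounded for `θ ≤ 0`, so that `H` embeds in `H_θ`. For a stable mode
the dichotomy at time `1` forces `‖S_1 b_k - b_k‖ ≥ 1 - e^{-β}`, while the mean value inequality
bounds the same quantity by `M |λ_k|`. The unstable modes are finitely many. -/
theorem exists_lam_ge [CompleteSpace H] : ∃ m : ℝ, 0 < m ∧ ∀ k, m ≤ ‖L.lam k‖ := by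
  obtain ⟨k₀, -, hk₀⟩ := Finset.exists_min_image (Finset.range L.N) (fun k => ‖L.lam k‖)
    ⟨0, by simpa using L.N_pos⟩
  obtain ⟨M, hM1, hM⟩ := L.exists_norm_S_le_Icc 1
  have hβ : Real.exp (-L.β) < 1 := by
    rw [Real.exp_lt_one_iff]; linarith [L.β_pos]
  refine ⟨min ‖L.lam k₀‖ ((1 - Real.exp (-L.β)) / M),
    lt_min (norm_pos_iff.2 (L.lam_ne_zero _)) (div_pos (by linarith) (by linarith)), fun k => ?_⟩
  rcases lt_or_ge k L.N with hk | hk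
  · exact (min_le_left _ _).trans (hk₀ k (by simpa using hk))
  · refine (min_le_right _ _).trans ?_
    rw [div_le_iff₀ (by linarith)]
    have h1 := L.S_basis_sub_le hM k zero_le_one le_rfl
    have hb : ‖L.b k‖ = 1 := L.b.orthonormal.1 k
    have hp : projU L.b L.N (L.b k) = 0 := by
      simp only [projU, sum_apply, ContinuousLinearMap.smulRight_apply,
        innerSL_apply_apply]
      refine Finset.sum_eq_zero fun j hj => ?_
      rw [orthonormal_iff_ite.1 L.b.orthonormal]
      have : j ≠ k := by have := Finset.mem_range.1 hj; omega
      simp [this]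
    have h2 := L.dichotomy_s 1 zero_le_one _ hp
    have h3 := norm_sub_norm_le (L.b k) (L.S 1 (L.b k))
    rw [norm_sub_rev] at h3
    simp only [hb, mul_one] at h1 h2 h3
    linarith

variable [CompleteSpace H]

theorem exists_rpow_lam_le {θ : ℝ} (hθ : θ ≤ 0) : ∃ m : ℝ, 0 < m ∧ ∀ k, ‖L.lam k‖ ^ θ ≤ m := by
  obtain ⟨m, hm, h⟩ := L.exists_lam_ge
  exact ⟨m ^ θ, by positivity, fun k => Real.rpow_le_rpow_of_nonpos hm (h k) hθ⟩

theorem summable_nrm {θ : ℝ} (hθ : θ ≤ 0) (x : H) :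
    Summable fun k => (‖L.lam k‖ ^ θ * ‖L.coef x k‖) ^ 2 := by
  obtain ⟨m, hm, h⟩ := L.exists_rpow_lam_le hθ
  refine ((L.hasSum_norm_coef_sq x).summable.mul_left (m ^ 2)).of_nonneg_of_le
    (fun k => by positivity) fun k => ?_
  rw [← mul_pow]
  gcongr
  exact h k

theorem nrm_nonneg (θ : ℝ) (x : H) : 0 ≤ L.nrm θ x := Real.sqrt_nonneg _

theorem hasSum_nrm_sq {θ : ℝ} (hθ : θ ≤ 0) (x : H) :
    HasSum (fun k => (‖L.lam k‖ ^ θ * ‖L.coef x k‖) ^ 2) (L.nrm θ x ^ 2) := by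
  rw [nrm, Real.sq_sqrt (tsum_nonneg fun k => by positivity)]
  exact (L.summable_nrm hθ x).hasSum

theorem nrm_zero_order (x : H) : L.nrm 0 x = ‖x‖ := by
  have h1 := L.hasSum_nrm_sq le_rfl x
  simp only [Real.rpow_zero, one_mul] at h1
  have := h1.unique (L.hasSum_norm_coef_sq x)
  exact (pow_left_inj₀ (L.nrm_nonneg _ _) (norm_nonneg _) two_ne_zero).1 this

theorem nrm_le_of_coef_le {x y : H} {θ θ' c : ℝ} (hθ : θ ≤ 0) (hθ' : θ' ≤ 0) (hc : 0 ≤ c)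
    (h : ∀ k, ‖L.lam k‖ ^ θ * ‖L.coef x k‖ ≤ c * (‖L.lam k‖ ^ θ' * ‖L.coef y k‖)) :
    L.nrm θ x ≤ c * L.nrm θ' y := by
  refine abs_le_of_sq_le_sq' ?_ (mul_nonneg hc (L.nrm_nonneg _ _)) |>.2
  rw [mul_pow]
  refine hasSum_le ?_ (L.hasSum_nrm_sq hθ x) ((L.hasSum_nrm_sq hθ' y).mul_left _)
  intro k
  rw [← mul_pow]
  exact pow_le_pow_left₀ (by positivity) (h k) 2

/-- Diagonal operators with bounded multipliers are bounded on all interpolation spaces. -/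
theorem nrm_le_of_multiplier {x y : H} {θ c : ℝ} {m : ℕ → 𝕜} (hθ : θ ≤ 0) (hc : 0 ≤ c)
    (h : ∀ k, L.coef x k = m k * L.coef y k) (hm : ∀ k, ‖m k‖ ≤ c) :
    L.nrm θ x ≤ c * L.nrm θ y := by
  refine L.nrm_le_of_coef_le hθ hθ hc fun k => ?_
  rw [h, norm_mul]
  calc ‖L.lam k‖ ^ θ * (‖m k‖ * ‖L.coef y k‖) = ‖m k‖ * (‖L.lam k‖ ^ θ * ‖L.coef y k‖) := by ring
    _ ≤ _ := by gcongr; exact hm k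

theorem norm_le_of_multiplier {x y : H} {c : ℝ} {m : ℕ → 𝕜} (hc : 0 ≤ c)
    (h : ∀ k, L.coef x k = m k * L.coef y k) (hm : ∀ k, ‖m k‖ ≤ c) :
    ‖x‖ ≤ c * ‖y‖ := by
  simpa only [nrm_zero_order] using L.nrm_le_of_multiplier le_rfl hc h hm

/-- The semigroup estimates on `[0,1]` between `H` and `H_{-2γ}`. -/
structure SemigroupBounds (γ M : ℝ) : Prop where
  one_le : 1 ≤ M
  norm_S : ∀ t : ℝ, 0 ≤ t → t ≤ 1 → ∀ x, ‖L.S t x‖ ≤ M * ‖x‖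
  nrm_S : ∀ t : ℝ, 0 ≤ t → t ≤ 1 → ∀ x, L.nrm (-2 * γ) (L.S t x) ≤ M * L.nrm (-2 * γ) x
  nrm_le : ∀ x, L.nrm (-2 * γ) x ≤ M * ‖x‖
  smoothing : ∀ t : ℝ, 0 < t → t ≤ 1 → ∀ x, ‖L.S t x‖ ≤ M * t ^ (-2 * γ) * L.nrm (-2 * γ) x
  nrm_S_sub : ∀ t : ℝ, 0 ≤ t → t ≤ 1 → ∀ x, L.nrm (-2 * γ) (L.S t x - x) ≤ M * t ^ (2 * γ) * ‖x‖

theorem norm_multiplier_le {M : ℝ} (hM : ∀ t : ℝ, 0 ≤ t → t ≤ 1 → ‖L.S t‖ ≤ M) {t : ℝ} (ht : 0 ≤ t)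
    (ht1 : t ≤ 1) (k : ℕ) : ‖NormedSpace.exp ((t : 𝕜) * L.lam k)‖ ≤ M := by
  have h := (L.S t).le_of_opNorm_le (hM t ht ht1) (L.b k)
  have hb : ‖L.b k‖ = 1 := L.b.orthonormal.1 k
  rwa [L.S_basis k ht, norm_smul, hb, mul_one, mul_one] at h

theorem norm_multiplier_sub_one_le {M : ℝ} (hM : ∀ t : ℝ, 0 ≤ t → t ≤ 1 → ‖L.S t‖ ≤ M) {t : ℝ}
    (ht : 0 ≤ t) (ht1 : t ≤ 1) (k : ℕ) :
    ‖NormedSpace.exp ((t : 𝕜) * L.lam k) - 1‖ ≤ M * ‖L.lam k‖ * t := by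
  have h := L.S_basis_sub_le hM k ht ht1
  have hb : ‖L.b k‖ = 1 := L.b.orthonormal.1 k
  have e : NormedSpace.exp ((t : 𝕜) * L.lam k) • L.b k - L.b k
      = (NormedSpace.exp ((t : 𝕜) * L.lam k) - 1) • L.b k := by rw [sub_smul, one_smul]
  rwa [L.S_basis k ht, e, norm_smul, hb, mul_one] at h

/-- Analyticity tested on `b_k`: the graph of `A` determines the image of `S_t b_k`, which is
`e^{tλ_k} λ_k b_k`. -/
theorem exists_norm_lam_multiplier_le : ∃ M : ℝ, ∀ t : ℝ, 0 < t → t ≤ 1 → ∀ k : ℕ,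
    t * (‖L.lam k‖ * ‖NormedSpace.exp ((t : 𝕜) * L.lam k)‖) ≤ M := by
  obtain ⟨M, hM⟩ := L.analytic
  refine ⟨M, fun t ht ht1 k => ?_⟩
  obtain ⟨y, hy, hy'⟩ := hM t ht ht1 (L.b k)
  have hb : ‖L.b k‖ = 1 := L.b.orthonormal.1 k
  have h1 : (L.S t (L.b k), NormedSpace.exp ((t : 𝕜) * L.lam k) • L.lam k • L.b k) ∈ L.A.graph := by
    rw [L.S_basis k ht.le]
    exact L.A.graph.smul_mem _ (L.eigen k)
  have h2 : y = NormedSpace.exp ((t : 𝕜) * L.lam k) • L.lam k • L.b k :=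
    L.A.mem_graph_snd_inj hy h1 rfl
  rw [h2, norm_smul, norm_smul, hb, mul_one, mul_one] at hy'
  rwa [mul_comm ‖L.lam k‖]

theorem rpow_mul_rpow_one_sub_le {x y M p : ℝ} (hx : 0 ≤ x) (hy : 0 ≤ y) (hxM : x ≤ M)
    (hyM : y ≤ M) (hM : 0 < M) (hp : 0 ≤ p) (hp1 : p ≤ 1) : x ^ p * y ^ (1 - p) ≤ M := by
  calc x ^ p * y ^ (1 - p) ≤ M ^ p * M ^ (1 - p) := by
        gcongr
    _ = M := by rw [← Real.rpow_add hM]; simp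

/-- Every bound is a pointwise bound on multipliers. The last two are geometric means with exponents
`2γ` and `1 - 2γ`, for which `γ ≤ 1/2` is needed. -/
theorem exists_semigroupBounds {γ : ℝ} (hγ : 0 < γ) (hγ' : γ ≤ 1 / 2) :
    ∃ M, L.SemigroupBounds γ M := by
  obtain ⟨M₀, hM₀, hS⟩ := L.exists_norm_S_le_Icc 1
  obtain ⟨M₁, hA⟩ := L.exists_norm_lam_multiplier_le
  have hθ : -2 * γ ≤ 0 := by linarith
  obtain ⟨m, hm, hlam⟩ := L.exists_rpow_lam_le hθ
  have hlpos : ∀ k, 0 < ‖L.lam k‖ := fun k => norm_pos_iff.2 (L.lam_ne_zero k)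
  -- `M₀ + 1` rather than `M₀`, so that `M` also dominates `|e^{tλ_k} - 1|`.
  set M := max (max (M₀ + 1) M₁) m with hMdef
  have h0 : M₀ + 1 ≤ M := (le_max_left _ _).trans (le_max_left _ _)
  have h1 : M₁ ≤ M := (le_max_right _ _).trans (le_max_left _ _)
  have h2 : m ≤ M := le_max_right _ _
  have hMpos : 0 < M := by linarith
  refine ⟨M, by linarith, ?_, ?_, ?_, ?_, ?_⟩
  · exact fun t ht ht1 x => (L.S t).le_of_opNorm_le ((hS t ht ht1).trans (by linarith)) x
  · intro t ht ht1 x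
    exact L.nrm_le_of_multiplier hθ hMpos.le (L.coef_S ht x)
      fun k => (L.norm_multiplier_le hS ht ht1 k).trans (by linarith)
  · intro x
    rw [← L.nrm_zero_order]
    refine L.nrm_le_of_coef_le hθ le_rfl hMpos.le fun k => ?_
    rw [Real.rpow_zero, one_mul]
    gcongr
    exact (hlam k).trans h2
  · intro t ht ht1 x
    rw [← L.nrm_zero_order]
    refine L.nrm_le_of_coef_le le_rfl hθ (by positivity) fun k => ?_
    rw [Real.rpow_zero, one_mul, L.coef_S ht.le, norm_mul, ← mul_assoc]
    gcongr
    set e := ‖NormedSpace.exp ((t : 𝕜) * L.lam k)‖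
    have he : 0 ≤ e := norm_nonneg _
    -- Interpolates between `t |λ_k| |e^{tλ_k}| ≤ M` (analyticity) and `|e^{tλ_k}| ≤ M`, which
    -- leaves `(t |λ_k|)^{2γ} |e^{tλ_k}| ≤ M`.
    have key := rpow_mul_rpow_one_sub_le (x := t * (‖L.lam k‖ * e)) (y := e) (M := M) (p := 2 * γ)
      (by positivity) he ((hA t ht ht1 k).trans h1)
      ((L.norm_multiplier_le hS ht.le ht1 k).trans (by linarith)) hMpos (by linarith) (by linarith)
    rw [Real.mul_rpow ht.le (by positivity), Real.mul_rpow (hlpos k).le he, mul_assoc, mul_assoc,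
      ← Real.rpow_add_of_nonneg he (by linarith) (by linarith)] at key
    simp only [add_sub_cancel, Real.rpow_one] at key
    rw [show -2 * γ = -(2 * γ) by ring, Real.rpow_neg ht.le, Real.rpow_neg (hlpos k).le]
    have a1 : 0 < t ^ (2 * γ) := by positivity
    have a2 : 0 < ‖L.lam k‖ ^ (2 * γ) := Real.rpow_pos_of_pos (hlpos k) _
    rw [mul_assoc, ← mul_inv, ← div_eq_mul_inv, le_div_iff₀ (by positivity)]
    linarith
  · intro t ht ht1 x
    rw [← L.nrm_zero_order]
    refine L.nrm_le_of_coef_le hθ le_rfl (by positivity) fun k => ?_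
    rw [Real.rpow_zero, one_mul, L.coef_sub, L.coef_S ht, ← sub_one_mul, norm_mul, ← mul_assoc]
    refine mul_le_mul_of_nonneg_right ?_ (norm_nonneg _)
    set e := ‖NormedSpace.exp ((t : 𝕜) * L.lam k) - 1‖
    have he : 0 ≤ e := norm_nonneg _
    have e1 : e ≤ M * (‖L.lam k‖ * t) := by
      refine (L.norm_multiplier_sub_one_le hS ht ht1 k).trans ?_
      rw [mul_assoc]
      gcongr
      linarith
    have e2 : e ≤ M := by
      refine (norm_sub_le _ _).trans ?_
      have := L.norm_multiplier_le hS ht ht1 k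
      simp only [norm_one]
      linarith
    have a2 : 0 < ‖L.lam k‖ ^ (2 * γ) := Real.rpow_pos_of_pos (hlpos k) _
    -- Interpolates between `e ≤ M |λ_k| t` and `e ≤ M`.
    have e3 : e ≤ M * (‖L.lam k‖ * t) ^ (2 * γ) := by
      calc e = e ^ (2 * γ) * e ^ (1 - 2 * γ) := by
            rw [← Real.rpow_add_of_nonneg he (by linarith) (by linarith)]; simp
        _ ≤ (M * (‖L.lam k‖ * t)) ^ (2 * γ) * M ^ (1 - 2 * γ) := by
            gcongr
            linarith
        _ = M * (‖L.lam k‖ * t) ^ (2 * γ) := by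
            rw [Real.mul_rpow hMpos.le (by positivity), mul_right_comm, ← Real.rpow_add hMpos]
            simp
    rw [Real.mul_rpow (hlpos k).le ht] at e3
    rw [show -2 * γ = -(2 * γ) by ring, Real.rpow_neg (hlpos k).le, ← div_eq_inv_mul,
      div_le_iff₀ a2]
    linarith

/-! ### The unstable and the stable part -/

theorem coef_πu (x : H) (k : ℕ) : L.coef (L.πu x) k = (if k < L.N then 1 else 0) * L.coef x k := by
  refine L.coef_of_diagonal _ (fun k => if k < L.N then 1 else 0) (fun k => ?_) x k
  simp only [πu, projU, sum_apply, ContinuousLinearMap.smulRight_apply,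
        innerSL_apply_apply, orthonormal_iff_ite.1 L.b.orthonormal]
  simp [ite_smul]

theorem coef_Su (r : ℝ) (x : H) (k : ℕ) : L.coef (L.Su r x) k =
    (if k < L.N then NormedSpace.exp ((r : 𝕜) * L.lam k) else 0) * L.coef x k := by
  refine L.coef_of_diagonal _
    (fun k => if k < L.N then NormedSpace.exp ((r : 𝕜) * L.lam k) else 0) (fun k => ?_) x k
  simp only [Su, expU, sum_apply, smul_apply,
    ContinuousLinearMap.smulRight_apply, innerSL_apply_apply,
    orthonormal_iff_ite.1 L.b.orthonormal]
  simp [ite_smul]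

theorem exp_add_mul (s t : ℝ) (c : 𝕜) : NormedSpace.exp (((s + t : ℝ) : 𝕜) * c)
    = NormedSpace.exp ((s : 𝕜) * c) * NormedSpace.exp ((t : 𝕜) * c) := by
  let _ : NormedAlgebra ℚ 𝕜 := .restrictScalars ℚ ℝ 𝕜
  rw [← NormedSpace.exp_add]
  push_cast
  rw [add_mul]

theorem Su_add (s t : ℝ) (x : H) : L.Su (s + t) x = L.Su s (L.Su t x) := by
  refine L.coef_injective fun k => ?_
  rw [coef_Su, coef_Su, coef_Su]
  split_ifs
  · rw [exp_add_mul]; ring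
  · simp

theorem Su_zero : L.Su 0 = L.πu := by
  ext x
  refine L.coef_injective fun k => ?_
  rw [coef_Su, coef_πu]
  simp [NormedSpace.exp_zero]

theorem S_Su {t : ℝ} (ht : 0 ≤ t) (r : ℝ) (x : H) : L.S t (L.Su r x) = L.Su (t + r) x := by
  refine L.coef_injective fun k => ?_
  rw [coef_S _ ht, coef_Su, coef_Su]
  split_ifs
  · rw [exp_add_mul]; ring
  · simp

theorem Su_S {t : ℝ} (ht : 0 ≤ t) (r : ℝ) (x : H) : L.Su r (L.S t x) = L.Su (r + t) x := by
  refine L.coef_injective fun k => ?_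
  rw [coef_Su, coef_S _ ht, coef_Su]
  split_ifs
  · rw [exp_add_mul]; ring
  · simp

theorem Su_πu (r : ℝ) (x : H) : L.Su r (L.πu x) = L.Su r x := by
  rw [← Su_zero, ← Su_add, add_zero]

theorem πu_πu (x : H) : L.πu (L.πu x) = L.πu x := by
  rw [← Su_zero, ← Su_add, zero_add]

theorem Ss_apply (r : ℝ) (x : H) : L.Ss r x = L.S r (x - L.πu x) := by
  simp [Ss]

theorem S_πu {t : ℝ} (ht : 0 ≤ t) (x : H) : L.S t (L.πu x) = L.πu (L.S t x) := by
  rw [← Su_zero, S_Su _ ht, Su_S _ ht, add_comm]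

theorem Ss_apply' {r : ℝ} (hr : 0 ≤ r) (x : H) : L.Ss r x = L.S r x - L.πu (L.S r x) := by
  rw [Ss_apply, map_sub, S_πu _ hr]

theorem norm_πu_le (x : H) : ‖L.πu x‖ ≤ ‖x‖ := by
  have := L.norm_le_of_multiplier zero_le_one (L.coef_πu x) (fun k => by split_ifs <;> simp)
  simpa using this

theorem norm_sub_πu_le (x : H) : ‖x - L.πu x‖ ≤ ‖x‖ := by
  have := L.norm_le_of_multiplier (x := x - L.πu x) (y := x) zero_le_one
    (m := fun k => if k < L.N then 0 else 1)
    (fun k => by rw [coef_sub, coef_πu]; split_ifs <;> simp) (fun k => by split_ifs <;> simp)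
  simpa using this

theorem norm_Su_le {t : ℝ} (ht : t ≤ 0) (x : H) : ‖L.Su t x‖ ≤ Real.exp (L.α * t) * ‖x‖ := by
  rw [← Su_πu]
  refine (L.dichotomy_u t ht (L.πu x) (L.πu_πu x)).trans ?_
  gcongr
  exact L.norm_πu_le x

theorem norm_Ss_le {t : ℝ} (ht : 0 ≤ t) (x : H) : ‖L.Ss t x‖ ≤ Real.exp (-L.β * t) * ‖x‖ := by
  rw [Ss_apply]
  refine (L.dichotomy_s t ht (x - L.πu x) ?_).trans ?_
  · have : projU L.b L.N = L.πu := rfl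
    rw [this, map_sub, πu_πu, sub_self]
  · gcongr
    exact L.norm_sub_πu_le x

theorem nrm_πu_le {θ : ℝ} (hθ : θ ≤ 0) (x : H) : L.nrm θ (L.πu x) ≤ L.nrm θ x := by
  have := L.nrm_le_of_multiplier hθ zero_le_one (L.coef_πu x) (fun k => by split_ifs <;> simp)
  simpa using this

theorem nrm_sub_πu_le {θ : ℝ} (hθ : θ ≤ 0) (x : H) : L.nrm θ (x - L.πu x) ≤ L.nrm θ x := by
  have := L.nrm_le_of_multiplier (x := x - L.πu x) (y := x) hθ zero_le_one
    (m := fun k => if k < L.N then 0 else 1)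
    (fun k => by rw [coef_sub, coef_πu]; split_ifs <;> simp) (fun k => by split_ifs <;> simp)
  simpa using this

/-- Only finitely many modes are involved, so the bound holds for negative `r` too. This is what
allows backward unstable operators to be taken out of rough integrals. -/
theorem exists_nrm_Su_le {θ : ℝ} (hθ : θ ≤ 0) (r : ℝ) :
    ∃ c : ℝ, 0 ≤ c ∧ ∀ x, L.nrm θ (L.Su r x) ≤ c * L.nrm θ x := by
  refine ⟨∑ k ∈ Finset.range L.N, ‖NormedSpace.exp ((r : 𝕜) * L.lam k)‖, by positivity, fun x =>
    L.nrm_le_of_multiplier hθ (by positivity) (L.coef_Su r x) fun k => ?_⟩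
  split_ifs with hk
  · exact Finset.single_le_sum (f := fun k => ‖NormedSpace.exp ((r : 𝕜) * L.lam k)‖)
      (fun _ _ => norm_nonneg _) (Finset.mem_range.2 hk)
  · simpa using Finset.sum_nonneg fun _ _ => norm_nonneg _

/-! ### The embedding of `H` into `H_θ`, `θ ≤ 0` -/

theorem Hs.norm_def {θ : ℝ} (x : L.Hs θ) : ‖x‖ = ‖Hs.toLp L θ x‖ := rfl

theorem memℓp_coef {θ : ℝ} (hθ : θ ≤ 0) (x : H) :
    Memℓp (fun k => (‖L.lam k‖ ^ θ) • L.coef x k) 2 := by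
  refine memℓp_gen ?_
  refine (L.summable_nrm hθ x).congr fun k => ?_
  rw [norm_smul, Real.norm_of_nonneg (by positivity)]
  simp

theorem exists_nrm_le {θ : ℝ} (hθ : θ ≤ 0) : ∃ c : ℝ, ∀ x, L.nrm θ x ≤ c * ‖x‖ := by
  obtain ⟨m, hm, h⟩ := L.exists_rpow_lam_le hθ
  refine ⟨m, fun x => ?_⟩
  rw [← L.nrm_zero_order]
  refine L.nrm_le_of_coef_le hθ le_rfl hm.le fun k => ?_
  rw [Real.rpow_zero, one_mul]
  gcongr
  exact h k

/-- The embedding of `H` into `H_θ` for `θ ≤ 0` as a linear map. -/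
def embₗ (θ : ℝ) (hθ : θ ≤ 0) : H →ₗ[ℝ] L.Hs θ where
  toFun x := ⟨L.coef x, L.memℓp_coef hθ x⟩
  map_add' x y := Subtype.ext (funext fun k => L.coef_add x y k)
  map_smul' c x := Subtype.ext (funext fun k => L.coef_rsmul c x k)

theorem norm_embₗ {θ : ℝ} (hθ : θ ≤ 0) (x : H) : ‖L.embₗ θ hθ x‖ = L.nrm θ x := by
  have h := lp.hasSum_norm (p := 2) (by norm_num) (Hs.toLp L θ (L.embₗ θ hθ x))
  simp only [ENNReal.toReal_ofNat, Real.rpow_ofNat] at h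
  have h1 := L.hasSum_nrm_sq hθ x
  have : ‖Hs.toLp L θ (L.embₗ θ hθ x)‖ ^ 2 = L.nrm θ x ^ 2 := by
    refine h.unique (h1.congr_fun fun k => ?_)
    have : (Hs.toLp L θ (L.embₗ θ hθ x)) k = (‖L.lam k‖ ^ θ) • L.coef x k := rfl
    rw [this, norm_smul, Real.norm_of_nonneg (by positivity)]
  exact (pow_left_inj₀ (norm_nonneg _) (L.nrm_nonneg _ _) two_ne_zero).1 this

/-- The embedding of `H` into `H_θ` for `θ ≤ 0`. -/
def emb (θ : ℝ) (hθ : θ ≤ 0) : H →L[ℝ] L.Hs θ :=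
  LinearMap.mkContinuousOfExistsBound (L.embₗ θ hθ) (by
    obtain ⟨c, hc⟩ := L.exists_nrm_le hθ
    exact ⟨c, fun x => by rw [norm_embₗ]; exact hc x⟩)

theorem norm_emb {θ : ℝ} (hθ : θ ≤ 0) (x : H) : ‖L.emb θ hθ x‖ = L.nrm θ x := L.norm_embₗ hθ x

theorem coef_emb {θ : ℝ} (hθ : θ ≤ 0) (x : H) : (L.emb θ hθ x).coef = L.coef x := rfl

theorem Hs.coef_injective {θ : ℝ} {x y : L.Hs θ} (h : x.coef = y.coef) : x = y := Subtype.ext h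

theorem emb_injective {θ : ℝ} (hθ : θ ≤ 0) : Function.Injective (L.emb θ hθ) := fun _ _ h =>
  L.coef_injective fun k => congrFun (congrArg Hs.coef h) k

/-- Finite truncations of a coefficient sequence come from `H`. Density transfers the vanishing of
derivatives at the origin from `H` to `H_θ`. -/
theorem denseRange_emb {θ : ℝ} (hθ : θ ≤ 0) : DenseRange (L.emb θ hθ) := by
  intro x
  have h := lp.hasSum_single (p := 2) (by norm_num) (Hs.toLp L θ x)
  rw [mem_closure_iff_seq_limit]
  refine ⟨fun n => L.emb θ hθ (∑ k ∈ Finset.range n, x.coef k • L.b k), fun n => ⟨_, rfl⟩, ?_⟩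
  have h1 := h.tendsto_sum_nat
  rw [tendsto_iff_norm_sub_tendsto_zero] at h1 ⊢
  refine h1.congr fun n => ?_
  rw [Hs.norm_def, map_sub]
  congr 2
  apply Subtype.ext
  funext k
  have e1 : (Hs.toLp L θ (L.emb θ hθ (∑ k ∈ Finset.range n, x.coef k • L.b k))).1 k
    = (‖L.lam k‖ ^ θ) • L.coef (∑ k ∈ Finset.range n, x.coef k • L.b k) k := rfl
  have e2 : L.coef (∑ k ∈ Finset.range n, x.coef k • L.b k) k = if k < n then x.coef k else 0 := by
    rw [coef_eq, inner_sum]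
    simp only [inner_smul_right, orthonormal_iff_ite.1 L.b.orthonormal]
    simp
  rw [e1, e2, lp.coeFn_sum, Finset.sum_apply]
  simp only [lp.single_apply]
  have e3 : ∀ k, (Hs.toLp L θ x) k = (‖L.lam k‖ ^ θ) • x.coef k := fun k => rfl
  simp [Pi.single_apply, e3]

theorem emb_zero_surjective : Function.Surjective (L.emb 0 le_rfl) := by
  intro x
  have h : Memℓp x.coef 2 := by
    have := x.2
    have h2 : Memℓp (fun k => (‖L.lam k‖ ^ (0 : ℝ)) • x.coef k) 2 := this
    simpa using h2
  refine ⟨L.b.repr.symm ⟨x.coef, h⟩, Hs.coef_injective L ?_⟩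
  rw [coef_emb]
  funext k
  simp [coef]

/-- `H` is isometric to `H_0`. -/
def embZero : H ≃ₗᵢ[ℝ] L.Hs 0 :=
  LinearIsometryEquiv.ofSurjective
    ⟨L.embₗ 0 le_rfl, fun x => by rw [norm_embₗ, nrm_zero_order]⟩ L.emb_zero_surjective

theorem nrm_eq_zero {θ : ℝ} (hθ : θ ≤ 0) {x : H} : L.nrm θ x = 0 ↔ x = 0 := by
  rw [← norm_emb _ hθ, norm_eq_zero]
  exact ⟨fun h => L.emb_injective hθ (by rw [h, map_zero]), fun h => by rw [h, map_zero]⟩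

end LinearPart

end LinearTheory

/-! ## `C³` maps vanishing to third order at the origin -/

section Flat

variable {V W : Type*} [NormedAddCommGroup V] [NormedSpace ℝ V] [NormedAddCommGroup W]
  [NormedSpace ℝ W]

/-- A `C³` map that vanishes at `0` together with its derivatives of order one and two, and has a
third derivative bounded by `M`. -/
structure FlatCubic (G : V → W) (M : ℝ) : Prop where
  contDiff : ContDiff ℝ 3 G
  bound : ∀ x, ‖iteratedFDeriv ℝ 3 G x‖ ≤ M
  map_zero : G 0 = 0
  fderiv_zero : fderiv ℝ G 0 = 0
  fderiv2_zero : fderiv ℝ (fderiv ℝ G) 0 = 0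

theorem norm_fderiv3_eq (G : V → W) (x : V) :
    ‖fderiv ℝ (fderiv ℝ (fderiv ℝ G)) x‖ = ‖iteratedFDeriv ℝ 3 G x‖ := by
  rw [← norm_iteratedFDeriv_fderiv, ← norm_iteratedFDeriv_fderiv, ← norm_iteratedFDeriv_fderiv,
    norm_iteratedFDeriv_zero]

namespace FlatCubic

variable {G : V → W} {M : ℝ}

theorem nonneg (h : FlatCubic G M) : 0 ≤ M := (norm_nonneg _).trans (h.bound 0)

theorem mono (h : FlatCubic G M) {M' : ℝ} (hM : M ≤ M') : FlatCubic G M' :=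
  { h with bound := fun x => (h.bound x).trans hM }

theorem contDiff_fderiv (h : FlatCubic G M) : ContDiff ℝ 2 (fderiv ℝ G) :=
  h.contDiff.fderiv_right (by norm_num)

theorem contDiff_fderiv2 (h : FlatCubic G M) : ContDiff ℝ 1 (fderiv ℝ (fderiv ℝ G)) :=
  h.contDiff_fderiv.fderiv_right (by norm_num)

theorem differentiable (h : FlatCubic G M) : Differentiable ℝ G := h.contDiff.differentiable (by norm_num)

theorem differentiable_fderiv (h : FlatCubic G M) : Differentiable ℝ (fderiv ℝ G) :=
  h.contDiff_fderiv.differentiable (by norm_num)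

theorem differentiable_fderiv2 (h : FlatCubic G M) : Differentiable ℝ (fderiv ℝ (fderiv ℝ G)) :=
  h.contDiff_fderiv2.differentiable (by norm_num)

/-- The head of a chain of mean value inequalities. From the bound on the third derivative and the
vanishing of the lower ones at `0`, the orders two, one and zero are integrated in turn on the ball
of radius `B`, each integration gaining one factor `B`. -/
theorem fderiv2_lipschitz (h : FlatCubic G M) (x y : V) :
    ‖fderiv ℝ (fderiv ℝ G) x - fderiv ℝ (fderiv ℝ G) y‖ ≤ M * ‖x - y‖ :=
  convex_univ.norm_image_sub_le_of_norm_fderiv_le (𝕜 := ℝ)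
    (fun z _ => h.differentiable_fderiv2 z)
    (fun z _ => by rw [norm_fderiv3_eq]; exact h.bound z) (mem_univ y) (mem_univ x)

theorem fderiv2_le (h : FlatCubic G M) (x : V) : ‖fderiv ℝ (fderiv ℝ G) x‖ ≤ M * ‖x‖ := by
  simpa [h.fderiv2_zero] using h.fderiv2_lipschitz x 0

theorem fderiv_lipschitz (h : FlatCubic G M) {B : ℝ} {x y : V} (hx : ‖x‖ ≤ B) (hy : ‖y‖ ≤ B) :
    ‖fderiv ℝ G x - fderiv ℝ G y‖ ≤ M * B * ‖x - y‖ :=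
  (convex_closedBall (0 : V) B).norm_image_sub_le_of_norm_fderiv_le (𝕜 := ℝ)
    (fun z _ => h.differentiable_fderiv z)
    (fun z hz => (h.fderiv2_le z).trans
      (mul_le_mul_of_nonneg_left (by simpa using hz) h.nonneg))
    (by simpa using hy) (by simpa using hx)

theorem fderiv_le (h : FlatCubic G M) {B : ℝ} {x : V} (hx : ‖x‖ ≤ B) : ‖fderiv ℝ G x‖ ≤ M * B ^ 2 := by
  have hB : 0 ≤ B := (norm_nonneg _).trans hx
  have := h.fderiv_lipschitz hx (y := 0) (by simpa using hB)
  rw [h.fderiv_zero, sub_zero, sub_zero] at this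
  refine this.trans ?_
  rw [sq, ← mul_assoc]
  exact mul_le_mul_of_nonneg_left hx (mul_nonneg h.nonneg hB)

theorem lipschitz (h : FlatCubic G M) {B : ℝ} {x y : V} (hx : ‖x‖ ≤ B) (hy : ‖y‖ ≤ B) :
    ‖G x - G y‖ ≤ M * B ^ 2 * ‖x - y‖ :=
  (convex_closedBall (0 : V) B).norm_image_sub_le_of_norm_fderiv_le (𝕜 := ℝ)
    (fun z _ => h.differentiable z) (fun z hz => h.fderiv_le (by simpa using hz))
    (by simpa using hy) (by simpa using hx)

/-- Mean value inequality in the base point: the derivative of `x ↦ DG(x + δ) - DG(x)` is an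
increment of `D²G`, hence at most `M ‖δ‖`. -/
theorem fderiv_increment_same (h : FlatCubic G M) (y v δ : V) :
    ‖(fderiv ℝ G (y + δ) - fderiv ℝ G y) - (fderiv ℝ G (v + δ) - fderiv ℝ G v)‖
      ≤ M * ‖δ‖ * ‖y - v‖ := by
  refine convex_univ.norm_image_sub_le_of_norm_hasFDerivWithin_le (𝕜 := ℝ)
    (f := fun x => fderiv ℝ G (x + δ) - fderiv ℝ G x)
    (f' := fun x => fderiv ℝ (fderiv ℝ G) (x + δ) - fderiv ℝ (fderiv ℝ G) x)
    (fun z _ => ?_) (fun z _ => ?_) (mem_univ v) (mem_univ y)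
  · have e : HasFDerivAt (fun x => fderiv ℝ G (x + δ)) (fderiv ℝ (fderiv ℝ G) (z + δ)) z :=
      (hasFDerivAt_comp_add_right δ).2 (h.differentiable_fderiv (z + δ)).hasFDerivAt
    exact (e.sub (h.differentiable_fderiv z).hasFDerivAt).hasFDerivWithinAt
  · simpa using h.fderiv2_lipschitz (z + δ) z

/-- Lipschitz dependence of the increments of the derivative on the end points. -/
theorem fderiv_increment (h : FlatCubic G M) {B : ℝ} {y y₁ v v₁ : V} (hy : ‖y‖ ≤ B) (hy₁ : ‖y₁‖ ≤ B) (hv : ‖v‖ ≤ B)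
    (hv₁ : ‖v₁‖ ≤ B) :
    ‖(fderiv ℝ G y₁ - fderiv ℝ G y) - (fderiv ℝ G v₁ - fderiv ℝ G v)‖
      ≤ M * ‖y₁ - y‖ * ‖y - v‖ + M * (3 * B) * ‖(y₁ - y) - (v₁ - v)‖ := by
  have hB : 0 ≤ B := (norm_nonneg _).trans hy
  have h1 := h.fderiv_increment_same y v (y₁ - y)
  rw [add_sub_cancel] at h1
  -- The intermediate point combines three vectors of norm at most `B`, which is where `3B` comes
  -- from.
  have hn : ‖v + (y₁ - y)‖ ≤ 3 * B := by
    have := norm_add_le v (y₁ - y)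
    have := norm_sub_le y₁ y
    linarith
  have h2 := h.fderiv_lipschitz hn (y := v₁) (by linarith)
  have e : v + (y₁ - y) - v₁ = (y₁ - y) - (v₁ - v) := by abel
  rw [e] at h2
  have e2 : (fderiv ℝ G y₁ - fderiv ℝ G y) - (fderiv ℝ G v₁ - fderiv ℝ G v)
      = ((fderiv ℝ G y₁ - fderiv ℝ G y) - (fderiv ℝ G (v + (y₁ - y)) - fderiv ℝ G v))
        + (fderiv ℝ G (v + (y₁ - y)) - fderiv ℝ G v₁) := by abel
  rw [e2]
  exact (norm_add_le _ _).trans (add_le_add h1 h2)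

/-- Mean value inequality in the increment: the derivative in `x` of the difference of the two
remainders is the difference of increments of `DG` estimated in `fderiv_increment_same`, and it is
integrated over a ball of radius `‖δ‖`. -/
theorem taylor_same (h : FlatCubic G M) (y v δ : V) :
    ‖(G (y + δ) - G y - fderiv ℝ G y δ) - (G (v + δ) - G v - fderiv ℝ G v δ)‖
      ≤ M * ‖δ‖ ^ 2 * ‖y - v‖ := by
  have key := (convex_closedBall (0 : V) ‖δ‖).norm_image_sub_le_of_norm_hasFDerivWithin_le (𝕜 := ℝ)
    (f := fun x => (G (y + x) - G y - fderiv ℝ G y x) - (G (v + x) - G v - fderiv ℝ G v x))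
    (f' := fun x => (fderiv ℝ G (y + x) - fderiv ℝ G y) - (fderiv ℝ G (v + x) - fderiv ℝ G v))
    (C := M * ‖δ‖ * ‖y - v‖) (x := 0) (y := δ)
    (fun z _ => by
      have e : ∀ u : V, HasFDerivAt (fun x => G (u + x) - G u - fderiv ℝ G u x)
          (fderiv ℝ G (u + z) - fderiv ℝ G u) z := fun u =>
        (((hasFDerivAt_comp_add_left u).2 (h.differentiable (u + z)).hasFDerivAt).sub_const
          (G u)).sub
          (fderiv ℝ G u).hasFDerivAt
      exact ((e y).sub (e v)).hasFDerivWithinAt)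
    (fun z hz => by
      refine (h.fderiv_increment_same y v z).trans ?_
      have : ‖z‖ ≤ ‖δ‖ := by simpa using hz
      have := h.nonneg
      gcongr)
    (by simp) (by simp)
  simp only [add_zero, sub_self, _root_.map_zero, sub_zero] at key
  calc _ ≤ _ := key
    _ = _ := by ring

/-- Lipschitz dependence of the first order Taylor remainder on the end points. -/
theorem taylor (h : FlatCubic G M) {B r : ℝ} {y y₁ v v₁ : V} (hv : ‖v‖ ≤ B)
    (hr : ‖y₁ - y‖ ≤ r) (hr' : ‖v₁ - v‖ ≤ r) (hrB : r ≤ 2 * B) :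
    ‖(G y₁ - G y - fderiv ℝ G y (y₁ - y)) - (G v₁ - G v - fderiv ℝ G v (v₁ - v))‖
      ≤ M * r ^ 2 * ‖y - v‖ + M * (3 * B) * r * ‖(y₁ - y) - (v₁ - v)‖ := by
  have hB : 0 ≤ B := (norm_nonneg _).trans hv
  have hr0 : 0 ≤ r := (norm_nonneg _).trans hr
  have hM := h.nonneg
  have h1 := h.taylor_same y v (y₁ - y)
  rw [add_sub_cancel] at h1
  have h1' : M * ‖y₁ - y‖ ^ 2 * ‖y - v‖ ≤ M * r ^ 2 * ‖y - v‖ := by gcongr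
  have key := (convex_closedBall (0 : V) r).norm_image_sub_le_of_norm_hasFDerivWithin_le (𝕜 := ℝ)
    (f := fun x => G (v + x) - G v - fderiv ℝ G v x)
    (f' := fun x => fderiv ℝ G (v + x) - fderiv ℝ G v)
    (C := M * (3 * B) * r) (x := v₁ - v) (y := y₁ - y)
    (fun z _ => ((((hasFDerivAt_comp_add_left v).2
      (h.differentiable (v + z)).hasFDerivAt).sub_const (G v)).sub (fderiv ℝ G v).hasFDerivAt).hasFDerivWithinAt)
    (fun z hz => by
      have hz : ‖z‖ ≤ r := by simpa using hz
      -- Here `‖v + z‖ ≤ B + r ≤ 3B`, by the assumption `r ≤ 2B`.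
      refine (h.fderiv_lipschitz (B := 3 * B) ?_ (by linarith)).trans ?_
      · exact (norm_add_le _ _).trans (by linarith)
      · rw [add_sub_cancel_left]
        gcongr)
    (by simpa using hr') (by simpa using hr)
  rw [add_sub_cancel] at key
  -- The base point is varied at a fixed increment, then the increment at a fixed base point.
  have e2 : (G y₁ - G y - fderiv ℝ G y (y₁ - y)) - (G v₁ - G v - fderiv ℝ G v (v₁ - v))
      = ((G y₁ - G y - fderiv ℝ G y (y₁ - y))
          - (G (v + (y₁ - y)) - G v - fderiv ℝ G v (y₁ - y)))
        + ((G (v + (y₁ - y)) - G v - fderiv ℝ G v (y₁ - y))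
          - (G v₁ - G v - fderiv ℝ G v (v₁ - v))) := by abel
  rw [e2]
  exact (norm_add_le _ _).trans (add_le_add (h1.trans h1') key)

end FlatCubic

end Flat

/-! ## The coefficients on `H` and on `H_{-2γ}` -/

section Transfer

variable {𝕜 H : Type*} [RCLike 𝕜] [NormedAddCommGroup H] [InnerProductSpace 𝕜 H]
  [CompleteSpace H] [NormedSpace ℝ H] [IsScalarTower ℝ 𝕜 H] {d : ℕ}
  {L : LinearPart 𝕜 H} {γ : ℝ}

/-- `H_0` is isometric to `H`, so the member `θ = 0` of the scale is a regularity statement on `H`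
itself. -/
theorem IsDrift.exists_contDiff {f : H → H} (hf : IsDrift L γ f) (hγ : 0 ≤ γ) :
    ContDiff ℝ 1 f ∧ ∃ M : ℝ, ∀ x, ‖fderiv ℝ f x‖ ≤ M := by
  obtain ⟨F, hF, ⟨M, hM⟩, hFf⟩ := hf.scale 0 (by linarith)
  have e : f = L.embZero.symm ∘ (F ∘ L.embZero) := by
    funext x
    simp only [Function.comp]
    rw [LinearIsometryEquiv.eq_symm_apply]
    exact (LinearPart.Hs.coef_injective L (hFf x (L.embZero x) rfl)).symm
  refine ⟨?_, M, fun x => ?_⟩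
  · rw [e]
    exact L.embZero.symm.contDiff.comp (hF.comp L.embZero.contDiff)
  · rw [← norm_iteratedFDeriv_one, e, LinearIsometryEquiv.norm_iteratedFDeriv_comp_left,
      LinearIsometryEquiv.norm_iteratedFDeriv_comp_right, norm_iteratedFDeriv_one]
    exact hM _

/-- A diffusion coefficient is flat on `H`, and extends to a flat map of `H_{-2γ}`. -/
theorem IsDiffusion.exists_flatCubic {g : H → EuclideanSpace ℝ (Fin d) →L[ℝ] H}
    (hg : IsDiffusion L γ g) (hγ : 0 ≤ γ) (hθ : -2 * γ ≤ 0) :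
    ∃ M : ℝ, FlatCubic g M ∧
      ∃ G : L.Hs (-2 * γ) → EuclideanSpace ℝ (Fin d) →L[ℝ] L.Hs (-2 * γ), FlatCubic G M ∧
        ∀ x, G (L.emb _ hθ x) = (L.emb _ hθ).comp (g x) := by
  obtain ⟨G₀, hG₀, hM₀, hGg₀⟩ := hg.scale 0 (by linarith)
  obtain ⟨M₀, hM₀⟩ := hM₀ 3 (by norm_num) le_rfl
  obtain ⟨G, hG, hM, hGg⟩ := hg.scale (-2 * γ) le_rfl
  obtain ⟨M, hM⟩ := hM 3 (by norm_num) le_rfl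
  set ι := L.emb (-2 * γ) hθ with hι
  have hd : DenseRange ι := L.denseRange_emb hθ
  set P : (EuclideanSpace ℝ (Fin d) →L[ℝ] L.Hs 0) →L[ℝ] (EuclideanSpace ℝ (Fin d) →L[ℝ] H) :=
    ContinuousLinearMap.compL ℝ _ _ _
      (L.embZero.symm.toContinuousLinearEquiv : L.Hs 0 →L[ℝ] H) with hP
  have hPn : ∀ T, ‖P T‖ ≤ ‖T‖ := fun T => by
    refine ContinuousLinearMap.opNorm_le_bound _ (norm_nonneg _) fun a => ?_
    have : P T a = L.embZero.symm (T a) := rfl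
    rw [this, LinearIsometryEquiv.norm_map]
    exact T.le_opNorm a
  have e : g = P ∘ (G₀ ∘ L.embZero) := by
    funext x
    ext1 a
    have : (P ∘ (G₀ ∘ L.embZero)) x a = L.embZero.symm (G₀ (L.embZero x) a) := rfl
    rw [this, LinearIsometryEquiv.eq_symm_apply]
    exact (LinearPart.Hs.coef_injective L (hGg₀ x (L.embZero x) rfl a)).symm
  have hgC : ContDiff ℝ 3 g := by
    rw [e]
    exact P.contDiff.comp (hG₀.comp L.embZero.contDiff)
  have hgflat : FlatCubic g M₀ := by
    refine ⟨hgC, fun x => ?_, hg.map_zero, hg.fderiv_zero, ?_⟩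
    · have h1 := P.norm_iteratedFDeriv_comp_left
        (f := G₀ ∘ L.embZero) (x := x) (hG₀.comp L.embZero.contDiff).contDiffAt
        (n := 3) le_rfl
      rw [← e, LinearIsometryEquiv.norm_iteratedFDeriv_comp_right] at h1
      have hP1 : ‖P‖ ≤ 1 := ContinuousLinearMap.opNorm_le_bound _ zero_le_one
        (by simpa using hPn)
      refine h1.trans ?_
      calc ‖P‖ * ‖iteratedFDeriv ℝ 3 G₀ (L.embZero x)‖
          ≤ 1 * ‖iteratedFDeriv ℝ 3 G₀ (L.embZero x)‖ := by gcongr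
        _ ≤ M₀ := by rw [one_mul]; exact hM₀ _
    · rw [← norm_eq_zero, ← norm_iteratedFDeriv_one, norm_iteratedFDeriv_fderiv,
        hg.fderiv2_zero, norm_zero]
  have hGι : ∀ x, G (ι x) = ι.comp (g x) := fun x => by
    ext1 a
    exact LinearPart.Hs.coef_injective L (hGg x (ι x) rfl a)
  set Q : (EuclideanSpace ℝ (Fin d) →L[ℝ] H) →L[ℝ]
    (EuclideanSpace ℝ (Fin d) →L[ℝ] L.Hs (-2 * γ)) := ContinuousLinearMap.compL ℝ _ _ _ ι with hQ
  have hGQ : ∀ x, G (ι x) = Q (g x) := hGι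
  have hGd : Differentiable ℝ G := hG.differentiable (by norm_num)
  have hGd2 : Differentiable ℝ (fderiv ℝ G) :=
    (hG.fderiv_right (m := 2) (by norm_num)).differentiable (by norm_num)
  -- The chain rule applied to both sides of `G ∘ ι = Q ∘ g` relates the derivatives along the range
  -- of `ι`. The same is done once more for second derivatives.
  have hD1 : ∀ x h, fderiv ℝ G (ι x) (ι h) = Q (fderiv ℝ g x h) := fun x h => by
    have h1 : HasFDerivAt (fun x => G (ι x)) ((fderiv ℝ G (ι x)).comp ι) x :=
      (hGd (ι x)).hasFDerivAt.comp x ι.hasFDerivAt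
    have h2 : HasFDerivAt (fun x => Q (g x)) (Q.comp (fderiv ℝ g x)) x :=
      Q.hasFDerivAt.comp x (hgflat.differentiable x).hasFDerivAt
    have h3 : (fun x => G (ι x)) = fun x => Q (g x) := funext hGQ
    rw [h3] at h1
    exact congrArg (fun T => T h) (h1.unique h2)
  -- A continuous linear map that vanishes on the dense range of `ι` vanishes.
  have hext : ∀ {Z : Type _} [NormedAddCommGroup Z] [NormedSpace ℝ Z]
      (T : L.Hs (-2 * γ) →L[ℝ] Z), (∀ h, T (ι h) = 0) → T = 0 := by
    intro Z _ _ T hT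
    have := hd.equalizer T.continuous (0 : L.Hs (-2 * γ) →L[ℝ] Z).continuous (by
      funext h; simpa using hT h)
    ext x
    exact congrFun this x
  have hD2 : ∀ x h k, fderiv ℝ (fderiv ℝ G) (ι x) (ι h) (ι k)
      = Q (fderiv ℝ (fderiv ℝ g) x h k) := fun x h k => by
    have h1 : HasFDerivAt (fun x => fderiv ℝ G (ι x) (ι k))
        (((fderiv ℝ (fderiv ℝ G) (ι x)).comp ι).flip (ι k)) x := by
      have h0 : HasFDerivAt (fun x => fderiv ℝ G (ι x)) ((fderiv ℝ (fderiv ℝ G) (ι x)).comp ι) x :=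
        (hGd2 (ι x)).hasFDerivAt.comp x ι.hasFDerivAt
      exact (ContinuousLinearMap.apply ℝ _ (ι k)).hasFDerivAt.comp x h0
    have h2 : HasFDerivAt (fun x => Q (fderiv ℝ g x k))
        (Q.comp ((fderiv ℝ (fderiv ℝ g) x).flip k)) x := by
      have h0 : HasFDerivAt (fun x => fderiv ℝ g x) (fderiv ℝ (fderiv ℝ g) x) x :=
        (hgflat.differentiable_fderiv x).hasFDerivAt
      have h00 : HasFDerivAt (fun x => fderiv ℝ g x k) ((fderiv ℝ (fderiv ℝ g) x).flip k) x :=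
        (ContinuousLinearMap.apply ℝ (EuclideanSpace ℝ (Fin d) →L[ℝ] H) k).hasFDerivAt.comp x h0
      exact Q.hasFDerivAt.comp x h00
    have h3 : (fun x => fderiv ℝ G (ι x) (ι k)) = fun x => Q (fderiv ℝ g x k) :=
      funext fun x => hD1 x k
    rw [h3] at h1
    exact congrArg (fun T => T h) (h1.unique h2)
  -- The third derivative bound is assumed on `H_{-2γ}`. The vanishing at the origin is assumed only
  -- on `H` and carried over by density.
  have hGflat : FlatCubic G M := by
    refine ⟨hG, hM, ?_, ?_, ?_⟩
    · have := hGQ 0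
      rwa [_root_.map_zero, hg.map_zero, _root_.map_zero] at this
    · refine hext _ fun h => ?_
      have := hD1 0 h
      rwa [_root_.map_zero, hg.fderiv_zero, zero_apply, _root_.map_zero] at this
    · refine hext _ fun h => hext _ fun k => ?_
      have := hD2 0 h k
      rwa [_root_.map_zero, hgflat.fderiv2_zero, zero_apply, zero_apply, _root_.map_zero] at this
  exact ⟨max M₀ M, hgflat.mono (le_max_left _ _), G, hGflat.mono (le_max_right _ _), hGι⟩

theorem fderiv_emb {g : H → EuclideanSpace ℝ (Fin d) →L[ℝ] H}
    {θ : ℝ} (hθ : θ ≤ 0) {G : L.Hs θ → EuclideanSpace ℝ (Fin d) →L[ℝ] L.Hs θ}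
    (hg : Differentiable ℝ g) (hG : Differentiable ℝ G)
    (hGι : ∀ x, G (L.emb _ hθ x) = (L.emb _ hθ).comp (g x)) (x h : H)
    (a : EuclideanSpace ℝ (Fin d)) :
    fderiv ℝ G (L.emb _ hθ x) (L.emb _ hθ h) a = L.emb _ hθ (fderiv ℝ g x h a) := by
  have h1 : HasFDerivAt (fun x => G (L.emb _ hθ x))
      ((fderiv ℝ G (L.emb _ hθ x)).comp (L.emb _ hθ)) x :=
    (hG _).hasFDerivAt.comp x (L.emb _ hθ).hasFDerivAt
  have h2 : HasFDerivAt (fun x => (L.emb _ hθ).comp (g x))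
      ((ContinuousLinearMap.compL ℝ (EuclideanSpace ℝ (Fin d)) _ _ (L.emb _ hθ)).comp
        (fderiv ℝ g x)) x :=
    (ContinuousLinearMap.compL ℝ (EuclideanSpace ℝ (Fin d)) _ _
      (L.emb _ hθ)).hasFDerivAt.comp x (hg x).hasFDerivAt
  rw [funext hGι] at h1
  exact congrArg (fun T => T h a) (h1.unique h2)

end Transfer

/-! ## The sewing lemma -/

section Sewing

variable {V : Type*} [NormedAddCommGroup V]

/-- The sum of a germ over the first `n` intervals of a partition. -/
def psum (μ : ℝ → ℝ → V) (τ : ℕ → ℝ) (n : ℕ) : V := ∑ j ∈ Finset.range n, μ (τ j) (τ (j + 1))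

/-- The defect of additivity of the germ `μ` on `[s,t]` is at most `c |v-u|^a`. -/
def AlmostAdditive (μ : ℝ → ℝ → V) (c a s t : ℝ) : Prop :=
  ∀ u m v, s ≤ u → u ≤ m → m ≤ v → v ≤ t → ‖μ u v - μ u m - μ m v‖ ≤ c * (v - u) ^ a

/-- The constant of the sewing lemma. -/
def sewConst (a : ℝ) : ℝ := 2 / (1 - 2 ^ (1 - a))

theorem two_rpow_lt_one {x : ℝ} (hx : x < 0) : (2 : ℝ) ^ x < 1 :=
  Real.rpow_lt_one_of_one_lt_of_neg one_lt_two hx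

theorem sewConst_pos {a : ℝ} (ha : 1 < a) : 0 < sewConst a := by
  have := two_rpow_lt_one (x := 1 - a) (by linarith)
  exact div_pos two_pos (by linarith)

/-- The fixed point equation that closes the induction of the maximal inequality: two defects, plus
two halves that each contribute the factor `2^{-a}`. -/
theorem sewConst_eq {a : ℝ} (ha : 1 < a) : 2 + 2 * (sewConst a * 2 ^ (-a)) = sewConst a := by
  have h := two_rpow_lt_one (x := 1 - a) (by linarith)
  have e : (2 : ℝ) ^ (1 - a) = 2 * 2 ^ (-a) := by
    rw [sub_eq_add_neg, Real.rpow_add two_pos, Real.rpow_one]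
  rw [sewConst]
  rw [e] at h ⊢
  have : (1 - 2 * (2 : ℝ) ^ (-a)) ≠ 0 := by linarith
  field_simp
  ring

namespace AlmostAdditive

variable {μ : ℝ → ℝ → V} {c a s t : ℝ}

theorem self (h : AlmostAdditive μ c a s t) (ha : 1 < a) {x : ℝ} (hs : s ≤ x) (ht : x ≤ t) :
    μ x x = 0 := by
  have := h x x x hs le_rfl le_rfl ht
  rw [sub_self (x : ℝ), Real.zero_rpow (by linarith), mul_zero] at this
  simpa using this

/-- Strong induction on the number of intervals. The interval that contains the midpoint is singled
out; the parts to its left and right have length at most half, so the induction hypothesis gains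
`2^{-a}` on each, and reattaching the pieces costs two defects. No regularity of the partition is
used. -/
theorem psum_sub_le_aux (h : AlmostAdditive μ c a s t) (ha : 1 < a) (hc : 0 ≤ c) {τ : ℕ → ℝ}
    (hτ : Monotone τ) (n : ℕ) : ∀ i : ℕ, s ≤ τ i → τ (i + n) ≤ t →
    ‖psum μ (fun j => τ (i + j)) n - μ (τ i) (τ (i + n))‖
      ≤ sewConst a * c * (τ (i + n) - τ i) ^ a := by
  have hK := sewConst_pos ha
  induction n using Nat.strong_induction_on with
  | _ n ih =>
  intro i hs ht
  have hin : τ i ≤ τ (i + n) := hτ (by omega)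
  have hnn : 0 ≤ τ (i + n) - τ i := by linarith
  rcases Nat.eq_zero_or_pos n with rfl | hn
  · have := h.self ha hs ht
    simp only [add_zero] at this ⊢
    simp only [psum, Finset.range_zero, Finset.sum_empty, this, sub_zero, norm_zero]
    positivity
  set M := (τ i + τ (i + n)) / 2 with hM
  have hex : ∃ j, M ≤ τ (i + j + 1) := ⟨n - 1, by
    rw [show i + (n - 1) + 1 = i + n by omega]; linarith⟩
  classical
  -- The first interval whose right end point reaches the midpoint. By minimality its left end point
  -- has not passed it.
  obtain ⟨j, hj1, hj2, hjn⟩ : ∃ j, M ≤ τ (i + j + 1) ∧ τ (i + j) ≤ M ∧ j < n := by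
    refine ⟨Nat.find hex, Nat.find_spec hex, ?_, ?_⟩
    · rcases Nat.eq_zero_or_pos (Nat.find hex) with h0 | h0
      · rw [h0, add_zero]; linarith
      · have := Nat.find_min hex (m := Nat.find hex - 1) (by omega)
        rw [show i + (Nat.find hex - 1) + 1 = i + Nat.find hex by omega] at this
        linarith [not_le.1 this]
    · have : Nat.find hex ≤ n - 1 := Nat.find_min' hex (by
        rw [show i + (n - 1) + 1 = i + n by omega]; linarith)
      omega
  have m1 : τ i ≤ τ (i + j) := hτ (by omega)
  have m2 : τ (i + j) ≤ τ (i + j + 1) := hτ (by omega)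
  have m3 : τ (i + j + 1) ≤ τ (i + n) := hτ (by omega)
  have ih1 := ih j hjn i hs (by linarith)
  have ih2 := ih (n - (j + 1)) (by omega) (i + j + 1) (by linarith)
    (by rw [show i + j + 1 + (n - (j + 1)) = i + n by omega]; exact ht)
  rw [show i + j + 1 + (n - (j + 1)) = i + n by omega] at ih2
  have d1 := h (τ i) (τ (i + j)) (τ (i + n)) hs m1 (by linarith) ht
  have d2 := h (τ (i + j)) (τ (i + j + 1)) (τ (i + n)) (by linarith) m2 m3 ht
  have hsplit : psum μ (fun k => τ (i + k)) n = psum μ (fun k => τ (i + k)) j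
      + μ (τ (i + j)) (τ (i + j + 1))
      + psum μ (fun k => τ (i + j + 1 + k)) (n - (j + 1)) := by
    conv_lhs => rw [psum, show n = (j + 1) + (n - (j + 1)) by omega, Finset.sum_range_add,
      Finset.sum_range_succ]
    simp only [psum, add_assoc]
  have half : ∀ x : ℝ, 0 ≤ x → x ≤ (τ (i + n) - τ i) / 2 →
      x ^ a ≤ 2 ^ (-a) * (τ (i + n) - τ i) ^ a := fun x hx0 hx => by
    refine (Real.rpow_le_rpow hx0 hx (by linarith)).trans (le_of_eq ?_)
    rw [Real.div_rpow hnn two_pos.le, Real.rpow_neg two_pos.le]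
    field_simp
  have b1 := half (τ (i + j) - τ i) (by linarith) (by linarith)
  have b2 := half (τ (i + n) - τ (i + j + 1)) (by linarith) (by linarith)
  have b3 : (τ (i + n) - τ (i + j)) ^ a ≤ (τ (i + n) - τ i) ^ a :=
    Real.rpow_le_rpow (by linarith) (by linarith) (by linarith)
  set X := (τ (i + n) - τ i) ^ a
  have e : psum μ (fun k => τ (i + k)) n - μ (τ i) (τ (i + n))
      = (psum μ (fun k => τ (i + k)) j - μ (τ i) (τ (i + j)))
        + (psum μ (fun k => τ (i + j + 1 + k)) (n - (j + 1)) - μ (τ (i + j + 1)) (τ (i + n)))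
        - (μ (τ i) (τ (i + n)) - μ (τ i) (τ (i + j)) - μ (τ (i + j)) (τ (i + n)))
        - (μ (τ (i + j)) (τ (i + n)) - μ (τ (i + j)) (τ (i + j + 1))
          - μ (τ (i + j + 1)) (τ (i + n))) := by
    rw [hsplit]; abel
  rw [e]
  have hKc : 0 ≤ sewConst a * c := by positivity
  calc _ ≤ sewConst a * c * (τ (i + j) - τ i) ^ a
        + sewConst a * c * (τ (i + n) - τ (i + j + 1)) ^ a + c * X
        + c * (τ (i + n) - τ (i + j)) ^ a := by
        refine (norm_sub_le _ _).trans (add_le_add ((norm_sub_le _ _).trans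
          (add_le_add ((norm_add_le _ _).trans (add_le_add ih1 ih2)) d1)) d2)
    _ ≤ sewConst a * c * (2 ^ (-a) * X) + sewConst a * c * (2 ^ (-a) * X) + c * X + c * X := by
        gcongr
    _ = (2 + 2 * (sewConst a * 2 ^ (-a))) * c * X := by ring
    _ = _ := by rw [sewConst_eq ha]

/-- The maximal inequality: sums over arbitrary partitions are close to the germ. -/
theorem psum_sub_le (h : AlmostAdditive μ c a s t) (ha : 1 < a) (hc : 0 ≤ c) {τ : ℕ → ℝ}
    (hτ : Monotone τ) {n : ℕ} (hs : s ≤ τ 0) (ht : τ n ≤ t) :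
    ‖psum μ τ n - μ (τ 0) (τ n)‖ ≤ sewConst a * c * (τ n - τ 0) ^ a := by
  simpa using h.psum_sub_le_aux ha hc hτ n 0 hs (by simpa using ht)

theorem sum_rpow_le {τ : ℕ → ℝ} (hτ : Monotone τ) {n : ℕ} {ρ : ℝ} (ha : 1 < a)
    (hρ : ∀ j < n, τ (j + 1) - τ j ≤ ρ) :
    ∑ j ∈ Finset.range n, (τ (j + 1) - τ j) ^ a ≤ ρ ^ (a - 1) * (τ n - τ 0) := by
  rw [← Finset.sum_range_sub τ n, Finset.mul_sum]
  refine Finset.sum_le_sum fun j hj => ?_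
  have h0 : 0 ≤ τ (j + 1) - τ j := sub_nonneg.2 (hτ (by omega))
  have : (τ (j + 1) - τ j) ^ a = (τ (j + 1) - τ j) ^ (a - 1) * (τ (j + 1) - τ j) := by
    rw [← Real.rpow_add_one' h0 (by linarith), sub_add_cancel]
  rw [this]
  exact mul_le_mul_of_nonneg_right
    (Real.rpow_le_rpow h0 (hρ j (Finset.mem_range.1 hj)) (by linarith)) h0

/-- Both sides are the germ on `[p,q] ∩ [x,y]`. If these intervals do not overlap, clipping gives a
single point on either side, where the germ vanishes. -/
theorem clip_symm (h : AlmostAdditive μ c a s t) (ha : 1 < a) {p q x y : ℝ} (hpq : p ≤ q)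
    (hxy : x ≤ y) (hp : s ≤ p) (hq : q ≤ t) (hx : s ≤ x) (hy : y ≤ t) :
    μ (max p (min q x)) (max p (min q y)) = μ (max x (min y p)) (max x (min y q)) := by
  rcases le_total q x with h1 | h1
  · rw [min_eq_left h1, min_eq_left (h1.trans hxy), max_eq_right hpq, max_eq_left, max_eq_left,
      h.self ha (by linarith) hq, h.self ha hx (by linarith)]
    · exact (min_le_right _ _).trans h1
    · exact (min_le_right _ _).trans (hpq.trans h1)
  rcases le_total y p with h2 | h2
  · rw [max_eq_left, max_eq_left, min_eq_left h2, min_eq_left (h2.trans hpq), max_eq_right hxy,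
      h.self ha hp (by linarith), h.self ha (by linarith) hy]
    · exact (min_le_right _ _).trans h2
    · exact (min_le_right _ _).trans (hxy.trans h2)
  · rw [min_eq_right h1, min_eq_right h2, max_eq_right (le_min hpq h2),
      max_eq_right (le_min hxy h1), max_comm, min_comm]

/-- The common refinement is represented by clipping `σ` to each interval of `τ`, so the union of
the two partitions need not be sorted. The maximal inequality on each interval leaves a sum of
`a`-th powers, and the mesh to the power `a - 1` factors out. -/
theorem refine_sub_le (h : AlmostAdditive μ c a s t) (ha : 1 < a) (hc : 0 ≤ c) {τ σ : ℕ → ℝ}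
    (hτ : Monotone τ) (hσ : Monotone σ) {n m : ℕ} (hτ0 : τ 0 = s) (hτn : τ n = t)
    (hσ0 : σ 0 = s) (hσm : σ m = t) {ρ : ℝ} (hρ : ∀ j < n, τ (j + 1) - τ j ≤ ρ) :
    ‖psum μ τ n - ∑ j ∈ Finset.range n, psum μ (fun i => max (τ j) (min (τ (j + 1)) (σ i))) m‖
      ≤ sewConst a * c * (ρ ^ (a - 1) * (t - s)) := by
  have hK := sewConst_pos ha
  rw [psum, ← Finset.sum_sub_distrib]
  calc _ ≤ ∑ j ∈ Finset.range n, sewConst a * c * (τ (j + 1) - τ j) ^ a := by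
        refine (norm_sum_le _ _).trans (Finset.sum_le_sum fun j hj => ?_)
        have hj := Finset.mem_range.1 hj
        have a0 : s ≤ τ j := hτ0 ▸ hτ (Nat.zero_le j)
        have a1 : τ (j + 1) ≤ t := hτn ▸ hτ hj
        have a2 : τ j ≤ τ (j + 1) := hτ (by omega)
        have e0 : max (τ j) (min (τ (j + 1)) (σ 0)) = τ j := by
          rw [hσ0]; exact max_eq_left ((min_le_right _ _).trans a0)
        have e1 : max (τ j) (min (τ (j + 1)) (σ m)) = τ (j + 1) := by
          rw [hσm, min_eq_left a1, max_eq_right a2]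
        have key := h.psum_sub_le ha hc (τ := fun i => max (τ j) (min (τ (j + 1)) (σ i))) (n := m)
          (fun i k hik => max_le_max le_rfl (min_le_min le_rfl (hσ hik)))
          (by rw [e0]; exact a0) (by rw [e1]; exact a1)
        rw [e0, e1, norm_sub_rev] at key
        exact key
    _ ≤ _ := by
        rw [← Finset.mul_sum, ← hτn, ← hτ0]
        exact mul_le_mul_of_nonneg_left (sum_rpow_le hτ ha hρ) (by positivity)

/-- Sums over two partitions of small mesh are close to each other. -/
theorem psum_sub_psum_le (h : AlmostAdditive μ c a s t) (ha : 1 < a) (hc : 0 ≤ c) {τ σ : ℕ → ℝ}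
    (hτ : Monotone τ) (hσ : Monotone σ) {n m : ℕ} (hτ0 : τ 0 = s) (hτn : τ n = t)
    (hσ0 : σ 0 = s) (hσm : σ m = t) {ρ ρ' : ℝ} (hρ : ∀ j < n, τ (j + 1) - τ j ≤ ρ)
    (hρ' : ∀ j < m, σ (j + 1) - σ j ≤ ρ') :
    ‖psum μ τ n - psum μ σ m‖
      ≤ sewConst a * c * (ρ ^ (a - 1) * (t - s)) + sewConst a * c * (ρ' ^ (a - 1) * (t - s)) := by
  have h1 := h.refine_sub_le ha hc hτ hσ hτ0 hτn hσ0 hσm hρ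
  have h2 := h.refine_sub_le ha hc hσ hτ hσ0 hσm hτ0 hτn hρ'
  -- The clipped double sum is symmetric in the two partitions, so both are compared with the same
  -- quantity.
  have e : ∑ j ∈ Finset.range n, psum μ (fun i => max (τ j) (min (τ (j + 1)) (σ i))) m
      = ∑ i ∈ Finset.range m, psum μ (fun j => max (σ i) (min (σ (i + 1)) (τ j))) n := by
    simp only [psum]
    rw [Finset.sum_comm]
    refine Finset.sum_congr rfl fun i hi => Finset.sum_congr rfl fun j hj => ?_
    have hi := Finset.mem_range.1 hi
    have hj := Finset.mem_range.1 hj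
    exact h.clip_symm ha (hτ (by omega)) (hσ (by omega)) (hτ0 ▸ hτ (Nat.zero_le j))
      (hτn ▸ hτ hj) (hσ0 ▸ hσ (Nat.zero_le i)) (hσm ▸ hσ hi)
  rw [e] at h1
  calc _ = ‖(psum μ τ n - ∑ i ∈ Finset.range m, psum μ (fun j => max (σ i) (min (σ (i + 1)) (τ j))) n)
        - (psum μ σ m - ∑ i ∈ Finset.range m,
          psum μ (fun j => max (σ i) (min (σ (i + 1)) (τ j))) n)‖ := by
        congr 1; abel
    _ ≤ _ := (norm_sub_le _ _).trans (add_le_add h1 h2)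

end AlmostAdditive

/-! ### Uniform partitions -/

/-- The points of the partition of `[s,t]` into `n` intervals of equal length. -/
def unif (s t : ℝ) (n j : ℕ) : ℝ := s + j * ((t - s) / n)

theorem unif_zero (s t : ℝ) (n : ℕ) : unif s t n 0 = s := by simp [unif]

theorem unif_last (s t : ℝ) {n : ℕ} (hn : n ≠ 0) : unif s t n n = t := by
  have : (n : ℝ) ≠ 0 := by exact_mod_cast hn
  rw [unif]; field_simp; ring

theorem unif_mono {s t : ℝ} (h : s ≤ t) (n : ℕ) : Monotone (unif s t n) := by
  intro i j hij
  have : 0 ≤ (t - s) / n := div_nonneg (by linarith) (by positivity)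
  have h2 : (i : ℝ) ≤ j := by exact_mod_cast hij
  simp only [unif]
  gcongr

theorem unif_mesh (s t : ℝ) (n j : ℕ) : unif s t n (j + 1) - unif s t n j = (t - s) / n := by
  simp only [unif]; push_cast; ring

theorem sum_range_two_mul {M : Type*} [AddCommMonoid M] (f : ℕ → M) (n : ℕ) :
    ∑ j ∈ Finset.range (2 * n), f j = ∑ j ∈ Finset.range n, (f (2 * j) + f (2 * j + 1)) := by
  induction n with
  | zero => simp
  | succ n ih =>
    rw [show 2 * (n + 1) = 2 * n + 1 + 1 by ring, Finset.sum_range_succ, Finset.sum_range_succ, ih,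
      Finset.sum_range_succ, add_assoc]

theorem unif_two_mul (s t : ℝ) (n j : ℕ) : unif s t (2 * n) (2 * j) = unif s t n j := by
  simp only [unif]; push_cast
  rcases eq_or_ne (n : ℝ) 0 with h | h
  · simp [h]
  · field_simp

/-- With `x = n^{1/3}` and `y = (n+1)^{1/3}`, the identity `y³ - x³ = 1` gives `1 ≤ 3 y² (y - x)`,
which is the induction step. -/
theorem sum_rpow_neg_two_thirds_le (n : ℕ) :
    ∑ i ∈ Finset.range n, ((i : ℝ) + 1) ^ (-(2 / 3) : ℝ) ≤ 3 * (n : ℝ) ^ (1 / 3 : ℝ) := by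
  induction n with
  | zero => simp
  | succ n ih =>
    rw [Finset.sum_range_succ]
    set x := (n : ℝ) ^ (1 / 3 : ℝ) with hx
    set y := ((n + 1 : ℕ) : ℝ) ^ (1 / 3 : ℝ) with hy
    have hx0 : 0 ≤ x := by positivity
    have hy0 : 0 < y := by positivity
    have hxy : x ≤ y := by
      apply Real.rpow_le_rpow (by positivity) (by push_cast; linarith) (by norm_num)
    have hx3 : x ^ 3 = n := by
      rw [hx, ← Real.rpow_natCast, ← Real.rpow_mul (by positivity)]; norm_num
    have hy3 : y ^ 3 = n + 1 := by
      rw [hy, ← Real.rpow_natCast, ← Real.rpow_mul (by positivity)]; norm_num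
    have hy2 : ((n : ℝ) + 1) ^ (-(2 / 3) : ℝ) = (y ^ 2)⁻¹ := by
      rw [hy, ← Real.rpow_natCast, ← Real.rpow_mul (by positivity), ← Real.rpow_neg (by positivity)]
      push_cast
      norm_num
    rw [hy2]
    have key : (y ^ 2)⁻¹ ≤ 3 * (y - x) := by
      rw [inv_le_iff_one_le_mul₀ (by positivity)]
      nlinarith [mul_nonneg hx0 hy0.le, mul_nonneg (sub_nonneg.2 hxy) hx0,
        mul_nonneg (sub_nonneg.2 hxy) (mul_nonneg (sub_nonneg.2 hxy) hy0.le),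
        mul_nonneg (sub_nonneg.2 hxy) (mul_nonneg (sub_nonneg.2 hxy) hx0)]
    linarith

/-- The ratio of the geometric series in the singular sewing lemma. -/
def singRatio (γ : ℝ) : ℝ := 2 ^ (1 / 3 - γ)

/-- The constant of the singular sewing lemma. -/
def singConst (γ : ℝ) : ℝ := 6 / (1 - singRatio γ)

theorem singConst_pos {γ : ℝ} (hγ : 1 / 3 < γ) : 0 < singConst γ := by
  have := two_rpow_lt_one (x := 1 / 3 - γ) (by linarith)
  exact div_pos (by norm_num) (by rw [singRatio]; linarith)

/-- Halving a uniform partition. In units of the step `k`, the midpoint of the `i`-th interval from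
the right lies at distance `i + 1/2` from `t`, so the singular weights sum like `∑ (i+1)^{-2/3}`,
that is, like `n^{1/3}`. With the factor `k^γ` the total is of order `n^{1/3-γ}`, which decays along
dyadic `n` exactly because `γ > 1/3`. The condition `m < v` keeps the weight away from the default
value of the power at `0`. -/
theorem psum_unif_step {μ : ℝ → ℝ → V} {γ c s t : ℝ} (hγ : 1 / 3 < γ) (hγ' : γ ≤ 1 / 2)
    (hc : 0 ≤ c) (hst : s < t)
    (h : ∀ u m v, s ≤ u → u ≤ m → m < v → v ≤ t →
      ‖μ u v - μ u m - μ m v‖ ≤ c * (t - m) ^ (-2 * γ) * (v - u) ^ (3 * γ)) {n : ℕ} (hn : 0 < n) :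
    ‖psum μ (unif s t n) n - psum μ (unif s t (2 * n)) (2 * n)‖
      ≤ 6 * c * (t - s) ^ γ * (n : ℝ) ^ (1 / 3 - γ) := by
  have hn' : (0 : ℝ) < n := by exact_mod_cast hn
  set k : ℝ := (t - s) / n with hk
  have hk0 : 0 < k := div_pos (by linarith) hn'
  rw [psum, psum, sum_range_two_mul, ← Finset.sum_sub_distrib]
  have hterm : ∀ j ∈ Finset.range n,
      ‖μ (unif s t n j) (unif s t n (j + 1)) - (μ (unif s t (2 * n) (2 * j))
        (unif s t (2 * n) (2 * j + 1)) + μ (unif s t (2 * n) (2 * j + 1))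
        (unif s t (2 * n) (2 * j + 1 + 1)))‖
      ≤ 2 * c * k ^ γ * (((n - 1 - j : ℕ) : ℝ) + 1) ^ (-(2 / 3) : ℝ) := by
    intro j hj
    have hj := Finset.mem_range.1 hj
    have e1 : unif s t (2 * n) (2 * j + 1 + 1) = unif s t n (j + 1) := by
      exact unif_two_mul s t n (j + 1)
    have e0 : unif s t (2 * n) (2 * j) = unif s t n j := unif_two_mul ..
    have hm := unif_mono hst.le (2 * n)
    have hm' := unif_mono hst.le n
    have hb := h (unif s t n j) (unif s t (2 * n) (2 * j + 1)) (unif s t n (j + 1))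
      (by have := hm' (Nat.zero_le j); rwa [unif_zero] at this)
      (by rw [← e0]; exact hm (by omega))
      (by
        have := unif_mesh s t (2 * n) (2 * j + 1)
        rw [e1] at this
        have h3 : 0 < (t - s) / ((2 * n : ℕ) : ℝ) := div_pos (by linarith) (by push_cast; linarith)
        linarith)
      (by have := hm' (show j + 1 ≤ n by omega); rwa [unif_last s t hn.ne'] at this)
    rw [e0, e1, ← sub_sub]
    refine hb.trans ?_
    rw [unif_mesh, ← hk]
    -- Intervals are counted from the right end point, where the singularity sits.
    set i : ℝ := ((n - 1 - j : ℕ) : ℝ) with hi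
    have hie : i = n - 1 - j := by
      rw [hi, Nat.cast_sub (by omega), Nat.cast_sub (by omega)]; push_cast; ring
    have hi0 : 0 ≤ i := by positivity
    have et : t - unif s t (2 * n) (2 * j + 1) = (i + 1 / 2) * k := by
      rw [hie, unif, hk]; push_cast; field_simp; ring
    have h1 : (t - unif s t (2 * n) (2 * j + 1)) ^ (-2 * γ)
        ≤ (2 * (i + 1) ^ (-(2 / 3) : ℝ)) * k ^ (-2 * γ) := by
      rw [et, Real.mul_rpow (by positivity) hk0.le]
      gcongr
      -- From `i + 1/2 ≥ (i+1)/2`, the factor is `2^{2γ} ≤ 2`. The exponent is relaxed from `-2γ` to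
      -- `-2/3`, which is allowed because the base is at least `1`.
      calc (i + 1 / 2) ^ (-2 * γ) ≤ ((i + 1) * 2⁻¹) ^ (-2 * γ) :=
            Real.rpow_le_rpow_of_nonpos (by positivity) (by linarith) (by linarith)
        _ = (i + 1) ^ (-2 * γ) * 2 ^ (2 * γ) := by
            rw [Real.mul_rpow (by positivity) (by positivity), Real.inv_rpow two_pos.le,
              ← Real.rpow_neg two_pos.le]
            ring_nf
        _ ≤ (i + 1) ^ (-(2 / 3) : ℝ) * 2 ^ (1 : ℝ) := by
            gcongr <;> linarith
        _ = _ := by rw [Real.rpow_one]; ring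
    calc c * (t - unif s t (2 * n) (2 * j + 1)) ^ (-2 * γ) * k ^ (3 * γ)
        ≤ c * ((2 * (i + 1) ^ (-(2 / 3) : ℝ)) * k ^ (-2 * γ)) * k ^ (3 * γ) := by gcongr
      _ = 2 * c * (k ^ (-2 * γ) * k ^ (3 * γ)) * (i + 1) ^ (-(2 / 3) : ℝ) := by ring
      _ = _ := by rw [← Real.rpow_add hk0]; ring_nf
  calc _ ≤ ∑ j ∈ Finset.range n,
        2 * c * k ^ γ * (((n - 1 - j : ℕ) : ℝ) + 1) ^ (-(2 / 3) : ℝ) :=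
        (norm_sum_le _ _).trans (Finset.sum_le_sum hterm)
    _ = 2 * c * k ^ γ * ∑ j ∈ Finset.range n, ((j : ℝ) + 1) ^ (-(2 / 3) : ℝ) := by
        rw [← Finset.mul_sum, Finset.sum_range_reflect (fun j => ((j : ℝ) + 1) ^ (-(2 / 3) : ℝ))]
    _ ≤ 2 * c * k ^ γ * (3 * (n : ℝ) ^ (1 / 3 : ℝ)) := by
        gcongr
        exact sum_rpow_neg_two_thirds_le n
    _ = _ := by
        rw [hk, Real.div_rpow (by linarith) hn'.le, Real.rpow_sub hn']
        field_simp
        ring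

/-- The singular sewing lemma: the sums over dyadic partitions converge. -/
theorem exists_dyadic_limit [CompleteSpace V] {μ : ℝ → ℝ → V} {γ c s t : ℝ} (hγ : 1 / 3 < γ)
    (hγ' : γ ≤ 1 / 2) (hc : 0 ≤ c) (hst : s < t)
    (h : ∀ u m v, s ≤ u → u ≤ m → m < v → v ≤ t →
      ‖μ u v - μ u m - μ m v‖ ≤ c * (t - m) ^ (-2 * γ) * (v - u) ^ (3 * γ)) :
    ∃ I : V, Tendsto (fun n : ℕ => psum μ (unif s t (2 ^ n)) (2 ^ n)) atTop (𝓝 I) ∧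
      ‖I - μ s t‖ ≤ singConst γ * c * (t - s) ^ γ := by
  have hr : singRatio γ < 1 := two_rpow_lt_one (by linarith)
  have hstep : ∀ n : ℕ, dist (psum μ (unif s t (2 ^ n)) (2 ^ n))
      (psum μ (unif s t (2 ^ (n + 1))) (2 ^ (n + 1)))
      ≤ (6 * c * (t - s) ^ γ) * singRatio γ ^ n := fun n => by
    rw [dist_eq_norm, pow_succ' 2 n]
    refine (psum_unif_step hγ hγ' hc hst h (n := 2 ^ n) (by positivity)).trans (le_of_eq ?_)
    congr 1
    rw [singRatio, ← Real.rpow_natCast (2 ^ (1 / 3 - γ) : ℝ), ← Real.rpow_mul two_pos.le]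
    push_cast
    rw [← Real.rpow_natCast 2 n, ← Real.rpow_mul two_pos.le, mul_comm]
  obtain ⟨I, hI⟩ := cauchySeq_tendsto_of_complete (cauchySeq_of_le_geometric _ _ hr hstep)
  refine ⟨I, hI, ?_⟩
  have := dist_le_of_le_geometric_of_tendsto₀ _ _ hr hstep hI
  rw [dist_comm, dist_eq_norm] at this
  simp only [pow_zero] at this
  have e : psum μ (unif s t 1) 1 = μ s t := by
    rw [psum, Finset.sum_range_one, unif_zero, zero_add, unif_last s t one_ne_zero]
  rw [e] at this
  refine this.trans (le_of_eq ?_)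
  rw [singConst]
  ring

end Sewing

/-! ## Hölder bounds -/

section Holder

theorem holderSup_nonneg {r : ℝ} {q : I01 → I01 → ℝ} (hq : ∀ t s, 0 ≤ q t s) :
    0 ≤ holderSup r q :=
  Real.iSup_nonneg fun z => div_nonneg (hq _ _)
    (Real.rpow_nonneg (sub_nonneg.2 (Subtype.coe_le_coe.2 z.2)) _)

theorem le_holderSup {r : ℝ} {q : I01 → I01 → ℝ} (h : HolderFinite r q) (hq : ∀ t s, 0 ≤ q t s)
    (hq0 : ∀ t, q t t = 0) {s t : I01} (hst : s ≤ t) :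
    q t s ≤ holderSup r q * ((t : ℝ) - s) ^ r := by
  rcases eq_or_lt_of_le hst with rfl | hlt
  · rw [hq0]
    exact mul_nonneg (holderSup_nonneg hq) (Real.rpow_nonneg (by simp) _)
  · have hpos : 0 < ((t : ℝ) - s) ^ r := Real.rpow_pos_of_pos (sub_pos.2 hlt) _
    rw [← div_le_iff₀ hpos]
    exact le_ciSup h (⟨(t, s), hst⟩ : Simplex)

theorem div_rpow_le_of_le {r B : ℝ} {q : I01 → I01 → ℝ} (hB : 0 ≤ B)
    (h : ∀ s t : I01, s ≤ t → q t s ≤ B * ((t : ℝ) - s) ^ r) (z : Simplex) :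
    q z.1.1 z.1.2 / ((z.1.1 : ℝ) - (z.1.2 : ℝ)) ^ r ≤ B := by
  have h0 : 0 ≤ (z.1.1 : ℝ) - z.1.2 := sub_nonneg.2 (Subtype.coe_le_coe.2 z.2)
  exact div_le_of_le_mul₀ (Real.rpow_nonneg h0 _) hB (h _ _ z.2)

theorem holderFinite_of_le {r B : ℝ} {q : I01 → I01 → ℝ} (hB : 0 ≤ B)
    (h : ∀ s t : I01, s ≤ t → q t s ≤ B * ((t : ℝ) - s) ^ r) : HolderFinite r q :=
  ⟨B, by rintro _ ⟨z, rfl⟩; exact div_rpow_le_of_le hB h z⟩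

instance : Nonempty Simplex := ⟨⟨(0, 0), le_rfl⟩⟩

namespace RoughPath

variable {γ : ℝ} {d : ℕ} (w : RoughPath γ d)

theorem norm1_nonneg : 0 ≤ w.norm1 := holderSup_nonneg fun _ _ => norm_nonneg _

theorem norm2_nonneg : 0 ≤ w.norm2 := holderSup_nonneg fun _ _ => norm_nonneg _

theorem area_self (hγ : 0 < γ) (t : ℝ) : w.area t t = 0 := by
  obtain ⟨M, hM⟩ := w.area_holder (|t| + 1) (by positivity)
  have := hM t t (by linarith [neg_abs_le t]) le_rfl (by linarith [le_abs_self t])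
  rw [sub_self, Real.zero_rpow (by linarith), mul_zero] at this
  exact norm_le_zero_iff.1 this

theorem norm_path_sub_le {s t : ℝ} (hs : 0 ≤ s) (hst : s ≤ t) (ht : t ≤ 1) :
    ‖w.path t - w.path s‖ ≤ w.norm1 * (t - s) ^ γ := by
  obtain ⟨M, hM⟩ := w.path_holder 1 one_pos
  have hf : HolderFinite γ fun t s : I01 => ‖w.path t - w.path s‖ :=
    holderFinite_of_le (B := |M|) (abs_nonneg _) fun s t hst => by
      have h0 : (s : ℝ) ≤ t := hst
      refine (hM s t (by linarith [s.2.1]) hst t.2.2).trans ?_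
      have := Real.rpow_nonneg (sub_nonneg.2 h0) γ
      gcongr
      exact le_abs_self M
  exact le_holderSup hf (fun _ _ => norm_nonneg _) (fun t => by simp)
    (s := ⟨s, hs, by linarith⟩) (t := ⟨t, by linarith, ht⟩) hst

theorem norm_area_le (hγ : 0 < γ) {s t : ℝ} (hs : 0 ≤ s) (hst : s ≤ t) (ht : t ≤ 1) :
    ‖w.area t s‖ ≤ w.norm2 * (t - s) ^ (2 * γ) := by
  obtain ⟨M, hM⟩ := w.area_holder 1 one_pos
  have hf : HolderFinite (2 * γ) fun t s : I01 => ‖w.area t s‖ :=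
    holderFinite_of_le (B := |M|) (abs_nonneg _) fun s t hst => by
      have h0 : (s : ℝ) ≤ t := hst
      refine (hM s t (by linarith [s.2.1]) hst t.2.2).trans ?_
      have := Real.rpow_nonneg (sub_nonneg.2 h0) (2 * γ)
      gcongr
      exact le_abs_self M
  exact le_holderSup hf (fun _ _ => norm_nonneg _) (fun t => by simp [w.area_self hγ])
    (s := ⟨s, hs, by linarith⟩) (t := ⟨t, by linarith, ht⟩) hst

theorem norm_path_sub_le_norm1 (hγ : 0 ≤ γ) {s t : ℝ} (hs : 0 ≤ s) (hst : s ≤ t) (ht : t ≤ 1) :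
    ‖w.path t - w.path s‖ ≤ w.norm1 := by
  refine (w.norm_path_sub_le hs hst ht).trans ?_
  exact mul_le_of_le_one_right w.norm1_nonneg
    (Real.rpow_le_one (by linarith) (by linarith) hγ)

end RoughPath

end Holder

/-! ### Rough integrals with operator kernels. -/

section RoughIntegral

variable {𝕜 H : Type*} [RCLike 𝕜] [NormedAddCommGroup H] [InnerProductSpace 𝕜 H]
  [CompleteSpace H] [NormedSpace ℝ H] [IsScalarTower ℝ 𝕜 H] {d : ℕ}

/-! ## The norm of `H_θ` as a seminorm on `H` -/

namespace LinearPart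

variable (L : LinearPart 𝕜 H) {θ : ℝ}

theorem nrm_add_le (hθ : θ ≤ 0) (x y : H) : L.nrm θ (x + y) ≤ L.nrm θ x + L.nrm θ y := by
  simp only [← L.norm_emb hθ, map_add]; exact norm_add_le _ _

theorem nrm_sub_le (hθ : θ ≤ 0) (x y : H) : L.nrm θ (x - y) ≤ L.nrm θ x + L.nrm θ y := by
  simp only [← L.norm_emb hθ, map_sub]; exact norm_sub_le _ _

theorem nrm_neg (hθ : θ ≤ 0) (x : H) : L.nrm θ (-x) = L.nrm θ x := by
  simp only [← L.norm_emb hθ, map_neg, norm_neg]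

theorem nrm_smul (hθ : θ ≤ 0) (c : ℝ) (x : H) : L.nrm θ (c • x) = |c| * L.nrm θ x := by
  simp only [← L.norm_emb hθ, map_smul, norm_smul, Real.norm_eq_abs]

theorem nrm_zero (hθ : θ ≤ 0) : L.nrm θ 0 = 0 := (L.nrm_eq_zero hθ).2 rfl

theorem nrm_sum_le (hθ : θ ≤ 0) {ι : Type*} (s : Finset ι) (x : ι → H) :
    L.nrm θ (∑ i ∈ s, x i) ≤ ∑ i ∈ s, L.nrm θ (x i) := by
  simp only [← L.norm_emb hθ, map_sum]; exact norm_sum_le _ _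

end LinearPart

/-! ## Contractions with the area -/

section Contract

variable (z z₁ : EuclideanSpace ℝ (Fin d) →L[ℝ] EuclideanSpace ℝ (Fin d) →L[ℝ] H)

theorem contract_sub_left (m : EuclideanSpace ℝ (Fin d × Fin d)) :
    contract (z - z₁) m = contract z m - contract z₁ m := by
  simp only [contract, ← Finset.sum_sub_distrib, sub_apply, smul_sub]

theorem bilin_eq_sum (x y : EuclideanSpace ℝ (Fin d)) :
    z x y = ∑ i, ∑ j, (x i * y j) • z (EuclideanSpace.single i 1) (EuclideanSpace.single j 1) := by
  have hx := (EuclideanSpace.basisFun (Fin d) ℝ).sum_repr x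
  have hy := (EuclideanSpace.basisFun (Fin d) ℝ).sum_repr y
  simp only [EuclideanSpace.basisFun_repr, EuclideanSpace.basisFun_apply] at hx hy
  conv_lhs => rw [← hx, ← hy]
  simp only [map_sum, sum_apply, map_smul, smul_apply, Finset.smul_sum, smul_smul]
  rw [Finset.sum_comm]
  simp only [mul_comm]

/-- Chen's relation contracted with `z'`. The cross term is what compensates, in the defect of the
germ, the first order change of `z`. -/
theorem contract_chen {γ : ℝ} (w : RoughPath γ d) {s u t : ℝ} (hsu : s ≤ u) (hut : u ≤ t) :
    contract z (w.area t s) = contract z (w.area t u) + contract z (w.area u s)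
      + z (w.path u - w.path s) (w.path t - w.path u) := by
  rw [bilin_eq_sum]
  simp only [contract, ← Finset.sum_add_distrib, ← add_smul]
  refine Finset.sum_congr rfl fun i _ => Finset.sum_congr rfl fun j _ => ?_
  congr 1
  linarith [w.chen s u t hsu hut i j]

theorem norm_contract_le {b : ℝ} (hz : ‖z‖ ≤ b) (m : EuclideanSpace ℝ (Fin d × Fin d)) :
    ‖contract z m‖ ≤ (d : ℝ) ^ 2 * b * ‖m‖ := by
  have : ∀ i j : Fin d, ‖m (i, j) • z (EuclideanSpace.single i (1 : ℝ))
      (EuclideanSpace.single j (1 : ℝ))‖ ≤ b * ‖m‖ := fun i j => by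
    rw [norm_smul, mul_comm]
    have h1 := (z (EuclideanSpace.single i (1 : ℝ))).le_opNorm (EuclideanSpace.single j (1 : ℝ))
    have h2 := z.le_of_opNorm_le hz (EuclideanSpace.single i (1 : ℝ))
    simp only [PiLp.norm_single, norm_one, mul_one] at h1 h2
    exact mul_le_mul (h1.trans h2) (PiLp.norm_apply_le m (i, j)) (norm_nonneg _)
      ((norm_nonneg _).trans hz)
  calc ‖contract z m‖ ≤ ∑ i : Fin d, ∑ j : Fin d, b * ‖m‖ :=
        (norm_sum_le _ _).trans (Finset.sum_le_sum fun i _ =>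
          (norm_sum_le _ _).trans (Finset.sum_le_sum fun j _ => this i j))
    _ = _ := by simp; ring

theorem nrm_contract_sub_le (L : LinearPart 𝕜 H) {θ : ℝ} (hθ : θ ≤ 0) {b r : ℝ}
    (hb : ∀ a c, L.nrm θ (z a c - L.S r (z₁ a c)) ≤ b * ‖a‖ * ‖c‖)
    (m : EuclideanSpace ℝ (Fin d × Fin d)) :
    L.nrm θ (contract z m - L.S r (contract z₁ m)) ≤ (d : ℝ) ^ 2 * b * ‖m‖ := by
  have e : contract z m - L.S r (contract z₁ m) = ∑ i : Fin d, ∑ j : Fin d,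
      m (i, j) • (z (EuclideanSpace.single i (1 : ℝ)) (EuclideanSpace.single j (1 : ℝ))
        - L.S r (z₁ (EuclideanSpace.single i (1 : ℝ)) (EuclideanSpace.single j (1 : ℝ)))) := by
    simp only [contract, map_sum, ContinuousLinearMap.map_smul_of_tower, smul_sub,
      Finset.sum_sub_distrib]
  have : ∀ i j : Fin d, L.nrm θ (m (i, j) •
      (z (EuclideanSpace.single i (1 : ℝ)) (EuclideanSpace.single j (1 : ℝ))
        - L.S r (z₁ (EuclideanSpace.single i (1 : ℝ)) (EuclideanSpace.single j (1 : ℝ)))))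
      ≤ b * ‖m‖ := fun i j => by
    have h1 := hb (EuclideanSpace.single i (1 : ℝ)) (EuclideanSpace.single j (1 : ℝ))
    simp only [PiLp.norm_single, norm_one, mul_one] at h1
    rw [L.nrm_smul hθ, mul_comm, ← Real.norm_eq_abs]
    exact mul_le_mul h1 (PiLp.norm_apply_le m (i, j)) (norm_nonneg _)
      ((L.nrm_nonneg _ _).trans h1)
  rw [e]
  calc _ ≤ ∑ i : Fin d, ∑ j : Fin d, b * ‖m‖ :=
        (L.nrm_sum_le hθ _ _).trans (Finset.sum_le_sum fun i _ =>
          (L.nrm_sum_le hθ _ _).trans (Finset.sum_le_sum fun j _ => this i j))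
    _ = _ := by simp; ring

end Contract

/-! ## General properties of the rough integral -/

namespace IsRoughIntegral

variable {L : LinearPart 𝕜 H} {γ : ℝ} {w : RoughPath γ d} {Q : ℝ → H →L[𝕜] H}
  {z z₁ : I01 → EuclideanSpace ℝ (Fin d) →L[ℝ] H}
  {z' z₁' : I01 → EuclideanSpace ℝ (Fin d) →L[ℝ] EuclideanSpace ℝ (Fin d) →L[ℝ] H}
  {s t : ℝ} {I I₁ : H}

theorem exists_unif_mesh_lt {s t ρ : ℝ} (hst : s ≤ t) (hρ : 0 < ρ) :
    ∃ n : ℕ, n ≠ 0 ∧ ∀ j, unif s t n (j + 1) - unif s t n j < ρ := by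
  obtain ⟨n, hn⟩ := exists_nat_gt ((t - s) / ρ)
  have hn0 : (0 : ℝ) < n := lt_of_le_of_lt (div_nonneg (by linarith) hρ.le) hn
  refine ⟨n, by exact_mod_cast hn0.ne', fun j => ?_⟩
  rw [unif_mesh, div_lt_iff₀ hn0]
  rw [div_lt_iff₀ hρ] at hn
  linarith

theorem unique (hθ : -2 * γ ≤ 0) (hst : s ≤ t) (h : IsRoughIntegral L w Q z z' s t I)
    (h₁ : IsRoughIntegral L w Q z z' s t I₁) : I = I₁ := by
  rw [← sub_eq_zero, ← L.nrm_eq_zero hθ]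
  refine le_antisymm (le_of_forall_pos_le_add fun ε hε => ?_) (L.nrm_nonneg _ _)
  obtain ⟨ρ, hρ, hI⟩ := h (ε / 2) (by linarith)
  obtain ⟨ρ₁, hρ₁, hI₁⟩ := h₁ (ε / 2) (by linarith)
  obtain ⟨n, hn, hmesh⟩ := exists_unif_mesh_lt hst (lt_min hρ hρ₁)
  have a := hI n _ (unif_mono hst n) (unif_zero ..) (unif_last _ _ hn)
    fun j _ => (hmesh j).trans_le (min_le_left _ _)
  have a₁ := hI₁ n _ (unif_mono hst n) (unif_zero ..) (unif_last _ _ hn)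
    fun j _ => (hmesh j).trans_le (min_le_right _ _)
  set X := ∑ j ∈ Finset.range n, Q (unif s t n j)
      (ext01 z (unif s t n j) (w.path (unif s t n (j + 1)) - w.path (unif s t n j))
        + contract (ext01 z' (unif s t n j)) (w.area (unif s t n (j + 1)) (unif s t n j)))
  have e : I - I₁ = (X - I₁) - (X - I) := by abel
  rw [e]
  have := L.nrm_sub_le hθ (X - I₁) (X - I)
  linarith

theorem roughIntegral_eq (hθ : -2 * γ ≤ 0) (hst : s ≤ t) (h : IsRoughIntegral L w Q z z' s t I) :
    roughIntegral L w Q z z' s t = I := by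
  have hex : ∃ I, IsRoughIntegral L w Q z z' s t I := ⟨I, h⟩
  rw [roughIntegral, dif_pos hex]
  exact hex.choose_spec.unique hθ hst h

/-- Takes a bounded operator out of the integral. The flow property and the stable and unstable
integrals are all obtained this way from convolutions with `S`. -/
theorem comp {P : H →L[𝕜] H} {c : ℝ} (hP : ∀ x, L.nrm (-2 * γ) (P x) ≤ c * L.nrm (-2 * γ) x)
    {Q' : ℝ → H →L[𝕜] H} (hQ : ∀ u ∈ Icc s t, ∀ x, Q' u x = P (Q u x))
    (h : IsRoughIntegral L w Q z z' s t I) : IsRoughIntegral L w Q' z z' s t (P I) := by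
  intro ε hε
  -- No sign is assumed for `c`, hence the denominator `|c| + 1`.
  obtain ⟨ρ, hρ, hI⟩ := h (ε / (|c| + 1)) (by positivity)
  refine ⟨ρ, hρ, fun n τ hτ h0 hn hmesh => ?_⟩
  have a := hI n τ hτ h0 hn hmesh
  have e : ∑ j ∈ Finset.range n, Q' (τ j) (ext01 z (τ j) (w.path (τ (j + 1)) - w.path (τ j))
        + contract (ext01 z' (τ j)) (w.area (τ (j + 1)) (τ j)))
      = P (∑ j ∈ Finset.range n, Q (τ j) (ext01 z (τ j) (w.path (τ (j + 1)) - w.path (τ j))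
        + contract (ext01 z' (τ j)) (w.area (τ (j + 1)) (τ j)))) := by
    rw [map_sum]
    refine Finset.sum_congr rfl fun j hj => hQ _ ⟨?_, ?_⟩ _
    · rw [← h0]; exact hτ (Nat.zero_le j)
    · rw [← hn]; exact hτ (Finset.mem_range.1 hj).le
  rw [e, ← map_sub]
  refine (hP _).trans_lt ?_
  rw [lt_div_iff₀ (by positivity)] at a
  refine lt_of_le_of_lt ?_ a
  rw [mul_comm]
  exact mul_le_mul_of_nonneg_left (by linarith [le_abs_self c]) (L.nrm_nonneg _ _)

theorem sub (hθ : -2 * γ ≤ 0) (h : IsRoughIntegral L w Q z z' s t I)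
    (h₁ : IsRoughIntegral L w Q z₁ z₁' s t I₁) :
    IsRoughIntegral L w Q (z - z₁) (z' - z₁') s t (I - I₁) := by
  intro ε hε
  obtain ⟨ρ, hρ, hI⟩ := h (ε / 2) (by linarith)
  obtain ⟨ρ₁, hρ₁, hI₁⟩ := h₁ (ε / 2) (by linarith)
  refine ⟨min ρ ρ₁, lt_min hρ hρ₁, fun n τ hτ h0 hn hmesh => ?_⟩
  have a := hI n τ hτ h0 hn fun j hj => (hmesh j hj).trans_le (min_le_left _ _)
  have a₁ := hI₁ n τ hτ h0 hn fun j hj => (hmesh j hj).trans_le (min_le_right _ _)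
  have e : ∑ j ∈ Finset.range n, Q (τ j)
      (ext01 (z - z₁) (τ j) (w.path (τ (j + 1)) - w.path (τ j))
        + contract (ext01 (z' - z₁') (τ j)) (w.area (τ (j + 1)) (τ j))) - (I - I₁)
      = (∑ j ∈ Finset.range n, Q (τ j) (ext01 z (τ j) (w.path (τ (j + 1)) - w.path (τ j))
        + contract (ext01 z' (τ j)) (w.area (τ (j + 1)) (τ j))) - I)
      - (∑ j ∈ Finset.range n, Q (τ j) (ext01 z₁ (τ j) (w.path (τ (j + 1)) - w.path (τ j))
        + contract (ext01 z₁' (τ j)) (w.area (τ (j + 1)) (τ j))) - I₁) := by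
    rw [sub_sub_sub_comm, ← Finset.sum_sub_distrib]
    congr 1
    refine Finset.sum_congr rfl fun j _ => ?_
    rw [← map_sub]
    congr 1
    simp only [IccExtend, Function.comp, Pi.sub_apply, sub_apply, contract_sub_left]
    abel
  rw [e]
  have := L.nrm_sub_le hθ _ _ |>.trans_lt (add_lt_add a a₁)
  linarith

/-- Fine partitions of the two halves are glued into one partition of the whole interval, whose sum
splits. As all three integrals are given, one partition for each `ε` suffices. -/
theorem concat (hθ : -2 * γ ≤ 0) {m : ℝ} {J : H} (hsm : s ≤ m) (hmt : m ≤ t)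
    (h : IsRoughIntegral L w Q z z' s m I) (h₁ : IsRoughIntegral L w Q z z' m t I₁)
    (hJ : IsRoughIntegral L w Q z z' s t J) : J = I + I₁ := by
  rw [← sub_eq_zero, ← L.nrm_eq_zero hθ]
  refine le_antisymm (le_of_forall_pos_le_add fun ε hε => ?_) (L.nrm_nonneg _ _)
  obtain ⟨ρ, hρ, hI⟩ := h (ε / 3) (by linarith)
  obtain ⟨ρ₁, hρ₁, hI₁⟩ := h₁ (ε / 3) (by linarith)
  obtain ⟨ρ₂, hρ₂, hI₂⟩ := hJ (ε / 3) (by linarith)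
  obtain ⟨n, hn, hmesh⟩ := exists_unif_mesh_lt hsm (lt_min hρ hρ₂)
  obtain ⟨k, hk, hmesh₁⟩ := exists_unif_mesh_lt hmt (lt_min hρ₁ hρ₂)
  set τ : ℕ → ℝ := fun j => if j ≤ n then unif s m n j else unif m t k (j - n) with hτdef
  have τ1 : ∀ j ≤ n, τ j = unif s m n j := fun j hj => if_pos hj
  have τ2 : ∀ j, τ (n + j) = unif m t k j := fun j => by
    rcases Nat.eq_zero_or_pos j with rfl | hj
    · rw [add_zero, τ1 n le_rfl, unif_last _ _ hn, unif_zero]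
    · simp only [hτdef]
      rw [if_neg (by omega), Nat.add_sub_cancel_left]
  have hτ : Monotone τ := monotone_nat_of_le_succ fun j => by
    rcases lt_or_ge j n with hj | hj
    · rw [τ1 j hj.le, τ1 (j + 1) hj]; exact unif_mono hsm n (Nat.le_succ j)
    · obtain ⟨i, rfl⟩ := Nat.exists_eq_add_of_le hj
      rw [add_assoc, τ2, τ2]; exact unif_mono hmt k (Nat.le_succ i)
  have hmeshτ : ∀ j < n + k, τ (j + 1) - τ j < ρ₂ := fun j _ => by
    rcases lt_or_ge j n with hj | hj
    · rw [τ1 j hj.le, τ1 (j + 1) hj]; exact (hmesh j).trans_le (min_le_right _ _)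
    · obtain ⟨i, rfl⟩ := Nat.exists_eq_add_of_le hj
      rw [add_assoc, τ2, τ2]; exact (hmesh₁ i).trans_le (min_le_right _ _)
  have a := hI n _ (unif_mono hsm n) (unif_zero ..) (unif_last _ _ hn)
    fun j _ => (hmesh j).trans_le (min_le_left _ _)
  have a₁ := hI₁ k _ (unif_mono hmt k) (unif_zero ..) (unif_last _ _ hk)
    fun j _ => (hmesh₁ j).trans_le (min_le_left _ _)
  have a₂ := hI₂ (n + k) τ hτ (by rw [τ1 0 (Nat.zero_le _), unif_zero])
    (by rw [τ2, unif_last _ _ hk]) hmeshτ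
  have e1 : ∀ F : ℝ → ℝ → H, ∑ j ∈ Finset.range (n + k), F (τ j) (τ (j + 1))
      = ∑ j ∈ Finset.range n, F (unif s m n j) (unif s m n (j + 1))
        + ∑ j ∈ Finset.range k, F (unif m t k j) (unif m t k (j + 1)) := fun F => by
    rw [Finset.sum_range_add]
    congr 1
    · refine Finset.sum_congr rfl fun j hj => ?_
      have := Finset.mem_range.1 hj
      rw [τ1 j this.le, τ1 (j + 1) this]
    · refine Finset.sum_congr rfl fun j _ => ?_
      rw [add_assoc, τ2, τ2]
  rw [e1 fun x y => Q x (ext01 z x (w.path y - w.path x) + contract (ext01 z' x) (w.area y x))]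
    at a₂
  set X := ∑ j ∈ Finset.range n, Q (unif s m n j) (ext01 z (unif s m n j)
    (w.path (unif s m n (j + 1)) - w.path (unif s m n j))
      + contract (ext01 z' (unif s m n j)) (w.area (unif s m n (j + 1)) (unif s m n j)))
  set Y := ∑ j ∈ Finset.range k, Q (unif m t k j) (ext01 z (unif m t k j)
    (w.path (unif m t k (j + 1)) - w.path (unif m t k j))
      + contract (ext01 z' (unif m t k j)) (w.area (unif m t k (j + 1)) (unif m t k j)))
  have e : J - (I + I₁) = (X - I) + (Y - I₁) - (X + Y - J) := by abel
  rw [e]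
  have b1 := L.nrm_sub_le hθ ((X - I) + (Y - I₁)) (X + Y - J)
  have b2 := L.nrm_add_le hθ (X - I) (Y - I₁)
  linarith

end IsRoughIntegral

/-! ## Existence and bounds of the rough convolution -/

/-- The bounds of a mildly controlled integrand `(z, z')`, uniformly by the constant `b`. -/
structure Ctrl (L : LinearPart 𝕜 H) {γ : ℝ} (w : RoughPath γ d)
    (z : I01 → EuclideanSpace ℝ (Fin d) →L[ℝ] H)
    (z' : I01 → EuclideanSpace ℝ (Fin d) →L[ℝ] EuclideanSpace ℝ (Fin d) →L[ℝ] H) (b : ℝ) :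
    Prop where
  bdd : ∀ t, ‖z t‖ ≤ b
  bdd' : ∀ t, ‖z' t‖ ≤ b
  rem : ∀ s t : I01, s ≤ t → ∀ a, L.nrm (-2 * γ) (z t a - L.S ((t : ℝ) - s) (z s a)
    - L.S ((t : ℝ) - s) (z' s (w.path t - w.path s) a)) ≤ b * ((t : ℝ) - s) ^ (2 * γ) * ‖a‖
  del : ∀ s t : I01, s ≤ t → ∀ a c, L.nrm (-2 * γ) (z' t a c - L.S ((t : ℝ) - s) (z' s a c))
    ≤ b * ((t : ℝ) - s) ^ γ * ‖a‖ * ‖c‖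

/-- The local approximation of the rough convolution `∫ S_{r-u} z_u d𝐰_u`. -/
def germ (L : LinearPart 𝕜 H) {γ : ℝ} (w : RoughPath γ d)
    (z : I01 → EuclideanSpace ℝ (Fin d) →L[ℝ] H)
    (z' : I01 → EuclideanSpace ℝ (Fin d) →L[ℝ] EuclideanSpace ℝ (Fin d) →L[ℝ] H)
    (r u v : ℝ) : H :=
  L.S (r - u) (ext01 z u (w.path v - w.path u) + contract (ext01 z' u) (w.area v u))

namespace Ctrl

variable {L : LinearPart 𝕜 H} {γ : ℝ} {w : RoughPath γ d}
  {z : I01 → EuclideanSpace ℝ (Fin d) →L[ℝ] H}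
  {z' : I01 → EuclideanSpace ℝ (Fin d) →L[ℝ] EuclideanSpace ℝ (Fin d) →L[ℝ] H} {b : ℝ}

theorem nonneg (h : Ctrl L w z z' b) : 0 ≤ b := (norm_nonneg _).trans (h.bdd 0)

/-- The size of the noise and of the integrand in the sewing estimates. -/
def size (w : RoughPath γ d) (b : ℝ) : ℝ := ((d : ℝ) ^ 2 + 1) * b * (w.norm1 + w.norm2)

theorem size_nonneg (w : RoughPath γ d) {b : ℝ} (hb : 0 ≤ b) : 0 ≤ size w b :=
  mul_nonneg (by positivity) (add_nonneg w.norm1_nonneg w.norm2_nonneg)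

theorem size_ge (w : RoughPath γ d) {b : ℝ} (hb : 0 ≤ b) :
    b * w.norm1 + (d : ℝ) ^ 2 * b * w.norm2 ≤ size w b := by
  have h1 := mul_nonneg hb w.norm1_nonneg
  have h2 := mul_nonneg hb w.norm2_nonneg
  have h3 := mul_nonneg (sq_nonneg (d : ℝ)) h1
  rw [size]
  nlinarith

/-- After Chen's relation, `x` is the remainder of `z` applied to the second increment of the path,
plus the mild increment of `z'` applied to the second area. The orders are `2γ + γ` and `γ + 2γ`.
The defect is kept in the form `-S_{r-m} x` so that it can be measured in `H_{-2γ}` without loss, or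
in `H` through smoothing. -/
theorem defect (h : Ctrl L w z z' b) {r u m v : ℝ} (h0 : 0 ≤ u) (hum : u ≤ m)
    (hmv : m ≤ v) (hvr : v ≤ r) (hr : r ≤ 1) (hγ : 0 < γ) :
    ∃ x : H, germ L w z z' r u v - germ L w z z' r u m - germ L w z z' r m v = -L.S (r - m) x ∧
      L.nrm (-2 * γ) x ≤ size w b * (v - u) ^ (3 * γ) := by
  have hθ : -2 * γ ≤ 0 := by linarith
  have hu : u ∈ Icc (0 : ℝ) 1 := ⟨h0, by linarith⟩
  have hm : m ∈ Icc (0 : ℝ) 1 := ⟨by linarith, by linarith⟩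
  have hb := h.nonneg
  have eu : ext01 z u = z ⟨u, hu⟩ := IccExtend_of_mem _ _ hu
  have em : ext01 z m = z ⟨m, hm⟩ := IccExtend_of_mem _ _ hm
  have eu' : ext01 z' u = z' ⟨u, hu⟩ := IccExtend_of_mem _ _ hu
  have em' : ext01 z' m = z' ⟨m, hm⟩ := IccExtend_of_mem _ _ hm
  set a := w.path m - w.path u with ha
  set c := w.path v - w.path m with hc
  refine ⟨(z ⟨m, hm⟩ c - L.S (m - u) (z ⟨u, hu⟩ c) - L.S (m - u) (z' ⟨u, hu⟩ a c))
    + (contract (z' ⟨m, hm⟩) (w.area v m) - L.S (m - u) (contract (z' ⟨u, hu⟩) (w.area v m))),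
    ?_, ?_⟩
  · have eS : ∀ y, L.S (r - u) y = L.S (r - m) (L.S (m - u) y) := fun y => by
      rw [L.S_comm (by linarith) (by linarith)]; congr 2; ring
    simp only [germ, eu, em, eu', em']
    rw [contract_chen (z' ⟨u, hu⟩) w hum hmv, ← ha, ← hc,
      show w.path v - w.path u = a + c by rw [ha, hc]; abel]
    simp only [eS, ← map_sub, ← map_neg]
    congr 1
    simp only [map_add, map_sub]
    abel
  · have b1 := h.rem ⟨u, hu⟩ ⟨m, hm⟩ hum c
    have b2 := nrm_contract_sub_le (z' ⟨m, hm⟩) (z' ⟨u, hu⟩) L hθ (h.del ⟨u, hu⟩ ⟨m, hm⟩ hum)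
      (w.area v m)
    have c1 := w.norm_path_sub_le (by linarith) hmv (by linarith)
    have c2 := w.norm_area_le hγ (by linarith) hmv (by linarith)
    have n1 := w.norm1_nonneg
    have n2 := w.norm2_nonneg
    have hvu : 0 ≤ v - u := by linarith
    have r1 : ∀ p : ℝ, 0 ≤ p → (m - u) ^ p ≤ (v - u) ^ p := fun p hp =>
      Real.rpow_le_rpow (by linarith) (by linarith) hp
    have r2 : ∀ p : ℝ, 0 ≤ p → (v - m) ^ p ≤ (v - u) ^ p := fun p hp =>
      Real.rpow_le_rpow (by linarith) (by linarith) hp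
    have q : ∀ x p : ℝ, 0 ≤ x → x ≤ v - u → 0 ≤ x ^ p := fun x p hx _ => Real.rpow_nonneg hx p
    have q1 := q (m - u) γ (by linarith) (by linarith)
    have q2 := q (m - u) (2 * γ) (by linarith) (by linarith)
    have q3 := q (v - m) γ (by linarith) (by linarith)
    have q4 := q (v - m) (2 * γ) (by linarith) (by linarith)
    have q5 := q (v - u) γ (by linarith) (by linarith)
    have q6 := q (v - u) (2 * γ) (by linarith) (by linarith)
    have e3 : (v - u) ^ (3 * γ) = (v - u) ^ (2 * γ) * (v - u) ^ γ := by
      rw [← Real.rpow_add_of_nonneg hvu (by linarith) hγ.le]; ring_nf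
    refine (L.nrm_add_le hθ _ _).trans ?_
    calc _ ≤ b * (m - u) ^ (2 * γ) * (w.norm1 * (v - m) ^ γ)
          + (d : ℝ) ^ 2 * (b * (m - u) ^ γ) * (w.norm2 * (v - m) ^ (2 * γ)) := by
          refine add_le_add (b1.trans ?_) (b2.trans ?_)
          · exact mul_le_mul_of_nonneg_left c1 (by positivity)
          · exact mul_le_mul_of_nonneg_left c2 (by positivity)
      _ ≤ b * (v - u) ^ (2 * γ) * (w.norm1 * (v - u) ^ γ)
          + (d : ℝ) ^ 2 * (b * (v - u) ^ γ) * (w.norm2 * (v - u) ^ (2 * γ)) := by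
          have := r1 (2 * γ) (by linarith)
          have := r1 γ hγ.le
          have := r2 (2 * γ) (by linarith)
          have := r2 γ hγ.le
          gcongr
      _ = (b * w.norm1 + (d : ℝ) ^ 2 * b * w.norm2) * (v - u) ^ (3 * γ) := by rw [e3]; ring
      _ ≤ _ := by
          refine mul_le_mul_of_nonneg_right (size_ge w hb) (Real.rpow_nonneg hvu _)

theorem almostAdditive (h : Ctrl L w z z' b) {M : ℝ} (hM : L.SemigroupBounds γ M) (hγ : 0 < γ)
    (hθ : -2 * γ ≤ 0) {s t : ℝ} (hs : 0 ≤ s) (ht : t ≤ 1) :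
    AlmostAdditive (fun u v => L.emb (-2 * γ) hθ (germ L w z z' t u v)) (M * size w b) (3 * γ)
      s t := by
  intro u m v hu hum hmv hv
  obtain ⟨x, hx, hxb⟩ := h.defect (hs.trans hu) hum hmv hv ht hγ
  rw [← map_sub, ← map_sub, L.norm_emb, hx, L.nrm_neg hθ]
  refine (hM.nrm_S _ (by linarith) (by linarith) _).trans ?_
  rw [mul_assoc]
  exact mul_le_mul_of_nonneg_left hxb (by linarith [hM.one_le])

/-- The defect measured in `H`: smoothing by `S_{t-m}` produces the singular weight. -/
theorem singular_defect (h : Ctrl L w z z' b) {M : ℝ} (hM : L.SemigroupBounds γ M) (hγ : 0 < γ)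
    {s t : ℝ} (hs : 0 ≤ s) (ht : t ≤ 1) (u m v : ℝ) (hu : s ≤ u) (hum : u ≤ m) (hmv : m < v)
    (hv : v ≤ t) :
    ‖germ L w z z' t u v - germ L w z z' t u m - germ L w z z' t m v‖
      ≤ M * size w b * (t - m) ^ (-2 * γ) * (v - u) ^ (3 * γ) := by
  obtain ⟨x, hx, hxb⟩ := h.defect (hs.trans hu) hum hmv.le hv ht hγ
  rw [hx, norm_neg]
  have hM0 : 0 ≤ M := by linarith [hM.one_le]
  refine (hM.smoothing _ (by linarith) (by linarith) _).trans ?_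
  calc _ ≤ M * (t - m) ^ (-2 * γ) * (size w b * (v - u) ^ (3 * γ)) :=
        mul_le_mul_of_nonneg_left hxb (mul_nonneg hM0 (Real.rpow_nonneg (by linarith) _))
    _ = _ := by ring

/-- Existence of the rough convolution, and its distance to the local approximation. -/
theorem exists_isRoughIntegral (h : Ctrl L w z z' b) {M : ℝ} (hM : L.SemigroupBounds γ M)
    (hγ : 1 / 3 < γ) (hγ' : γ ≤ 1 / 2) {s t : ℝ} (hs : 0 ≤ s) (hst : s ≤ t) (ht : t ≤ 1) :
    ∃ I, IsRoughIntegral L w (fun u => L.S (t - u)) z z' s t I ∧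
      ‖I - germ L w z z' t s t‖ ≤ singConst γ * (M * size w b) * (t - s) ^ γ ∧
      L.nrm (-2 * γ) (I - germ L w z z' t s t)
        ≤ sewConst (3 * γ) * (M * size w b) * (t - s) ^ (3 * γ) := by
  have hγ0 : 0 < γ := by linarith
  have hθ : -2 * γ ≤ 0 := by linarith
  have hM0 : 0 ≤ M := by linarith [hM.one_le]
  have hc : 0 ≤ M * size w b := mul_nonneg hM0 (size_nonneg w h.nonneg)
  have ha : 1 < 3 * γ := by linarith
  have hadd := h.almostAdditive hM hγ0 hθ hs ht
  have hK := sewConst_pos ha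
  have hK' := singConst_pos hγ
  have hsum : ∀ (τ : ℕ → ℝ) (n : ℕ),
      L.emb (-2 * γ) hθ (∑ j ∈ Finset.range n, L.S (t - τ j)
        (ext01 z (τ j) (w.path (τ (j + 1)) - w.path (τ j))
          + contract (ext01 z' (τ j)) (w.area (τ (j + 1)) (τ j))))
      = psum (fun u v => L.emb (-2 * γ) hθ (germ L w z z' t u v)) τ n := fun τ n => by
    rw [map_sum]; rfl
  rcases eq_or_lt_of_le hst with rfl | hlt
  · have hz : germ L w z z' s s s = 0 := by
      have := hadd.self ha le_rfl le_rfl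
      exact L.emb_injective hθ (by rw [this, map_zero])
    refine ⟨0, fun ε hε => ⟨1, one_pos, fun n τ hτ h0 hn _ => ?_⟩, ?_, ?_⟩
    · rw [← L.norm_emb hθ, map_sub, hsum, map_zero]
      have := hadd.psum_sub_le ha hc hτ (n := n) h0.ge hn.le
      rw [hn, h0, hz, map_zero, sub_self, Real.zero_rpow (by linarith), mul_zero] at this
      exact this.trans_lt hε
    · rw [hz, sub_self, norm_zero]
      exact mul_nonneg (by positivity) (Real.rpow_nonneg (by simp) _)
    · rw [hz, sub_self, L.nrm_zero hθ]
      exact mul_nonneg (by positivity) (Real.rpow_nonneg (by simp) _)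
  -- The candidate is the dyadic limit in `H`. That arbitrary fine partitions lead to the same value
  -- is shown afterwards in the weaker norm.
  obtain ⟨I, hI, hIb⟩ := exists_dyadic_limit hγ hγ' hc hlt (h.singular_defect hM hγ0 hs ht)
  have hI' : Tendsto (fun n : ℕ => psum (fun u v => L.emb (-2 * γ) hθ (germ L w z z' t u v))
      (unif s t (2 ^ n)) (2 ^ n)) atTop (𝓝 (L.emb (-2 * γ) hθ I)) := by
    refine (((L.emb (-2 * γ) hθ).continuous.tendsto _).comp hI).congr fun n => ?_
    simp only [Function.comp, psum, map_sum]
  refine ⟨I, ?_, hIb, ?_⟩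
  · intro ε hε
    have hlim : Tendsto (fun ρ : ℝ => sewConst (3 * γ) * (M * size w b) *
        (ρ ^ (3 * γ - 1) * (t - s))) (𝓝[>] 0) (𝓝 0) := by
      have h1 : ContinuousAt (fun ρ : ℝ => ρ ^ (3 * γ - 1)) 0 :=
        Real.continuousAt_rpow_const _ _ (Or.inr (by linarith))
      have h2 := h1.tendsto
      rw [Real.zero_rpow (by linarith)] at h2
      have h3 := ((h2.mono_left (nhdsWithin_le_nhds (s := Ioi 0))).mul_const (t - s)).const_mul
        (sewConst (3 * γ) * (M * size w b))
      simpa using h3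
    obtain ⟨ρ, hρε, hρ⟩ := ((hlim.eventually (gt_mem_nhds hε)).and self_mem_nhdsWithin).exists
    have hρ : 0 < ρ := hρ
    refine ⟨ρ, hρ, fun n τ hτ h0 hn hmesh => ?_⟩
    rw [← L.norm_emb hθ, map_sub, hsum]
    refine lt_of_le_of_lt ?_ hρε
    -- The given partition is compared with the `2^k`-th uniform one in `H_{-2γ}`. As `k → ∞` the
    -- second error term disappears and the uniform sums become `I`.
    have hb : ∀ k : ℕ, ‖psum (fun u v => L.emb (-2 * γ) hθ (germ L w z z' t u v)) τ n
        - psum (fun u v => L.emb (-2 * γ) hθ (germ L w z z' t u v)) (unif s t (2 ^ k)) (2 ^ k)‖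
        ≤ sewConst (3 * γ) * (M * size w b) * (ρ ^ (3 * γ - 1) * (t - s))
          + sewConst (3 * γ) * (M * size w b) *
            (((t - s) / ((2 ^ k : ℕ) : ℝ)) ^ (3 * γ - 1) * (t - s)) := fun k =>
      hadd.psum_sub_psum_le ha hc hτ (unif_mono hst _) h0 hn (unif_zero ..)
        (unif_last _ _ (by positivity)) (fun j hj => (hmesh j hj).le)
        (fun j _ => (unif_mesh ..).le)
    have hmesh0 : Tendsto (fun k : ℕ => (t - s) / ((2 ^ k : ℕ) : ℝ)) atTop (𝓝[>] 0) := by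
      refine tendsto_nhdsWithin_iff.2 ⟨?_, Eventually.of_forall fun k =>
        mem_Ioi.2 (div_pos (by linarith) (by positivity))⟩
      push_cast
      exact tendsto_const_nhds.div_atTop (tendsto_pow_atTop_atTop_of_one_lt one_lt_two)
    have hl := (tendsto_const_nhds (x := psum (fun u v => L.emb (-2 * γ) hθ
      (germ L w z z' t u v)) τ n)).sub hI' |>.norm
    have hr := (hlim.comp hmesh0).const_add
      (sewConst (3 * γ) * (M * size w b) * (ρ ^ (3 * γ - 1) * (t - s)))
    rw [add_zero] at hr
    exact le_of_tendsto_of_tendsto' hl hr hb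
  · rw [← L.norm_emb hθ, map_sub]
    refine le_of_tendsto (hI'.sub_const _).norm (Eventually.of_forall fun n => ?_)
    have := hadd.psum_sub_le ha hc (unif_mono hst (2 ^ n)) (n := 2 ^ n) (unif_zero ..).ge
      (unif_last _ _ (by positivity)).le
    rwa [unif_zero, unif_last _ _ (by positivity)] at this

/-- The constant in the bound of the rough convolution in `H`. -/
theorem norm_germ_le (h : Ctrl L w z z' b) {M : ℝ} (hM : L.SemigroupBounds γ M) (hγ : 0 < γ)
    {s t : ℝ} (hs : 0 ≤ s) (hst : s ≤ t) (ht : t ≤ 1) :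
    ‖germ L w z z' t s t‖ ≤ M * size w b * (t - s) ^ γ := by
  have hsm : s ∈ Icc (0 : ℝ) 1 := ⟨hs, by linarith⟩
  have e : ext01 z s = z ⟨s, hsm⟩ := IccExtend_of_mem _ _ hsm
  have e' : ext01 z' s = z' ⟨s, hsm⟩ := IccExtend_of_mem _ _ hsm
  have hM0 : 0 ≤ M := by linarith [hM.one_le]
  have hb := h.nonneg
  rw [germ, e, e', mul_assoc]
  refine (hM.norm_S _ (by linarith) (by linarith) _).trans (mul_le_mul_of_nonneg_left ?_ hM0)
  have h1 := (z ⟨s, hsm⟩).le_of_opNorm_le (h.bdd _) (w.path t - w.path s)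
  have h2 := norm_contract_le _ (h.bdd' ⟨s, hsm⟩) (w.area t s)
  have c1 := w.norm_path_sub_le hs hst ht
  have c2 := w.norm_area_le hγ hs hst ht
  have c3 : (t - s) ^ (2 * γ) ≤ (t - s) ^ γ := by
    rcases eq_or_lt_of_le hst with rfl | hlt
    · simp [Real.zero_rpow (show 2 * γ ≠ 0 by linarith), Real.zero_rpow hγ.ne']
    · exact Real.rpow_le_rpow_of_exponent_ge (by linarith) (by linarith) (by linarith)
  have n2 := w.norm2_nonneg
  calc _ ≤ b * (w.norm1 * (t - s) ^ γ) + (d : ℝ) ^ 2 * b * (w.norm2 * (t - s) ^ γ) := by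
        refine (norm_add_le _ _).trans (add_le_add (h1.trans ?_) (h2.trans ?_))
        · gcongr
        · gcongr
          exact c2.trans (by gcongr)
    _ = (b * w.norm1 + (d : ℝ) ^ 2 * b * w.norm2) * (t - s) ^ γ := by ring
    _ ≤ _ := mul_le_mul_of_nonneg_right (size_ge w hb) (Real.rpow_nonneg (by linarith) _)

end Ctrl

end RoughIntegral

/-! ## Composition of controlled paths with the diffusion coefficient -/

section Composition

variable {𝕜 H : Type*} [RCLike 𝕜] [NormedAddCommGroup H] [InnerProductSpace 𝕜 H]
  [CompleteSpace H] [NormedSpace ℝ H] [IsScalarTower ℝ 𝕜 H] {d : ℕ}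

/-- Bounds, uniformly by `B`, of a path controlled in the usual sense (with respect to plain
increments) in `H_{-2γ}` and bounded in `H`. -/
structure Plain (L : LinearPart 𝕜 H) {γ : ℝ} (w : RoughPath γ d) (p : Pair H d) (B : ℝ) :
    Prop where
  bdd : ∀ t, ‖p.1 t‖ ≤ B
  nrm_bdd : ∀ t, L.nrm (-2 * γ) (p.1 t) ≤ B
  bdd' : ∀ t, ‖p.2 t‖ ≤ B
  nrm_bdd' : ∀ t a, L.nrm (-2 * γ) (p.2 t a) ≤ B * ‖a‖
  inc : ∀ s t : I01, s ≤ t → L.nrm (-2 * γ) (p.1 t - p.1 s) ≤ B * ((t : ℝ) - s) ^ γ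
  inc' : ∀ s t : I01, s ≤ t → ∀ a,
    L.nrm (-2 * γ) (p.2 t a - p.2 s a) ≤ B * ((t : ℝ) - s) ^ γ * ‖a‖
  rem : ∀ s t : I01, s ≤ t →
    L.nrm (-2 * γ) (p.1 t - p.1 s - p.2 s (w.path t - w.path s)) ≤ B * ((t : ℝ) - s) ^ (2 * γ)

/-- The composition `(g(y), Dg(y) y')`, second component. -/
def compDeriv (g : H → EuclideanSpace ℝ (Fin d) →L[ℝ] H) (p : Pair H d) :
    I01 → EuclideanSpace ℝ (Fin d) →L[ℝ] EuclideanSpace ℝ (Fin d) →L[ℝ] H :=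
  fun t => (fderiv ℝ g (p.1 t)).comp (p.2 t)

/-- A difference of products. -/
theorem norm_apply_sub_apply_le {V W : Type*} [NormedAddCommGroup V] [NormedSpace ℝ V]
    [NormedAddCommGroup W] [NormedSpace ℝ W] {T T₁ : V →L[ℝ] W} {x x₁ : V} {α β ξ ζ : ℝ}
    (h1 : ‖T - T₁‖ ≤ α) (h2 : ‖x‖ ≤ ξ) (h3 : ‖T₁‖ ≤ β) (h4 : ‖x - x₁‖ ≤ ζ) :
    ‖T x - T₁ x₁‖ ≤ α * ξ + β * ζ := by
  have e : T x - T₁ x₁ = (T - T₁) x + T₁ (x - x₁) := by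
    simp only [sub_apply, map_sub]; abel
  rw [e]
  refine (norm_add_le _ _).trans (add_le_add ?_ ?_)
  · exact ((T - T₁).le_of_opNorm_le_of_le h1 h2)
  · exact (T₁.le_of_opNorm_le_of_le h3 h4)

variable {L : LinearPart 𝕜 H} {γ : ℝ} {w : RoughPath γ d} {p q : Pair H d} {B E m M : ℝ}
  {g : H → EuclideanSpace ℝ (Fin d) →L[ℝ] H}

namespace Plain

theorem nonneg (h : Plain L w p B) : 0 ≤ B := (norm_nonneg _).trans (h.bdd 0)

theorem norm_comp_sub_le (hp : Plain L w p B) (hq : Plain L w q B) (hpq : Plain L w (p - q) E)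
    (hg : FlatCubic g m) (t : I01) : ‖g (p.1 t) - g (q.1 t)‖ ≤ m * B ^ 2 * E := by
  have hB := hp.nonneg
  have hm := hg.nonneg
  exact (hg.lipschitz (hp.bdd t) (hq.bdd t)).trans
    (mul_le_mul_of_nonneg_left (hpq.bdd t) (by positivity))

theorem norm_compDeriv_sub_le (hp : Plain L w p B) (hq : Plain L w q B)
    (hpq : Plain L w (p - q) E) (hg : FlatCubic g m) (t : I01) :
    ‖compDeriv g p t - compDeriv g q t‖ ≤ 2 * (m * B ^ 2 * E) := by
  have hB := hp.nonneg
  have hE := hpq.nonneg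
  have hm := hg.nonneg
  refine ContinuousLinearMap.opNorm_le_bound _ (by positivity) fun a => ?_
  have h1 : ‖fderiv ℝ g (p.1 t) - fderiv ℝ g (q.1 t)‖ ≤ m * B * E :=
    (hg.fderiv_lipschitz (hp.bdd t) (hq.bdd t)).trans
      (mul_le_mul_of_nonneg_left (hpq.bdd t) (by positivity))
  have key := norm_apply_sub_apply_le h1 ((p.2 t).le_of_opNorm_le (hp.bdd' t) a)
    (hg.fderiv_le (hq.bdd t)) ((p.2 t - q.2 t).le_of_opNorm_le (hpq.bdd' t) a)
  refine key.trans (le_of_eq ?_)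
  ring

section Extended

variable (hθ : -2 * γ ≤ 0) {G : L.Hs (-2 * γ) → EuclideanSpace ℝ (Fin d) →L[ℝ] L.Hs (-2 * γ)}

/-- The remainder of the composition is the Taylor remainder of `G` plus `DG(y_s)` applied to the
remainder of `y`. Differences in the first part are covered by `FlatCubic.taylor` (constant `1 +
3`), in the second by the product estimate (constant `1 + 1`). -/
theorem norm_rem_comp_sub_le (hp : Plain L w p B) (hq : Plain L w q B)
    (hpq : Plain L w (p - q) E) (hG : FlatCubic G m) (hγ : 0 < γ)
    {s t : I01} (hst : s ≤ t) :
    ‖(G (L.emb _ hθ (p.1 t)) - G (L.emb _ hθ (p.1 s))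
        - fderiv ℝ G (L.emb _ hθ (p.1 s)) (L.emb _ hθ (p.2 s (w.path t - w.path s))))
      - (G (L.emb _ hθ (q.1 t)) - G (L.emb _ hθ (q.1 s))
        - fderiv ℝ G (L.emb _ hθ (q.1 s)) (L.emb _ hθ (q.2 s (w.path t - w.path s))))‖
      ≤ 6 * (m * B ^ 2 * E) * ((t : ℝ) - s) ^ (2 * γ) := by
  have hB := hp.nonneg
  have hE := hpq.nonneg
  have hm := hG.nonneg
  have hts : 0 ≤ (t : ℝ) - s := sub_nonneg.2 (Subtype.coe_le_coe.2 hst)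
  have hts1 : (t : ℝ) - s ≤ 1 := by linarith [t.2.2, s.2.1]
  set ι := L.emb (-2 * γ) hθ with hι
  have hn : ∀ x, ‖ι x‖ = L.nrm (-2 * γ) x := L.norm_emb hθ
  set k := ((t : ℝ) - s) ^ γ with hk
  have hk0 : 0 ≤ k := Real.rpow_nonneg hts _
  have hk1 : k ≤ 1 := Real.rpow_le_one hts hts1 hγ.le
  have hk2 : ((t : ℝ) - s) ^ (2 * γ) = k ^ 2 := by
    rw [hk, ← Real.rpow_natCast, ← Real.rpow_mul hts]; push_cast; ring_nf
  set a := w.path t - w.path s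
  -- Both increments have size at most `B k`, and `k ≤ 1` gives `B k ≤ 2B`.
  have t1 := hG.taylor (B := B) (r := B * k) (y := ι (p.1 s)) (y₁ := ι (p.1 t)) (v := ι (q.1 s))
    (v₁ := ι (q.1 t)) (by rw [hn]; exact hq.nrm_bdd s)
    (by rw [← map_sub, hn]; exact hp.inc s t hst) (by rw [← map_sub, hn]; exact hq.inc s t hst)
    (by nlinarith)
  have i1 : ‖ι (p.1 s) - ι (q.1 s)‖ ≤ E := by rw [← map_sub, hn]; exact hpq.nrm_bdd s
  have i2 : ‖(ι (p.1 t) - ι (p.1 s)) - (ι (q.1 t) - ι (q.1 s))‖ ≤ E * k := by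
    rw [← map_sub, ← map_sub, ← map_sub, hn]
    have := hpq.inc s t hst
    have e : (p.1 t - p.1 s) - (q.1 t - q.1 s) = (p - q).1 t - (p - q).1 s := by
      simp only [Prod.fst_sub, Pi.sub_apply]; abel
    rwa [e]
  have h1 : ‖fderiv ℝ G (ι (p.1 s)) - fderiv ℝ G (ι (q.1 s))‖ ≤ m * B * E :=
    (hG.fderiv_lipschitz (B := B) (by rw [hn]; exact hp.nrm_bdd s)
      (by rw [hn]; exact hq.nrm_bdd s)).trans (mul_le_mul_of_nonneg_left i1 (by positivity))
  have r1 : ‖ι (p.1 t - p.1 s - p.2 s a)‖ ≤ B * k ^ 2 := by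
    rw [hn, ← hk2]; exact hp.rem s t hst
  have r2 : ‖ι (p.1 t - p.1 s - p.2 s a) - ι (q.1 t - q.1 s - q.2 s a)‖ ≤ E * k ^ 2 := by
    rw [← map_sub, hn, ← hk2]
    have := hpq.rem s t hst
    have e : (p.1 t - p.1 s - p.2 s a) - (q.1 t - q.1 s - q.2 s a)
        = (p - q).1 t - (p - q).1 s - (p - q).2 s a := by
      simp only [Prod.fst_sub, Prod.snd_sub, Pi.sub_apply, sub_apply]; abel
    rwa [e]
  have t2 := norm_apply_sub_apply_le h1 r1
    (hG.fderiv_le (B := B) (x := ι (q.1 s)) (by rw [hn]; exact hq.nrm_bdd s)) r2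
  have e : ∀ u : Pair H d, G (ι (u.1 t)) - G (ι (u.1 s)) - fderiv ℝ G (ι (u.1 s)) (ι (u.2 s a))
      = (G (ι (u.1 t)) - G (ι (u.1 s)) - fderiv ℝ G (ι (u.1 s)) (ι (u.1 t) - ι (u.1 s)))
        + fderiv ℝ G (ι (u.1 s)) (ι (u.1 t - u.1 s - u.2 s a)) := fun u => by
    simp only [map_sub]; abel
  rw [e p, e q, add_sub_add_comm, hk2]
  refine (norm_add_le _ _).trans ?_
  calc _ ≤ (m * (B * k) ^ 2 * E + m * (3 * B) * (B * k) * (E * k))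
        + (m * B * E * (B * k ^ 2) + m * B ^ 2 * (E * k ^ 2)) := by
        refine add_le_add (t1.trans ?_) t2
        gcongr
    _ = _ := by ring

/-- Leibniz rule for increments: the increment of `DG(y)` acts on `y'_t`, and `DG(y_s)` acts on the
increment of `y'`. The products contribute `4 + 1` and `1 + 1`. -/
theorem norm_inc_compDeriv_sub_le (hp : Plain L w p B) (hq : Plain L w q B)
    (hpq : Plain L w (p - q) E) (hG : FlatCubic G m)
    {s t : I01} (hst : s ≤ t) (a : EuclideanSpace ℝ (Fin d)) :
    ‖(fderiv ℝ G (L.emb _ hθ (p.1 t)) (L.emb _ hθ (p.2 t a))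
        - fderiv ℝ G (L.emb _ hθ (p.1 s)) (L.emb _ hθ (p.2 s a)))
      - (fderiv ℝ G (L.emb _ hθ (q.1 t)) (L.emb _ hθ (q.2 t a))
        - fderiv ℝ G (L.emb _ hθ (q.1 s)) (L.emb _ hθ (q.2 s a)))‖
      ≤ 7 * (m * B ^ 2 * E) * ((t : ℝ) - s) ^ γ * ‖a‖ := by
  have hB := hp.nonneg
  have hE := hpq.nonneg
  have hm := hG.nonneg
  have hts : 0 ≤ (t : ℝ) - s := sub_nonneg.2 (Subtype.coe_le_coe.2 hst)
  set ι := L.emb (-2 * γ) hθ with hι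
  have hn : ∀ x, ‖ι x‖ = L.nrm (-2 * γ) x := L.norm_emb hθ
  set k := ((t : ℝ) - s) ^ γ with hk
  have hk0 : 0 ≤ k := Real.rpow_nonneg hts _
  have bp : ∀ u, ‖ι (p.1 u)‖ ≤ B := fun u => by rw [hn]; exact hp.nrm_bdd u
  have bq : ∀ u, ‖ι (q.1 u)‖ ≤ B := fun u => by rw [hn]; exact hq.nrm_bdd u
  have i1 : ∀ u, ‖ι (p.1 u) - ι (q.1 u)‖ ≤ E := fun u => by
    rw [← map_sub, hn]; exact hpq.nrm_bdd u
  have i2 : ‖(ι (p.1 t) - ι (p.1 s)) - (ι (q.1 t) - ι (q.1 s))‖ ≤ E * k := by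
    rw [← map_sub, ← map_sub, ← map_sub, hn]
    have := hpq.inc s t hst
    have e : (p.1 t - p.1 s) - (q.1 t - q.1 s) = (p - q).1 t - (p - q).1 s := by
      simp only [Prod.fst_sub, Pi.sub_apply]; abel
    rwa [e]
  have i3 : ‖ι (p.1 t) - ι (p.1 s)‖ ≤ B * k := by rw [← map_sub, hn]; exact hp.inc s t hst
  have i4 : ‖ι (q.1 t) - ι (q.1 s)‖ ≤ B * k := by rw [← map_sub, hn]; exact hq.inc s t hst
  have k1 : ‖(fderiv ℝ G (ι (p.1 t)) - fderiv ℝ G (ι (p.1 s)))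
      - (fderiv ℝ G (ι (q.1 t)) - fderiv ℝ G (ι (q.1 s)))‖ ≤ 4 * (m * B * E * k) := by
    refine (hG.fderiv_increment (bp s) (bp t) (bq s) (bq t)).trans ?_
    calc _ ≤ m * (B * k) * E + m * (3 * B) * (E * k) := by
          have := i1 s
          gcongr
      _ = _ := by ring
  have k2 : ‖fderiv ℝ G (ι (q.1 t)) - fderiv ℝ G (ι (q.1 s))‖ ≤ m * B * (B * k) :=
    (hG.fderiv_lipschitz (bq t) (bq s)).trans (mul_le_mul_of_nonneg_left i4 (by positivity))
  have y1 : ‖ι (p.2 t a)‖ ≤ B * ‖a‖ := by rw [hn]; exact hp.nrm_bdd' t a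
  have y2 : ‖ι (p.2 t a) - ι (q.2 t a)‖ ≤ E * ‖a‖ := by
    rw [← map_sub, hn]; exact hpq.nrm_bdd' t a
  have h1 : ‖fderiv ℝ G (ι (p.1 s)) - fderiv ℝ G (ι (q.1 s))‖ ≤ m * B * E :=
    (hG.fderiv_lipschitz (bp s) (bq s)).trans (mul_le_mul_of_nonneg_left (i1 s) (by positivity))
  have y3 : ‖ι (p.2 t a - p.2 s a)‖ ≤ B * k * ‖a‖ := by rw [hn]; exact hp.inc' s t hst a
  have y4 : ‖ι (p.2 t a - p.2 s a) - ι (q.2 t a - q.2 s a)‖ ≤ E * k * ‖a‖ := by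
    rw [← map_sub, hn]
    have := hpq.inc' s t hst a
    have e : (p.2 t a - p.2 s a) - (q.2 t a - q.2 s a) = (p - q).2 t a - (p - q).2 s a := by
      simp only [Prod.snd_sub, Pi.sub_apply, sub_apply]; abel
    rwa [e]
  have T1 := norm_apply_sub_apply_le k1 y1 k2 y2
  have T2 := norm_apply_sub_apply_le h1 y3 (hG.fderiv_le (bq s)) y4
  have e : ∀ u : Pair H d, fderiv ℝ G (ι (u.1 t)) (ι (u.2 t a))
        - fderiv ℝ G (ι (u.1 s)) (ι (u.2 s a))
      = (fderiv ℝ G (ι (u.1 t)) - fderiv ℝ G (ι (u.1 s))) (ι (u.2 t a))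
        + fderiv ℝ G (ι (u.1 s)) (ι (u.2 t a - u.2 s a)) := fun u => by
    simp only [map_sub, sub_apply]; abel
  rw [e p, e q, add_sub_add_comm]
  refine (norm_add_le _ _).trans ((add_le_add T1 T2).trans ?_)
  have : 0 ≤ m * B ^ 2 * E * k * ‖a‖ := by positivity
  nlinarith

end Extended

/-- The difference of two compositions is a mildly controlled integrand. -/
theorem ctrl_comp_sub (hM : L.SemigroupBounds γ M) (hγ : 0 < γ) (hθ : -2 * γ ≤ 0)
    (hp : Plain L w p B) (hq : Plain L w q B) (hpq : Plain L w (p - q) E) (hg : FlatCubic g m)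
    {G : L.Hs (-2 * γ) → EuclideanSpace ℝ (Fin d) →L[ℝ] L.Hs (-2 * γ)} (hG : FlatCubic G m)
    (hGι : ∀ x, G (L.emb _ hθ x) = (L.emb _ hθ).comp (g x)) :
    Ctrl L w ((fun t => g (p.1 t)) - fun t => g (q.1 t)) (compDeriv g p - compDeriv g q)
      (9 * M * (1 + w.norm1) * (m * B ^ 2 * E)) := by
  have hB := hp.nonneg
  have hE := hpq.nonneg
  have hm := hg.nonneg
  have hM1 := hM.one_le
  have hρ := w.norm1_nonneg
  set X := m * B ^ 2 * E with hX
  have hX0 : 0 ≤ X := by positivity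
  have hMρ : 1 ≤ M * (1 + w.norm1) := by nlinarith
  have hXle : X ≤ M * (1 + w.norm1) * X := le_mul_of_one_le_left hX0 hMρ
  set ι := L.emb (-2 * γ) hθ with hι
  have hn : ∀ x, ‖ι x‖ = L.nrm (-2 * γ) x := L.norm_emb hθ
  have hder : ∀ x h a, fderiv ℝ G (ι x) (ι h) a = ι (fderiv ℝ g x h a) :=
    fderiv_emb hθ hg.differentiable hG.differentiable hGι
  have hz : ∀ t, ‖((fun t => g (p.1 t)) - fun t => g (q.1 t)) t‖ ≤ X :=
    fun t => hp.norm_comp_sub_le hq hpq hg t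
  have hz' : ∀ t, ‖(compDeriv g p - compDeriv g q) t‖ ≤ 2 * X :=
    fun t => hp.norm_compDeriv_sub_le hq hpq hg t
  refine ⟨fun t => (hz t).trans (by linarith), fun t => (hz' t).trans (by linarith), ?_, ?_⟩
  · intro s t hst a
    have hts : 0 ≤ (t : ℝ) - s := sub_nonneg.2 (Subtype.coe_le_coe.2 hst)
    have hts1 : (t : ℝ) - s ≤ 1 := by linarith [t.2.2, s.2.1]
    set k := ((t : ℝ) - s) ^ (2 * γ) with hk
    have hk0 : 0 ≤ k := Real.rpow_nonneg hts _
    set c := w.path t - w.path s with hc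
    have hcn : ‖c‖ ≤ w.norm1 := w.norm_path_sub_le_norm1 hγ.le s.2.1 hst t.2.2
    set z := (fun t => g (p.1 t)) - fun t => g (q.1 t)
    set z' := compDeriv g p - compDeriv g q
    have key := hp.norm_rem_comp_sub_le hθ hq hpq hG hγ hst
    rw [← hι, ← hc, ← hk] at key
    have key' := ContinuousLinearMap.le_of_opNorm_le _ key a
    have e1 : ((G (ι (p.1 t)) - G (ι (p.1 s)) - fderiv ℝ G (ι (p.1 s)) (ι (p.2 s c)))
        - (G (ι (q.1 t)) - G (ι (q.1 s)) - fderiv ℝ G (ι (q.1 s)) (ι (q.2 s c)))) a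
        = ι (z t a - z s a - z' s c a) := by
      simp only [sub_apply, hGι, hder, ContinuousLinearMap.comp_apply, z, z', Pi.sub_apply,
        compDeriv, map_sub]
      abel
    rw [e1, hn] at key'
    have b2 := hM.nrm_S_sub _ hts hts1 (z s a)
    have b3 := hM.nrm_S_sub _ hts hts1 (z' s c a)
    have c2 : ‖z s a‖ ≤ X * ‖a‖ := (z s).le_of_opNorm_le (hz s) a
    have c3 : ‖z' s c a‖ ≤ 2 * X * w.norm1 * ‖a‖ :=
      ContinuousLinearMap.le_of_opNorm_le _ ((z' s).le_of_opNorm_le_of_le (hz' s) hcn) a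
    -- Plain increments become mild ones: `S_{t-s} - 1` maps bounded sets of `H` to size
    -- `(t-s)^{2γ}` in `H_{-2γ}`, precisely the order of a remainder.
    have e : z t a - L.S ((t : ℝ) - s) (z s a) - L.S ((t : ℝ) - s) (z' s c a)
        = (z t a - z s a - z' s c a) - ((L.S ((t : ℝ) - s) (z s a) - z s a)
          + (L.S ((t : ℝ) - s) (z' s c a) - z' s c a)) := by abel
    rw [e]
    calc _ ≤ 6 * X * k * ‖a‖ + (M * k * (X * ‖a‖) + M * k * (2 * X * w.norm1 * ‖a‖)) := by
          refine (L.nrm_sub_le hθ _ _).trans (add_le_add key'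
            ((L.nrm_add_le hθ _ _).trans (add_le_add (b2.trans ?_) (b3.trans ?_))))
          · gcongr
          · gcongr
      _ = (6 + M + 2 * (M * w.norm1)) * (X * k * ‖a‖) := by ring
      _ ≤ (9 * M * (1 + w.norm1)) * (X * k * ‖a‖) := by
          refine mul_le_mul_of_nonneg_right ?_ (by positivity)
          nlinarith
      _ = _ := by ring
  · intro s t hst a c
    have hts : 0 ≤ (t : ℝ) - s := sub_nonneg.2 (Subtype.coe_le_coe.2 hst)
    have hts1 : (t : ℝ) - s ≤ 1 := by linarith [t.2.2, s.2.1]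
    set z' := compDeriv g p - compDeriv g q
    have key := hp.norm_inc_compDeriv_sub_le hθ hq hpq hG hst a
    have key' := ContinuousLinearMap.le_of_opNorm_le _ key c
    rw [← hι] at key'
    have e1 : ((fderiv ℝ G (ι (p.1 t)) (ι (p.2 t a)) - fderiv ℝ G (ι (p.1 s)) (ι (p.2 s a)))
        - (fderiv ℝ G (ι (q.1 t)) (ι (q.2 t a)) - fderiv ℝ G (ι (q.1 s)) (ι (q.2 s a)))) c
        = ι (z' t a c - z' s a c) := by
      simp only [sub_apply, hder, z', Pi.sub_apply, compDeriv, ContinuousLinearMap.comp_apply,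
        map_sub]
      abel
    rw [e1, hn] at key'
    have b2 := hM.nrm_S_sub _ hts hts1 (z' s a c)
    have c2 : ‖z' s a c‖ ≤ 2 * X * ‖a‖ * ‖c‖ :=
      ContinuousLinearMap.le_of_opNorm_le _ ((z' s).le_of_opNorm_le (hz' s) a) c
    have hk : ((t : ℝ) - s) ^ (2 * γ) ≤ ((t : ℝ) - s) ^ γ := by
      rcases eq_or_lt_of_le hts with h0 | h0
      · rw [← h0, Real.zero_rpow (by linarith), Real.zero_rpow hγ.ne']
      · exact Real.rpow_le_rpow_of_exponent_ge h0 hts1 (by linarith)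
    set k := ((t : ℝ) - s) ^ γ
    have hk0 : 0 ≤ k := Real.rpow_nonneg hts _
    have e : z' t a c - L.S ((t : ℝ) - s) (z' s a c)
        = (z' t a c - z' s a c) - (L.S ((t : ℝ) - s) (z' s a c) - z' s a c) := by abel
    rw [e]
    calc _ ≤ 7 * X * k * ‖a‖ * ‖c‖ + M * k * (2 * X * ‖a‖ * ‖c‖) := by
          refine (L.nrm_sub_le hθ _ _).trans (add_le_add key' (b2.trans ?_))
          gcongr
      _ = (7 + 2 * M) * (X * k * ‖a‖ * ‖c‖) := by ring
      _ ≤ (9 * M * (1 + w.norm1)) * (X * k * ‖a‖ * ‖c‖) := by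
          refine mul_le_mul_of_nonneg_right ?_ (by positivity)
          nlinarith
      _ = _ := by ring

end Plain

end Composition

/-! ## Suprema of families of linear maps -/

section Families

variable {Z X W : Type*} [AddCommGroup X] [Module ℝ X] [NormedAddCommGroup W] [NormedSpace ℝ W]

/-- The supremum over a family of linear maps is finite at `p`. -/
def FamBdd (ℓ : Z → X →ₗ[ℝ] W) (p : X) : Prop := BddAbove (range fun z => ‖ℓ z p‖)

/-- The supremum of the norms of a family of linear maps. -/
def famSup (ℓ : Z → X →ₗ[ℝ] W) (p : X) : ℝ := ⨆ z, ‖ℓ z p‖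

variable {ℓ : Z → X →ₗ[ℝ] W} {p q : X}

theorem famSup_nonneg : 0 ≤ famSup ℓ p := Real.iSup_nonneg fun _ => norm_nonneg _

theorem FamBdd.le (h : FamBdd ℓ p) (z : Z) : ‖ℓ z p‖ ≤ famSup ℓ p := le_ciSup h z

theorem FamBdd.of_le {B : ℝ} (h : ∀ z, ‖ℓ z p‖ ≤ B) : FamBdd ℓ p :=
  ⟨B, by rintro _ ⟨z, rfl⟩; exact h z⟩

theorem FamBdd.add (hp : FamBdd ℓ p) (hq : FamBdd ℓ q) : FamBdd ℓ (p + q) :=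
  .of_le fun z => by
    rw [map_add]; exact (norm_add_le _ _).trans (add_le_add (hp.le z) (hq.le z))

theorem famSup_add_le (hp : FamBdd ℓ p) (hq : FamBdd ℓ q) :
    famSup ℓ (p + q) ≤ famSup ℓ p + famSup ℓ q :=
  Real.iSup_le (fun z => by
    rw [map_add]; exact (norm_add_le _ _).trans (add_le_add (hp.le z) (hq.le z)))
    (add_nonneg famSup_nonneg famSup_nonneg)

theorem FamBdd.smul (hp : FamBdd ℓ p) (c : ℝ) : FamBdd ℓ (c • p) :=
  .of_le (B := |c| * famSup ℓ p) fun z => by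
    rw [map_smul, norm_smul, Real.norm_eq_abs]
    exact mul_le_mul_of_nonneg_left (hp.le z) (abs_nonneg c)

theorem famSup_smul (c : ℝ) : famSup ℓ (c • p) = |c| * famSup ℓ p := by
  rw [famSup, famSup, Real.mul_iSup_of_nonneg (abs_nonneg c)]
  simp only [map_smul, norm_smul, Real.norm_eq_abs]

end Families

/-! ## The norm of the space of mildly controlled rough paths -/

section ControlledNorm

variable {𝕜 H : Type*} [RCLike 𝕜] [NormedAddCommGroup H] [InnerProductSpace 𝕜 H]
  [CompleteSpace H] [NormedSpace ℝ H] [IsScalarTower ℝ 𝕜 H] {d : ℕ}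

theorem nrmOp_eq (L : LinearPart 𝕜 H) {θ : ℝ} (hθ : θ ≤ 0)
    (T : EuclideanSpace ℝ (Fin d) →L[ℝ] H) :
    L.nrmOp θ (fun a => T a) = ‖(L.emb θ hθ).comp T‖ := by
  rw [← ContinuousLinearMap.sSup_unitClosedBall_eq_norm, LinearPart.nrmOp, sSup_image']
  simp only [ContinuousLinearMap.comp_apply, L.norm_emb hθ]

variable (L : LinearPart 𝕜 H) {γ : ℝ} (w : RoughPath γ d)

/-- `S_r` as a real operator. -/
def SR (r : ℝ) : H →L[ℝ] H := (L.S r).restrictScalars ℝ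

theorem SR_apply (r : ℝ) (x : H) : SR L r x = L.S r x := rfl

/-- Evaluation of the path. -/
def evalH (t : I01) : Pair H d →ₗ[ℝ] H := (LinearMap.proj t).comp (LinearMap.fst ℝ _ _)

/-- Evaluation of the derivative. -/
def evalOp (t : I01) : Pair H d →ₗ[ℝ] EuclideanSpace ℝ (Fin d) →L[ℝ] H :=
  (LinearMap.proj t).comp (LinearMap.snd ℝ _ _)

/-- The weighted increments `(δ̂y)_{t,s} / (t-s)^η`. -/
def famEta (η : ℝ) (z : Simplex) : Pair H d →ₗ[ℝ] H :=
  (((z.1.1 : ℝ) - (z.1.2 : ℝ)) ^ η)⁻¹ •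
    (evalH z.1.1 - (SR L ((z.1.1 : ℝ) - z.1.2)).toLinearMap.comp (evalH z.1.2))

/-- `y'` in `H_{-2γ}`. -/
def embOp (hθ : -2 * γ ≤ 0) (t : I01) :
    Pair H d →ₗ[ℝ] EuclideanSpace ℝ (Fin d) →L[ℝ] L.Hs (-2 * γ) :=
  (ContinuousLinearMap.compL ℝ (EuclideanSpace ℝ (Fin d)) H (L.Hs (-2 * γ))
    (L.emb _ hθ)).toLinearMap.comp (evalOp t)

/-- The weighted increments `(δ̂y')_{t,s} / (t-s)^γ`. -/
def famDeriv (hθ : -2 * γ ≤ 0) (z : Simplex) :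
    Pair H d →ₗ[ℝ] EuclideanSpace ℝ (Fin d) →L[ℝ] L.Hs (-2 * γ) :=
  (((z.1.1 : ℝ) - (z.1.2 : ℝ)) ^ γ)⁻¹ •
    (ContinuousLinearMap.compL ℝ (EuclideanSpace ℝ (Fin d)) H (L.Hs (-2 * γ))
      (L.emb _ hθ)).toLinearMap.comp
    (evalOp z.1.1 - (ContinuousLinearMap.compL ℝ (EuclideanSpace ℝ (Fin d)) H H
      (SR L ((z.1.1 : ℝ) - z.1.2))).toLinearMap.comp (evalOp z.1.2))

/-- The weighted remainders `R^y_{t,s} / (t-s)^{2γ}`. -/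
def famRem (hθ : -2 * γ ≤ 0) (z : Simplex) : Pair H d →ₗ[ℝ] L.Hs (-2 * γ) :=
  (((z.1.1 : ℝ) - (z.1.2 : ℝ)) ^ (2 * γ))⁻¹ • (L.emb _ hθ).toLinearMap.comp
    (evalH z.1.1 - (SR L ((z.1.1 : ℝ) - z.1.2)).toLinearMap.comp (evalH z.1.2)
      - (SR L ((z.1.1 : ℝ) - z.1.2)).toLinearMap.comp
        ((ContinuousLinearMap.apply ℝ H (w.path z.1.1 - w.path z.1.2)).toLinearMap.comp
          (evalOp z.1.2)))

theorem simplex_weight_nonneg (z : Simplex) (r : ℝ) :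
    0 ≤ (((z.1.1 : ℝ) - (z.1.2 : ℝ)) ^ r)⁻¹ :=
  inv_nonneg.2 (Real.rpow_nonneg (sub_nonneg.2 (Subtype.coe_le_coe.2 z.2)) _)

theorem norm_famEta (η : ℝ) (z : Simplex) (p : Pair H d) : ‖famEta L η z p‖
    = ‖hatDelta L p.1 z.1.1 z.1.2‖ / ((z.1.1 : ℝ) - (z.1.2 : ℝ)) ^ η := by
  rw [famEta, LinearMap.smul_apply, norm_smul, Real.norm_of_nonneg (simplex_weight_nonneg z η),
    mul_comm, ← div_eq_mul_inv]
  rfl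

theorem norm_famDeriv (hθ : -2 * γ ≤ 0) (z : Simplex) (p : Pair H d) : ‖famDeriv L hθ z p‖
    = L.nrmOp (-2 * γ) (hatDeltaOp L p.2 z.1.1 z.1.2) / ((z.1.1 : ℝ) - (z.1.2 : ℝ)) ^ γ := by
  rw [famDeriv, LinearMap.smul_apply, norm_smul, Real.norm_of_nonneg (simplex_weight_nonneg z γ),
    mul_comm, ← div_eq_mul_inv]
  congr 1
  exact (nrmOp_eq L hθ (p.2 z.1.1 - (SR L ((z.1.1 : ℝ) - z.1.2)).comp (p.2 z.1.2))).symm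

theorem norm_famRem (hθ : -2 * γ ≤ 0) (z : Simplex) (p : Pair H d) : ‖famRem L w hθ z p‖
    = L.nrm (-2 * γ) (remainder L w p z.1.1 z.1.2) / ((z.1.1 : ℝ) - (z.1.2 : ℝ)) ^ (2 * γ) := by
  rw [famRem, LinearMap.smul_apply, norm_smul,
    Real.norm_of_nonneg (simplex_weight_nonneg z (2 * γ)), mul_comm, ← div_eq_mul_inv,
    ← L.norm_emb hθ]
  rfl

/-- Every term of the norm is the norm of a linear map of the pair or a supremum of such norms.
Homogeneity and the triangle inequality thereby reduce to those of `famSup`. -/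
theorem normD_eq (hθ : -2 * γ ≤ 0) (η : ℝ) (p : Pair H d) :
    normD L η w p = ‖evalH 0 p‖ + ‖embOp L hθ 0 p‖ + famSup (famEta L η) p
      + famSup (evalOp : I01 → Pair H d →ₗ[ℝ] _) p
      + (famSup (famDeriv L hθ) p + famSup (famRem L w hθ) p) := by
  simp only [famSup, norm_famEta, norm_famDeriv, norm_famRem]
  rw [normD, nrmOp_eq L hθ]
  rfl

/-- The finiteness conditions in the definition of the space of controlled paths. -/
structure FinD (hθ : -2 * γ ≤ 0) (η : ℝ) (p : Pair H d) : Prop where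
  eta : FamBdd (famEta L η) p
  op : FamBdd (evalOp : I01 → Pair H d →ₗ[ℝ] _) p
  deriv : FamBdd (famDeriv L hθ) p
  rem : FamBdd (famRem L w hθ) p

variable {L w} {hθ : -2 * γ ≤ 0} {η : ℝ} {p q : Pair H d}

theorem MemD.finD (hθ : -2 * γ ≤ 0) (h : MemD L η w p) : FinD L w hθ η p := by
  refine ⟨?_, h.bdd', ?_, ?_⟩
  · simpa only [FamBdd, HolderFinite, norm_famEta] using h.holder_eta
  · simpa only [FamBdd, HolderFinite, norm_famDeriv] using h.holder'
  · simpa only [FamBdd, HolderFinite, norm_famRem] using h.rem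

theorem normD_nonneg (hθ : -2 * γ ≤ 0) (p : Pair H d) : 0 ≤ normD L η w p := by
  rw [normD_eq L w hθ]
  have := famSup_nonneg (ℓ := famEta L η) (p := p)
  have := famSup_nonneg (ℓ := (evalOp : I01 → Pair H d →ₗ[ℝ] _)) (p := p)
  have := famSup_nonneg (ℓ := famDeriv L hθ) (p := p)
  have := famSup_nonneg (ℓ := famRem L w hθ) (p := p)
  positivity

theorem normD_smul (hθ : -2 * γ ≤ 0) (c : ℝ) (p : Pair H d) :
    normD L η w (c • p) = |c| * normD L η w p := by
  simp only [normD_eq L w hθ, famSup_smul, map_smul, norm_smul, Real.norm_eq_abs]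
  ring

theorem FinD.add (hp : FinD L w hθ η p) (hq : FinD L w hθ η q) : FinD L w hθ η (p + q) :=
  ⟨hp.eta.add hq.eta, hp.op.add hq.op, hp.deriv.add hq.deriv, hp.rem.add hq.rem⟩

theorem FinD.smul (hp : FinD L w hθ η p) (c : ℝ) : FinD L w hθ η (c • p) :=
  ⟨hp.eta.smul c, hp.op.smul c, hp.deriv.smul c, hp.rem.smul c⟩

theorem FinD.normD_add_le (hp : FinD L w hθ η p) (hq : FinD L w hθ η q) :
    normD L η w (p + q) ≤ normD L η w p + normD L η w q := by
  simp only [normD_eq L w hθ, map_add]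
  have := famSup_add_le hp.eta hq.eta
  have := famSup_add_le hp.op hq.op
  have := famSup_add_le hp.deriv hq.deriv
  have := famSup_add_le hp.rem hq.rem
  have := norm_add_le (evalH 0 p) (evalH 0 q)
  have := norm_add_le (embOp L hθ 0 p) (embOp L hθ 0 q)
  linarith

/-! ### Pointwise bounds -/

/-- All components of the norm of a controlled path are bounded by `N`. -/
structure Pointwise (L : LinearPart 𝕜 H) (w : RoughPath γ d) (η : ℝ) (p : Pair H d) (N : ℝ) :
    Prop where
  init : ‖p.1 0‖ ≤ N
  init' : ∀ a, L.nrm (-2 * γ) (p.2 0 a) ≤ N * ‖a‖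
  eta : ∀ s t : I01, s ≤ t → ‖p.1 t - L.S ((t : ℝ) - s) (p.1 s)‖ ≤ N * ((t : ℝ) - s) ^ η
  op : ∀ t, ‖p.2 t‖ ≤ N
  deriv : ∀ s t : I01, s ≤ t → ∀ a,
    L.nrm (-2 * γ) (p.2 t a - L.S ((t : ℝ) - s) (p.2 s a)) ≤ N * ((t : ℝ) - s) ^ γ * ‖a‖
  rem : ∀ s t : I01, s ≤ t → L.nrm (-2 * γ) (p.1 t - L.S ((t : ℝ) - s) (p.1 s)
    - L.S ((t : ℝ) - s) (p.2 s (w.path t - w.path s))) ≤ N * ((t : ℝ) - s) ^ (2 * γ)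

theorem Pointwise.mono {N N' : ℝ} (h : Pointwise L w η p N) (hN : N ≤ N') :
    Pointwise L w η p N' := by
  have r : ∀ (s t : I01) (x : ℝ), s ≤ t → 0 ≤ ((t : ℝ) - s) ^ x := fun s t x hst =>
    Real.rpow_nonneg (sub_nonneg.2 (Subtype.coe_le_coe.2 hst)) _
  refine ⟨h.init.trans hN, fun a => (h.init' a).trans (by gcongr), fun s t hst =>
    (h.eta s t hst).trans ?_, fun t => (h.op t).trans hN, fun s t hst a =>
    (h.deriv s t hst a).trans ?_, fun s t hst => (h.rem s t hst).trans ?_⟩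
  · have := r s t η hst; gcongr
  · have := r s t γ hst; gcongr
  · have := r s t (2 * γ) hst; gcongr

/-- On the diagonal a quotient by `0^r` need not control its numerator, so vanishing there has to be
supplied. -/
theorem le_of_div_rpow_le {s t : I01} (hst : s ≤ t) {x N r : ℝ} (hx0 : s = t → x = 0)
    (hN : 0 ≤ N) (h : x / ((t : ℝ) - s) ^ r ≤ N) : x ≤ N * ((t : ℝ) - s) ^ r := by
  rcases eq_or_lt_of_le hst with heq | hlt
  · rw [hx0 heq]
    exact mul_nonneg hN (Real.rpow_nonneg (by simp [heq]) _)
  · rwa [div_le_iff₀ (Real.rpow_pos_of_pos (sub_pos.2 hlt) _)] at h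

theorem Pointwise.of_families {N : ℝ} (hθ : -2 * γ ≤ 0) (h0 : ‖evalH 0 p‖ ≤ N)
    (h0' : ‖embOp L hθ 0 p‖ ≤ N) (h1 : ∀ z, ‖famEta L η z p‖ ≤ N)
    (h2 : ∀ t, ‖evalOp t p‖ ≤ N) (h3 : ∀ z, ‖famDeriv L hθ z p‖ ≤ N)
    (h4 : ∀ z, ‖famRem L w hθ z p‖ ≤ N) : Pointwise L w η p N := by
  have hN : 0 ≤ N := (norm_nonneg _).trans h0
  have hS0 : ∀ x, L.S 0 x = x := fun x => by rw [L.S_zero]; rfl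
  refine ⟨h0, fun a => ?_, fun s t hst => ?_, h2, fun s t hst a => ?_, fun s t hst => ?_⟩
  · rw [← L.norm_emb hθ]
    exact (embOp L hθ 0 p).le_of_opNorm_le h0' a
  · have := h1 ⟨(t, s), hst⟩
    rw [norm_famEta] at this
    exact le_of_div_rpow_le hst (fun h => by simp [h, hS0]) hN this
  · have := h3 ⟨(t, s), hst⟩
    rw [norm_famDeriv] at this
    have e : L.nrmOp (-2 * γ) (hatDeltaOp L p.2 t s) = _ :=
      nrmOp_eq L hθ (p.2 t - (SR L ((t : ℝ) - s)).comp (p.2 s))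
    have h5 := le_of_div_rpow_le hst (fun h => by
      rw [e, norm_eq_zero]; ext1 c; simp [h, SR_apply, hS0]) hN this
    rw [e] at h5
    have h6 := ContinuousLinearMap.le_of_opNorm_le _ h5 a
    rw [ContinuousLinearMap.comp_apply, L.norm_emb hθ] at h6
    exact h6
  · have := h4 ⟨(t, s), hst⟩
    rw [norm_famRem] at this
    exact le_of_div_rpow_le hst (fun h => by
      rw [L.nrm_eq_zero hθ]; simp [h, hS0]) hN this

theorem FinD.pointwise (h : FinD L w hθ η p) : Pointwise L w η p (normD L η w p) := by
  have a1 := famSup_nonneg (ℓ := famEta L η) (p := p)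
  have a2 := famSup_nonneg (ℓ := (evalOp : I01 → Pair H d →ₗ[ℝ] _)) (p := p)
  have a3 := famSup_nonneg (ℓ := famDeriv L hθ) (p := p)
  have a4 := famSup_nonneg (ℓ := famRem L w hθ) (p := p)
  have a5 := norm_nonneg (evalH 0 p)
  have a6 := norm_nonneg (embOp L hθ 0 p)
  rw [normD_eq L w hθ]
  refine .of_families hθ (by linarith) (by linarith) (fun z => ?_) (fun z => ?_) (fun z => ?_)
    (fun z => ?_)
  · linarith [h.eta.le z]
  · linarith [h.op.le z]
  · linarith [h.deriv.le z]
  · linarith [h.rem.le z]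

namespace Pointwise

variable {N : ℝ}

theorem nonneg (h : Pointwise L w η p N) : 0 ≤ N := (norm_nonneg _).trans h.init

theorem norm_famEta_le (h : Pointwise L w η p N) (z : Simplex) : ‖famEta L η z p‖ ≤ N := by
  rw [norm_famEta]
  exact div_rpow_le_of_le (q := fun t s => ‖hatDelta L p.1 t s‖) h.nonneg h.eta z

theorem norm_famDeriv_le (hθ : -2 * γ ≤ 0) (h : Pointwise L w η p N) (z : Simplex) :
    ‖famDeriv L hθ z p‖ ≤ N := by
  rw [norm_famDeriv]
  refine div_rpow_le_of_le (q := fun t s => L.nrmOp (-2 * γ) (hatDeltaOp L p.2 t s)) h.nonneg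
    (fun s t hst => ?_) z
  have e : L.nrmOp (-2 * γ) (hatDeltaOp L p.2 t s) = _ :=
      nrmOp_eq L hθ (p.2 t - (SR L ((t : ℝ) - s)).comp (p.2 s))
  rw [e]
  refine ContinuousLinearMap.opNorm_le_bound _ (mul_nonneg h.nonneg
    (Real.rpow_nonneg (sub_nonneg.2 (Subtype.coe_le_coe.2 hst)) _)) fun a => ?_
  rw [ContinuousLinearMap.comp_apply, L.norm_emb hθ]
  exact h.deriv s t hst a

theorem norm_famRem_le (hθ : -2 * γ ≤ 0) (h : Pointwise L w η p N) (z : Simplex) :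
    ‖famRem L w hθ z p‖ ≤ N := by
  rw [norm_famRem]
  exact div_rpow_le_of_le (q := fun t s => L.nrm (-2 * γ) (remainder L w p t s)) h.nonneg h.rem z

theorem finD (hθ : -2 * γ ≤ 0) (h : Pointwise L w η p N) : FinD L w hθ η p :=
  ⟨.of_le h.norm_famEta_le, .of_le h.op, .of_le (h.norm_famDeriv_le hθ),
    .of_le (h.norm_famRem_le hθ)⟩

/-- The factor `6` counts the summands of the norm. It is harmless wherever pointwise bounds are
converted back, and enters the Lipschitz constants explicitly. -/
theorem normD_le (hθ : -2 * γ ≤ 0) (h : Pointwise L w η p N) : normD L η w p ≤ 6 * N := by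
  rw [normD_eq L w hθ]
  have h1 : famSup (famEta L η) p ≤ N := Real.iSup_le h.norm_famEta_le h.nonneg
  have h2 : famSup (evalOp : I01 → Pair H d →ₗ[ℝ] _) p ≤ N := Real.iSup_le h.op h.nonneg
  have h3 : famSup (famDeriv L hθ) p ≤ N := Real.iSup_le (h.norm_famDeriv_le hθ) h.nonneg
  have h4 : famSup (famRem L w hθ) p ≤ N := Real.iSup_le (h.norm_famRem_le hθ) h.nonneg
  have h5 : ‖evalH 0 p‖ ≤ N := h.init
  have h6 : ‖embOp L hθ 0 p‖ ≤ N :=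
    ContinuousLinearMap.opNorm_le_bound _ h.nonneg fun a => by
      have := h.init' a
      rw [← L.norm_emb hθ] at this
      exact this
  linarith

/-- Pointwise bounds pass to pointwise limits. -/
theorem of_tendsto (hθ : -2 * γ ≤ 0) {P : ℕ → Pair H d}
    (h1 : ∀ t, Tendsto (fun n => (P n).1 t) atTop (𝓝 (p.1 t)))
    (h2 : ∀ t, Tendsto (fun n => (P n).2 t) atTop (𝓝 (p.2 t)))
    (h : ∀ᶠ n in atTop, Pointwise L w η (P n) N) : Pointwise L w η p N := by
  have h2a : ∀ t a, Tendsto (fun n => (P n).2 t a) atTop (𝓝 (p.2 t a)) := fun t a =>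
    ((ContinuousLinearMap.apply ℝ H a).continuous.tendsto _).comp (h2 t)
  have hnrm : ∀ {x : ℕ → H} {x₀ : H}, Tendsto x atTop (𝓝 x₀) →
      Tendsto (fun n => L.nrm (-2 * γ) (x n)) atTop (𝓝 (L.nrm (-2 * γ) x₀)) := fun hx => by
    simp only [← L.norm_emb hθ]
    exact (((L.emb _ hθ).continuous.tendsto _).comp hx).norm
  have hS : ∀ {x : ℕ → H} {x₀ : H} (r : ℝ), Tendsto x atTop (𝓝 x₀) →
      Tendsto (fun n => L.S r (x n)) atTop (𝓝 (L.S r x₀)) := fun r hx =>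
    ((L.S r).continuous.tendsto _).comp hx
  refine ⟨?_, fun a => ?_, fun s t hst => ?_, fun t => ?_, fun s t hst a => ?_, fun s t hst => ?_⟩
  · exact le_of_tendsto (h1 0).norm (h.mono fun n hn => hn.init)
  · exact le_of_tendsto (hnrm (h2a 0 a)) (h.mono fun n hn => hn.init' a)
  · exact le_of_tendsto ((h1 t).sub (hS _ (h1 s))).norm (h.mono fun n hn => hn.eta s t hst)
  · exact le_of_tendsto (h2 t).norm (h.mono fun n hn => hn.op t)
  · exact le_of_tendsto (hnrm ((h2a t a).sub (hS _ (h2a s a))))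
      (h.mono fun n hn => hn.deriv s t hst a)
  · exact le_of_tendsto (hnrm (((h1 t).sub (hS _ (h1 s))).sub (hS _ (h2a s _))))
      (h.mono fun n hn => hn.rem s t hst)

variable {M : ℝ}

/-- `y_t` is `S_t y_0` plus its mild increment from time `0`. -/
theorem norm_le (hM : L.SemigroupBounds γ M) (hη : 0 ≤ η) (h : Pointwise L w η p N) (t : I01) :
    ‖p.1 t‖ ≤ 2 * M * N := by
  have h1 := h.eta 0 t t.2.1
  have h2 := hM.norm_S t t.2.1 t.2.2 (p.1 0)
  have hN := h.nonneg
  have hM1 := hM.one_le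
  have h3 : ((t : ℝ) - ((0 : I01) : ℝ)) ^ η ≤ 1 :=
    Real.rpow_le_one (by simpa using t.2.1) (by simpa using t.2.2) hη
  have e : ((0 : I01) : ℝ) = 0 := rfl
  rw [e, sub_zero] at h1 h3
  have h4 := norm_sub_norm_le (p.1 t) (L.S t (p.1 0))
  have h5 : N * (t : ℝ) ^ η ≤ N := mul_le_of_le_one_right hN h3
  have h6 : M * ‖p.1 0‖ ≤ M * N := mul_le_mul_of_nonneg_left h.init (by linarith)
  nlinarith

/-- The passage from mild to ordinary increments, for which Taylor's formula is available. The error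
`(S_{t-s} - 1)` applied to `y_s` or `y'_s` is of order `(t-s)^{2γ}` in `H_{-2γ}`, since `y` and `y'`
are bounded in `H`. -/
theorem plain (hM : L.SemigroupBounds γ M) (hγ : 0 < γ) (hη : 0 ≤ η)
    (h : Pointwise L w η p N) : Plain L w p (4 * M ^ 2 * (1 + w.norm1) * N) := by
  have hθ : -2 * γ ≤ 0 := by linarith
  have hN := h.nonneg
  have hM1 := hM.one_le
  have hρ := w.norm1_nonneg
  have hMM : M ≤ M ^ 2 := by nlinarith
  have c0 : 4 * M ^ 2 * N ≤ 4 * M ^ 2 * (1 + w.norm1) * N := by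
    have : 0 ≤ 4 * M ^ 2 * N * w.norm1 := by positivity
    nlinarith
  have c1 : 4 * M * N ≤ 4 * M ^ 2 * N := by gcongr
  have c2 : N ≤ M * N := le_mul_of_one_le_left hN hM1
  have hMN : 0 ≤ M * N := by positivity
  have hy := h.norm_le hM hη
  have hrem : ∀ s t : I01, s ≤ t →
      L.nrm (-2 * γ) (p.1 t - p.1 s - p.2 s (w.path t - w.path s))
      ≤ 3 * M ^ 2 * (1 + w.norm1) * N * ((t : ℝ) - s) ^ (2 * γ) := fun s t hst => by
    have hts : 0 ≤ (t : ℝ) - s := sub_nonneg.2 (Subtype.coe_le_coe.2 hst)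
    have hts1 : (t : ℝ) - s ≤ 1 := by linarith [t.2.2, s.2.1]
    set a := w.path t - w.path s with ha
    have han : ‖a‖ ≤ w.norm1 := w.norm_path_sub_le_norm1 hγ.le s.2.1 hst t.2.2
    have b1 := h.rem s t hst
    have b2 := hM.nrm_S_sub _ hts hts1 (p.1 s)
    have b3 := hM.nrm_S_sub _ hts hts1 (p.2 s a)
    have b4 := (p.2 s).le_of_opNorm_le_of_le (h.op s) han
    set k := ((t : ℝ) - s) ^ (2 * γ)
    have hk0 : 0 ≤ k := Real.rpow_nonneg hts _
    have e : p.1 t - p.1 s - p.2 s a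
        = (p.1 t - L.S ((t : ℝ) - s) (p.1 s) - L.S ((t : ℝ) - s) (p.2 s a))
          + (L.S ((t : ℝ) - s) (p.1 s) - p.1 s)
          + (L.S ((t : ℝ) - s) (p.2 s a) - p.2 s a) := by abel
    rw [e]
    calc _ ≤ N * k + M * k * (2 * M * N) + M * k * (N * w.norm1) := by
          refine (L.nrm_add_le hθ _ _).trans (add_le_add ((L.nrm_add_le hθ _ _).trans
            (add_le_add b1 (b2.trans ?_))) (b3.trans ?_))
          · have := hy s; gcongr
          · gcongr
      _ = (1 + 2 * M ^ 2 + M * w.norm1) * (N * k) := by ring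
      _ ≤ (3 * M ^ 2 * (1 + w.norm1)) * (N * k) := by
          refine mul_le_mul_of_nonneg_right ?_ (by positivity)
          nlinarith
      _ = _ := by ring
  refine ⟨fun t => ?_, fun t => ?_, fun t => ?_, fun t a => ?_, fun s t hst => ?_,
    fun s t hst a => ?_, fun s t hst => ?_⟩
  · refine (hy t).trans ?_; linarith
  · refine (hM.nrm_le _).trans ?_
    have : M * ‖p.1 t‖ ≤ M * (2 * M * N) := mul_le_mul_of_nonneg_left (hy t) (by linarith)
    have h4 : 0 ≤ M ^ 2 * N := by positivity
    nlinarith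
  · refine (h.op t).trans ?_; linarith
  · refine (hM.nrm_le _).trans ?_
    have := (p.2 t).le_of_opNorm_le (h.op t) a
    calc M * ‖p.2 t a‖ ≤ M * (N * ‖a‖) := by gcongr
      _ = M * N * ‖a‖ := by ring
      _ ≤ _ := mul_le_mul_of_nonneg_right (by linarith) (norm_nonneg a)
  · have hts : 0 ≤ (t : ℝ) - s := sub_nonneg.2 (Subtype.coe_le_coe.2 hst)
    have hts1 : (t : ℝ) - s ≤ 1 := by linarith [t.2.2, s.2.1]
    have b1 := hrem s t hst
    have b2 := (p.2 s).le_of_opNorm_le_of_le (h.op s) (w.norm_path_sub_le s.2.1 hst t.2.2)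
    have b3 := hM.nrm_le (p.2 s (w.path t - w.path s))
    have hk : ((t : ℝ) - s) ^ (2 * γ) ≤ ((t : ℝ) - s) ^ γ := by
      rcases eq_or_lt_of_le hts with h0 | h0
      · rw [← h0, Real.zero_rpow (by linarith), Real.zero_rpow hγ.ne']
      · exact Real.rpow_le_rpow_of_exponent_ge h0 hts1 (by linarith)
    set k := ((t : ℝ) - s) ^ γ
    have hk0 : 0 ≤ k := Real.rpow_nonneg hts _
    have e : p.1 t - p.1 s = (p.1 t - p.1 s - p.2 s (w.path t - w.path s))
      + p.2 s (w.path t - w.path s) := by abel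
    rw [e]
    calc _ ≤ 3 * M ^ 2 * (1 + w.norm1) * N * k + M * (N * (w.norm1 * k)) := by
          refine (L.nrm_add_le hθ _ _).trans (add_le_add (b1.trans ?_) (b3.trans ?_))
          · gcongr
          · gcongr
      _ = (3 * M ^ 2 * (1 + w.norm1) + M * w.norm1) * (N * k) := by ring
      _ ≤ (4 * M ^ 2 * (1 + w.norm1)) * (N * k) := by
          refine mul_le_mul_of_nonneg_right ?_ (by positivity)
          nlinarith
      _ = _ := by ring
  · have hts : 0 ≤ (t : ℝ) - s := sub_nonneg.2 (Subtype.coe_le_coe.2 hst)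
    have hts1 : (t : ℝ) - s ≤ 1 := by linarith [t.2.2, s.2.1]
    have b1 := h.deriv s t hst a
    have b2 := (p.2 s).le_of_opNorm_le (h.op s) a
    have b3 := hM.nrm_S_sub _ hts hts1 (p.2 s a)
    have hk : ((t : ℝ) - s) ^ (2 * γ) ≤ ((t : ℝ) - s) ^ γ := by
      rcases eq_or_lt_of_le hts with h0 | h0
      · rw [← h0, Real.zero_rpow (by linarith), Real.zero_rpow hγ.ne']
      · exact Real.rpow_le_rpow_of_exponent_ge h0 hts1 (by linarith)
    set k := ((t : ℝ) - s) ^ γ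
    have hk0 : 0 ≤ k := Real.rpow_nonneg hts _
    have e : p.2 t a - p.2 s a = (p.2 t a - L.S ((t : ℝ) - s) (p.2 s a))
      + (L.S ((t : ℝ) - s) (p.2 s a) - p.2 s a) := by abel
    rw [e]
    calc _ ≤ N * k * ‖a‖ + M * k * (N * ‖a‖) := by
          refine (L.nrm_add_le hθ _ _).trans (add_le_add b1 (b3.trans ?_))
          gcongr
      _ = (N + M * N) * (k * ‖a‖) := by ring
      _ ≤ (4 * M ^ 2 * (1 + w.norm1) * N) * (k * ‖a‖) := by
          refine mul_le_mul_of_nonneg_right ?_ (by positivity)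
          linarith
      _ = _ := by ring
  · refine (hrem s t hst).trans ?_
    have hts : 0 ≤ (t : ℝ) - s := sub_nonneg.2 (Subtype.coe_le_coe.2 hst)
    have := Real.rpow_nonneg hts (2 * γ)
    gcongr
    norm_num

end Pointwise

/-! ### The space of controlled paths -/

theorem tendsto_nrmOp_iff (hθ : -2 * γ ≤ 0) (y' : I01 → EuclideanSpace ℝ (Fin d) →L[ℝ] H) :
    (∀ t : I01, Tendsto (fun s => L.nrmOp (-2 * γ) (fun a => y' s a - y' t a)) (𝓝 t) (𝓝 0))
      ↔ Continuous fun t => (L.emb _ hθ).comp (y' t) := by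
  rw [continuous_iff_continuousAt]
  refine forall_congr' fun t => ?_
  rw [ContinuousAt, tendsto_iff_norm_sub_tendsto_zero (f := fun t => (L.emb _ hθ).comp (y' t))]
  refine iff_of_eq (congrArg (fun f => Tendsto f (𝓝 t) (𝓝 0)) (funext fun s => ?_))
  have := nrmOp_eq L hθ (y' s - y' t)
  simp only [sub_apply] at this
  rw [this, ContinuousLinearMap.comp_sub]

/-- The `γ`-Hölder bound of `y` in `H_{-2γ}` is not part of the norm. It is recovered from the
remainder and from `y'` applied to the increment of the path. -/
theorem memD_of_pointwise (hM : ∃ M, L.SemigroupBounds γ M) (hγ : 0 < γ)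
    (hθ : -2 * γ ≤ 0) {N : ℝ} (h : Pointwise L w η p N)
    (hc : Continuous p.1) (hc' : Continuous fun t => (L.emb _ hθ).comp (p.2 t)) :
    MemD L η w p := by
  have hf := h.finD hθ
  refine ⟨hc, (tendsto_nrmOp_iff hθ _).2 hc', ?_, ?_, ?_, ?_, hf.op⟩
  · obtain ⟨M, hM⟩ := hM
    have hN := h.nonneg
    have hM1 := hM.one_le
    have hρ := w.norm1_nonneg
    refine holderFinite_of_le (B := N + M * (M * (N * w.norm1))) (by positivity)
      fun s t hst => ?_
    have hts : 0 ≤ (t : ℝ) - s := sub_nonneg.2 (Subtype.coe_le_coe.2 hst)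
    have hts1 : (t : ℝ) - s ≤ 1 := by linarith [t.2.2, s.2.1]
    have b2 := (p.2 s).le_of_opNorm_le_of_le (h.op s) (w.norm_path_sub_le s.2.1 hst t.2.2)
    have b3 := hM.nrm_le (L.S ((t : ℝ) - s) (p.2 s (w.path t - w.path s)))
    have b4 := hM.norm_S _ hts hts1 (p.2 s (w.path t - w.path s))
    have hk : ((t : ℝ) - s) ^ (2 * γ) ≤ ((t : ℝ) - s) ^ γ := by
      rcases eq_or_lt_of_le hts with h0 | h0
      · rw [← h0, Real.zero_rpow (by linarith), Real.zero_rpow hγ.ne']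
      · exact Real.rpow_le_rpow_of_exponent_ge h0 hts1 (by linarith)
    have b1 := h.rem s t hst
    set k := ((t : ℝ) - s) ^ γ
    have hk0 : 0 ≤ k := Real.rpow_nonneg hts _
    have e : hatDelta L p.1 t s = (p.1 t - L.S ((t : ℝ) - s) (p.1 s)
      - L.S ((t : ℝ) - s) (p.2 s (w.path t - w.path s)))
      + L.S ((t : ℝ) - s) (p.2 s (w.path t - w.path s)) := by
      rw [hatDelta]; abel
    rw [e]
    calc _ ≤ N * k + M * (M * (N * (w.norm1 * k))) := by
          refine (L.nrm_add_le hθ _ _).trans (add_le_add (b1.trans (by gcongr)) (b3.trans ?_))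
          exact mul_le_mul_of_nonneg_left (b4.trans (by gcongr)) (by linarith)
      _ = _ := by ring
  · simpa only [FamBdd, HolderFinite, norm_famDeriv] using hf.deriv
  · simpa only [FamBdd, HolderFinite, norm_famRem] using hf.rem
  · simpa only [FamBdd, HolderFinite, norm_famEta] using hf.eta

theorem MemD.pointwise (hγ : 0 ≤ γ) (h : MemD L η w p) : Pointwise L w η p (normD L η w p) :=
  (h.finD (show -2 * γ ≤ 0 by linarith)).pointwise

theorem MemD.cont_emb (hθ : -2 * γ ≤ 0) (h : MemD L η w p) :
    Continuous fun t => (L.emb _ hθ).comp (p.2 t) := (tendsto_nrmOp_iff hθ _).1 h.cont'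

theorem MemD.add (hM : ∃ M, L.SemigroupBounds γ M) (hγ : 0 < γ) (hp : MemD L η w p)
    (hq : MemD L η w q) : MemD L η w (p + q) := by
  have hθ : -2 * γ ≤ 0 := by linarith
  refine memD_of_pointwise hM hγ hθ ((hp.finD hθ).add (hq.finD hθ)).pointwise
    (hp.cont.add hq.cont) ?_
  refine ((hp.cont_emb hθ).add (hq.cont_emb hθ)).congr fun t => ?_
  exact (ContinuousLinearMap.comp_add _ _ _).symm

theorem MemD.smul (hM : ∃ M, L.SemigroupBounds γ M) (hγ : 0 < γ) (hp : MemD L η w p) (c : ℝ) :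
    MemD L η w (c • p) := by
  have hθ : -2 * γ ≤ 0 := by linarith
  refine memD_of_pointwise hM hγ hθ ((hp.finD hθ).smul c).pointwise (hp.cont.const_smul c) ?_
  refine ((hp.cont_emb hθ).const_smul c).congr fun t => ?_
  exact (ContinuousLinearMap.comp_smul _ _ _).symm

theorem MemD.sub (hM : ∃ M, L.SemigroupBounds γ M) (hγ : 0 < γ) (hp : MemD L η w p)
    (hq : MemD L η w q) : MemD L η w (p - q) := by
  have := hp.add hM hγ (hq.smul hM hγ (-1))
  rwa [neg_one_smul, ← sub_eq_add_neg] at this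

theorem pointwise_zero : Pointwise L w η (0 : Pair H d) 0 := by
  refine ⟨?_, fun a => ?_, fun s t _ => ?_, fun t => ?_, fun s t _ a => ?_, fun s t _ => ?_⟩ <;>
  simp [LinearPart.nrm, LinearPart.coef]

theorem MemD.zero (hM : ∃ M, L.SemigroupBounds γ M) (hγ : 0 < γ) :
    MemD L η w (0 : Pair H d) := by
  have hθ : -2 * γ ≤ 0 := by linarith
  refine memD_of_pointwise hM hγ hθ pointwise_zero continuous_zero ?_
  refine (continuous_zero).congr fun t => ?_
  simp

theorem normD_zero (hθ : -2 * γ ≤ 0) : normD L η w (0 : Pair H d) = 0 := by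
  have := normD_smul (L := L) (w := w) (η := η) hθ 0 (0 : Pair H d)
  simpa using this

theorem normD_neg (hθ : -2 * γ ≤ 0) (p : Pair H d) : normD L η w (-p) = normD L η w p := by
  have := normD_smul (L := L) (w := w) (η := η) hθ (-1) p
  simpa using this

theorem MemD.normD_add_le (hγ : 0 ≤ γ) (hp : MemD L η w p) (hq : MemD L η w q) :
    normD L η w (p + q) ≤ normD L η w p + normD L η w q :=
  (hp.finD (show -2 * γ ≤ 0 by linarith)).normD_add_le (hq.finD _)

theorem MemD.normD_sub_le (hM : ∃ M, L.SemigroupBounds γ M) (hγ : 0 < γ) (hp : MemD L η w p)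
    (hq : MemD L η w q) : normD L η w (p - q) ≤ normD L η w p + normD L η w q := by
  have h := hp.normD_add_le hγ.le (hq.smul hM hγ (-1))
  rwa [neg_one_smul, ← sub_eq_add_neg, normD_neg (by linarith)] at h

/-- The path `S_· x` with zero derivative. -/
theorem normD_orbit_le (hγ : 0 ≤ γ) (x : H) :
    Pointwise L w η (((fun t => L.S t x), 0) : Pair H d) ‖x‖ ∧
      normD L η w (((fun t => L.S t x), 0) : Pair H d) ≤ ‖x‖ := by
  have hθ : -2 * γ ≤ 0 := by linarith
  have hd : ∀ s t : I01, s ≤ t → L.S t x - L.S ((t : ℝ) - s) (L.S s x) = 0 := fun s t hst => by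
    rw [L.S_comm (sub_nonneg.2 (Subtype.coe_le_coe.2 hst)) s.2.1, sub_add_cancel, sub_self]
  have h0 : L.S ((0 : I01) : ℝ) x = x := by
    rw [show ((0 : I01) : ℝ) = 0 from rfl, L.S_zero]; rfl
  have hr : ∀ (s t : I01) (r : ℝ), s ≤ t → 0 ≤ ((t : ℝ) - s) ^ r := fun s t r hst =>
    Real.rpow_nonneg (sub_nonneg.2 (Subtype.coe_le_coe.2 hst)) _
  constructor
  · refine ⟨by simp [L.S_zero], fun a => ?_, fun s t hst => ?_, fun t => ?_, fun s t hst a => ?_,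
      fun s t hst => ?_⟩
    · simp only [Pi.zero_apply, zero_apply, L.nrm_zero hθ]; positivity
    · simp only [hd s t hst, norm_zero]
      exact mul_nonneg (norm_nonneg _) (hr s t η hst)
    · simp
    · simp only [Pi.zero_apply, zero_apply, map_zero, sub_zero, L.nrm_zero hθ]
      exact mul_nonneg (mul_nonneg (norm_nonneg _) (hr s t γ hst)) (norm_nonneg _)
    · simp only [hd s t hst, Pi.zero_apply, zero_apply, map_zero, sub_zero, L.nrm_zero hθ]
      exact mul_nonneg (norm_nonneg _) (hr s t (2 * γ) hst)
  · rw [normD_eq L w hθ]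
    have e1 : famSup (famEta L η) (((fun t => L.S t x), 0) : Pair H d) = 0 := by
      simp only [famSup, norm_famEta, hatDelta]
      have : ∀ z : Simplex, ‖L.S (z.1.1 : ℝ) x - L.S ((z.1.1 : ℝ) - z.1.2) (L.S z.1.2 x)‖
          / ((z.1.1 : ℝ) - z.1.2) ^ η = 0 := fun z => by rw [hd _ _ z.2]; simp
      simp only [this, ciSup_const]
    have e2 : famSup (evalOp : I01 → Pair H d →ₗ[ℝ] _) ((fun t => L.S t x), 0) = 0 := by
      simp [famSup, evalOp]
    have e3 : famSup (famDeriv L hθ) (((fun t => L.S t x), 0) : Pair H d) = 0 := by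
      simp [famSup, famDeriv, evalOp]
    have e4 : famSup (famRem L w hθ) (((fun t => L.S t x), 0) : Pair H d) = 0 := by
      simp only [famSup, norm_famRem, remainder, hatDelta]
      have : ∀ z : Simplex, L.nrm (-2 * γ) (L.S (z.1.1 : ℝ) x
          - L.S ((z.1.1 : ℝ) - z.1.2) (L.S z.1.2 x) - L.S ((z.1.1 : ℝ) - z.1.2)
            ((0 : I01 → EuclideanSpace ℝ (Fin d) →L[ℝ] H) z.1.2 (w.path z.1.1 - w.path z.1.2)))
          / ((z.1.1 : ℝ) - z.1.2) ^ (2 * γ) = 0 := fun z => by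
        rw [hd _ _ z.2]
        simp only [Pi.zero_apply, zero_apply, map_zero, sub_zero, L.nrm_zero hθ, zero_div]
      simp only [this, ciSup_const]
    have e5 : embOp L hθ 0 (((fun t => L.S t x), 0) : Pair H d) = 0 := by
      simp [embOp, evalOp]
    have e6 : evalH 0 (((fun t => L.S t x), 0) : Pair H d) = x := h0
    rw [e1, e2, e3, e4, e5, e6]
    simp

/-- For a path that starts at zero, the end point is a mild increment over an interval of length
one. -/
theorem MemD.norm_one_le (hγ : 0 ≤ γ) (hp : MemD L η w p) (h0 : p.1 0 = 0) :
    ‖p.1 1‖ ≤ normD L η w p := by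
  have := (hp.pointwise hγ).eta 0 1 zero_le_one
  rw [h0, map_zero, sub_zero] at this
  simpa using this

theorem memD_orbit (hM : ∃ M, L.SemigroupBounds γ M) (hγ : 0 < γ) (x : H) :
    MemD L η w (((fun t => L.S t x), 0) : Pair H d) := by
  have hθ : -2 * γ ≤ 0 := by linarith
  refine memD_of_pointwise hM hγ hθ (normD_orbit_le hγ.le x).1 ?_ ?_
  · exact (L.continuousOn_S x).comp_continuous continuous_subtype_val fun t => t.2.1
  · exact continuous_zero.congr fun t => by simp

end ControlledNorm

/-! ## The mild solution map -/

section Mild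

variable {𝕜 H : Type*} [RCLike 𝕜] [NormedAddCommGroup H] [InnerProductSpace 𝕜 H]
  [CompleteSpace H] [NormedSpace ℝ H] [IsScalarTower ℝ 𝕜 H] {d : ℕ}
  {L : LinearPart 𝕜 H} {γ η : ℝ} {w : RoughPath γ d}

/-! ### Convolution with the drift -/

theorem continuousOn_conv_integrand {F : I01 → H} (hF : Continuous F) {t : ℝ} :
    ContinuousOn (fun u => L.S (t - u) (ext01 F u)) (Iic t) := by
  have hE : Continuous (ext01 F) := hF.Icc_extend'
  intro u₀ hu₀
  have hu₀ : u₀ ≤ t := hu₀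
  obtain ⟨M, hM, hb⟩ := L.exists_norm_S_le_Icc (t - u₀ + 1)
  have hS : Tendsto (fun u => L.S (t - u) (ext01 F u₀)) (𝓝[Iic t] u₀)
      (𝓝 (L.S (t - u₀) (ext01 F u₀))) := by
    have h1 : ContinuousOn (fun u => L.S (t - u) (ext01 F u₀)) (Iic t) :=
      (L.continuousOn_S (ext01 F u₀)).comp (by fun_prop) fun u hu => sub_nonneg.2 (mem_Iic.1 hu)
    exact h1 u₀ hu₀
  have hD : Tendsto (fun u => L.S (t - u) (ext01 F u - ext01 F u₀)) (𝓝[Iic t] u₀) (𝓝 0) := by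
    have h1 : Tendsto (fun u => M * ‖ext01 F u - ext01 F u₀‖) (𝓝[Iic t] u₀) (𝓝 0) := by
      have := ((hE.tendsto u₀).sub_const (ext01 F u₀)).norm.const_mul M
      simp only [sub_self, norm_zero, mul_zero] at this
      exact this.mono_left nhdsWithin_le_nhds
    refine squeeze_zero_norm' ?_ h1
    have h2 : ∀ᶠ u in 𝓝[Iic t] u₀, u₀ - 1 ≤ u :=
      nhdsWithin_le_nhds (Ici_mem_nhds (by linarith))
    filter_upwards [h2, self_mem_nhdsWithin] with u hu hut
    have hut : u ≤ t := hut
    exact (L.S (t - u)).le_of_opNorm_le (hb _ (by linarith) (by linarith)) _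
  have := hD.add hS
  rw [zero_add] at this
  refine this.congr fun u => ?_
  rw [← map_add, sub_add_cancel]

theorem intervalIntegrable_conv {F : I01 → H} (hF : Continuous F) {s t : ℝ} (hst : s ≤ t) {r : ℝ}
    (htr : t ≤ r) : IntervalIntegrable (fun u => L.S (r - u) (ext01 F u))
      MeasureTheory.volume s t := by
  refine ContinuousOn.intervalIntegrable ?_
  rw [uIcc_of_le hst]
  exact (continuousOn_conv_integrand hF).mono fun u hu => hu.2.trans htr

theorem norm_drift_conv_le {M : ℝ} (hM : L.SemigroupBounds γ M) {F : I01 → H} {b : ℝ}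
    (hb : ∀ t, ‖F t‖ ≤ b) {s t : ℝ} (hs : 0 ≤ s) (hst : s ≤ t) (ht : t ≤ 1) :
    ‖∫ u in s..t, L.S (t - u) (ext01 F u)‖ ≤ M * b * (t - s) := by
  have := intervalIntegral.norm_integral_le_of_norm_le_const (a := s) (b := t) (C := M * b)
    (f := fun u => L.S (t - u) (ext01 F u)) fun u hu => by
      rw [uIoc_of_le hst] at hu
      refine (hM.norm_S _ (by linarith [hu.2]) (by linarith [hu.1]) _).trans ?_
      exact mul_le_mul_of_nonneg_left (hb _) (by linarith [hM.one_le])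
  rwa [abs_of_nonneg (by linarith)] at this

/-! ### Paths that are Hölder continuous in the mild sense -/

/-- A mild increment compares with the orbit of an earlier value only. Hence `y_t` and `y_{t₀}` are
both compared with the orbit started at a point slightly to the left of `t₀`, and that orbit is
continuous. -/
theorem continuous_of_mild_holder {y : I01 → H} {C r : ℝ} (hr : 0 < r)
    (h : ∀ s t : I01, s ≤ t → ‖y t - L.S ((t : ℝ) - s) (y s)‖ ≤ C * ((t : ℝ) - s) ^ r) :
    Continuous y := by
  rw [Metric.continuous_iff']
  intro t₀ ε hε
  have hlim : Tendsto (fun δ : ℝ => |C| * (2 * δ) ^ r) (𝓝[>] 0) (𝓝 0) := by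
    have h1 : ContinuousAt (fun δ : ℝ => |C| * (2 * δ) ^ r) 0 :=
      continuousAt_const.mul ((Real.continuousAt_rpow_const _ _ (Or.inr hr.le)).comp
        (f := fun δ : ℝ => 2 * δ) (by fun_prop))
    have h2 := h1.tendsto
    rw [mul_zero, Real.zero_rpow hr.ne', mul_zero] at h2
    exact h2.mono_left nhdsWithin_le_nhds
  obtain ⟨δ, hδε, hδ⟩ := ((hlim.eventually (gt_mem_nhds (show 0 < ε / 3 by linarith))).and
    self_mem_nhdsWithin).exists
  have hδ : 0 < δ := hδ
  -- The base point is cut off at `0`. Points within `δ` of `t₀` lie within `2δ` of it.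
  set a : I01 := ⟨max 0 ((t₀ : ℝ) - δ), le_max_left _ _,
    max_le zero_le_one (by linarith [t₀.2.2])⟩ with ha
  have ha' : (a : ℝ) = max 0 ((t₀ : ℝ) - δ) := rfl
  have hcont : Continuous fun t : I01 => L.S (max ((t : ℝ) - a) 0) (y a) :=
    (L.continuousOn_S (y a)).comp_continuous (by fun_prop) fun t => mem_Ici.2 (le_max_right _ _)
  have hev1 := (Metric.continuous_iff'.1 hcont) t₀ (ε / 3) (by linarith)
  have hev2 : ∀ᶠ t : I01 in 𝓝 t₀, (t₀ : ℝ) - δ < t ∧ (t : ℝ) < t₀ + δ := by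
    have : Tendsto (fun t : I01 => (t : ℝ)) (𝓝 t₀) (𝓝 t₀) := continuous_subtype_val.tendsto _
    exact (this.eventually (lt_mem_nhds (by linarith))).and
      (this.eventually (gt_mem_nhds (by linarith)))
  have hbd : ∀ t : I01, (t₀ : ℝ) - δ < t → (t : ℝ) < t₀ + δ →
      ‖y t - L.S (max ((t : ℝ) - a) 0) (y a)‖ < ε / 3 := fun t h1 h2 => by
    have hat : (a : ℝ) ≤ t := max_le t.2.1 h1.le
    have hat' : (t₀ : ℝ) - δ ≤ a := le_max_right _ _
    rw [max_eq_left (by linarith)]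
    refine lt_of_le_of_lt ((h a t hat).trans ?_) hδε
    have : ((t : ℝ) - a) ^ r ≤ (2 * δ) ^ r :=
      Real.rpow_le_rpow (by linarith) (by linarith) hr.le
    exact mul_le_mul (le_abs_self C) this (Real.rpow_nonneg (by linarith) _) (abs_nonneg _)
  filter_upwards [hev1, hev2] with t ht1 ht2
  have b1 := hbd t ht2.1 ht2.2
  have b2 := hbd t₀ (by linarith) (by linarith)
  rw [dist_eq_norm] at ht1 ⊢
  have e : y t - y t₀ = (y t - L.S (max ((t : ℝ) - a) 0) (y a))
    + (L.S (max ((t : ℝ) - a) 0) (y a) - L.S (max ((t₀ : ℝ) - a) 0) (y a))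
    - (y t₀ - L.S (max ((t₀ : ℝ) - a) 0) (y a)) := by abel
  rw [e]
  refine (norm_sub_le _ _).trans_lt ?_
  have := norm_add_le (y t - L.S (max ((t : ℝ) - a) 0) (y a))
    (L.S (max ((t : ℝ) - a) 0) (y a) - L.S (max ((t₀ : ℝ) - a) 0) (y a))
  linarith

/-! ### The convolution with drift and noise -/

/-- The standing assumptions on the coefficients, with the constants that enter the estimates. -/
structure Coeffs (L : LinearPart 𝕜 H) (γ : ℝ) (f : H → H)
    (g : H → EuclideanSpace ℝ (Fin d) →L[ℝ] H) (M m : ℝ) : Prop where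
  lt_γ : 1 / 3 < γ
  γ_le : γ ≤ 1 / 2
  semigroup : L.SemigroupBounds γ M
  f_cont : Continuous f
  f_zero : f 0 = 0
  g_flat : FlatCubic g m
  g_ext : ∃ (hθ : -2 * γ ≤ 0) (G : L.Hs (-2 * γ) → EuclideanSpace ℝ (Fin d) →L[ℝ] L.Hs (-2 * γ)),
    FlatCubic G m ∧ ∀ x, G (L.emb _ hθ x) = (L.emb _ hθ).comp (g x)

/-- `∫_s^t Q_{r-u} f(y_u) du + ∫_s^t Q_{r-u} g(y_u) d𝐰_u`. -/
def mildConv (L : LinearPart 𝕜 H) (f : H → H) (g : H → EuclideanSpace ℝ (Fin d) →L[ℝ] H)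
    (w : RoughPath γ d) (P : Pair H d) (Q : ℝ → H →L[𝕜] H) (r s t : ℝ) : H :=
  (∫ u in s..t, Q (r - u) (ext01 (fun t => f (P.1 t)) u))
    + roughIntegral L w (fun u => Q (r - u)) (fun t => g (P.1 t)) (compDeriv g P) s t

/-- The integrals in `mildConv` exist. -/
def MildConvExists (L : LinearPart 𝕜 H) (f : H → H) (g : H → EuclideanSpace ℝ (Fin d) →L[ℝ] H)
    (w : RoughPath γ d) (P : Pair H d) (Q : ℝ → H →L[𝕜] H) (r s t : ℝ) : Prop :=
  IntervalIntegrable (fun u => Q (r - u) (ext01 (fun t => f (P.1 t)) u)) MeasureTheory.volume s t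
    ∧ ∃ I, IsRoughIntegral L w (fun u => Q (r - u)) (fun t => g (P.1 t)) (compDeriv g P) s t I

namespace Coeffs

variable {f : H → H} {g : H → EuclideanSpace ℝ (Fin d) →L[ℝ] H} {M m B E : ℝ} {P P₁ : Pair H d}

theorem pos (C : Coeffs L γ f g M m) : 0 < γ := by linarith [C.lt_γ]

theorem nonpos (C : Coeffs L γ f g M m) : -2 * γ ≤ 0 := by linarith [C.lt_γ]

/-- The constant in `ctrl_comp_sub`. -/
def ctrlConst (w : RoughPath γ d) (M m B E : ℝ) : ℝ := 9 * M * (1 + w.norm1) * (m * B ^ 2 * E)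

theorem ctrl_sub (C : Coeffs L γ f g M m) (hP : Plain L w P B) (hP₁ : Plain L w P₁ B)
    (hPP : Plain L w (P - P₁) E) :
    Ctrl L w ((fun t => g (P.1 t)) - fun t => g (P₁.1 t)) (compDeriv g P - compDeriv g P₁)
      (ctrlConst w M m B E) := by
  obtain ⟨hθ, G, hG, hGι⟩ := C.g_ext
  exact hP.ctrl_comp_sub C.semigroup C.pos hθ hP₁ hPP C.g_flat hG hGι

theorem plain_zero (C : Coeffs L γ f g M m) (hB : 0 ≤ B) : Plain L w (0 : Pair H d) B := by
  have hθ := C.nonpos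
  have hr : ∀ (s t : I01) (r : ℝ), s ≤ t → 0 ≤ ((t : ℝ) - s) ^ r := fun s t r hst =>
    Real.rpow_nonneg (sub_nonneg.2 (Subtype.coe_le_coe.2 hst)) _
  refine ⟨fun t => ?_, fun t => ?_, fun t => ?_, fun t a => ?_, fun s t hst => ?_,
    fun s t hst a => ?_, fun s t hst => ?_⟩ <;>
    simp only [Prod.fst_zero, Prod.snd_zero, Pi.zero_apply, zero_apply, norm_zero, sub_zero,
      L.nrm_zero hθ]
  · exact hB
  · exact hB
  · exact hB
  · positivity
  · exact mul_nonneg hB (hr s t γ hst)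
  · exact mul_nonneg (mul_nonneg hB (hr s t γ hst)) (norm_nonneg _)
  · exact mul_nonneg hB (hr s t (2 * γ) hst)

theorem compDeriv_zero : compDeriv g (0 : Pair H d) = 0 := by
  funext t
  simp [compDeriv]

/-- The single path estimate is the difference estimate against the zero path, because `g(0) = 0`.
-/
theorem ctrl (C : Coeffs L γ f g M m) (hP : Plain L w P B) :
    Ctrl L w (fun t => g (P.1 t)) (compDeriv g P) (ctrlConst w M m B B) := by
  have h := C.ctrl_sub hP (C.plain_zero hP.nonneg) (by rwa [sub_zero])
  have e : ((fun t => g (P.1 t)) - fun t => g ((0 : Pair H d).1 t)) = fun t => g (P.1 t) := by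
    funext t
    simp [C.g_flat.map_zero]
  rwa [e, compDeriv_zero, sub_zero] at h

theorem exists_rough (C : Coeffs L γ f g M m) (hP : Plain L w P B) {s t r : ℝ} (hs : 0 ≤ s)
    (hst : s ≤ t) (htr : t ≤ r) (hr : r ≤ 1) :
    ∃ I, IsRoughIntegral L w (fun u => L.S (r - u)) (fun t => g (P.1 t)) (compDeriv g P) s t I := by
  obtain ⟨I, hI, -⟩ := (C.ctrl hP).exists_isRoughIntegral C.semigroup C.lt_γ C.γ_le hs hst
    (htr.trans hr)
  -- For `r > t` the kernel `S_{r-u}` factors as `S_{r-t} S_{t-u}`.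
  refine ⟨L.S (r - t) I, hI.comp (C.semigroup.nrm_S (r - t) (by linarith) (by linarith)) ?_⟩
  intro u hu x
  rw [L.S_comm (by linarith) (by linarith [hu.2])]
  congr 2; ring

theorem exists_mildConv (C : Coeffs L γ f g M m) (hP : Plain L w P B) (hc : Continuous P.1)
    {s t r : ℝ} (hs : 0 ≤ s) (hst : s ≤ t) (htr : t ≤ r) (hr : r ≤ 1) :
    MildConvExists L f g w P L.S r s t :=
  ⟨intervalIntegrable_conv (C.f_cont.comp hc) hst htr, C.exists_rough hP hs hst htr hr⟩

/-- Convolutions with operators of the form `T S_{r₀-u}`. -/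
theorem mildConv_comp (C : Coeffs L γ f g M m) (hP : Plain L w P B) (hc : Continuous P.1)
    {s t r r₀ : ℝ} (hs : 0 ≤ s) (hst : s ≤ t) (htr : t ≤ r₀) (hr : r₀ ≤ 1) {T : H →L[𝕜] H}
    {Q : ℝ → H →L[𝕜] H} {c : ℝ} (hT : ∀ x, L.nrm (-2 * γ) (T x) ≤ c * L.nrm (-2 * γ) x)
    (hQ : ∀ u ∈ Icc s t, ∀ x, Q (r - u) x = T (L.S (r₀ - u) x)) :
    MildConvExists L f g w P Q r s t ∧
      mildConv L f g w P Q r s t = T (mildConv L f g w P L.S r₀ s t) := by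
  obtain ⟨h1, I, hI⟩ := C.exists_mildConv hP hc hs hst htr hr
  have hI' := hI.comp (Q' := fun u => Q (r - u)) hT hQ
  have hTi : IntervalIntegrable (fun u => T (L.S (r₀ - u) (ext01 (fun t => f (P.1 t)) u)))
      MeasureTheory.volume s t :=
    ⟨(T.restrictScalars ℝ).integrable_comp h1.1, (T.restrictScalars ℝ).integrable_comp h1.2⟩
  have hcongr : ∀ u ∈ uIoc s t, T (L.S (r₀ - u) (ext01 (fun t => f (P.1 t)) u))
      = Q (r - u) (ext01 (fun t => f (P.1 t)) u) := fun u hu => by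
    rw [uIoc_of_le hst] at hu
    exact (hQ u ⟨hu.1.le, hu.2⟩ _).symm
  refine ⟨⟨hTi.congr hcongr, _, hI'⟩, ?_⟩
  rw [mildConv, mildConv, hI.roughIntegral_eq C.nonpos hst, hI'.roughIntegral_eq C.nonpos hst,
    map_add]
  congr 1
  have := (T.restrictScalars ℝ).intervalIntegral_comp_comm h1
  rw [ContinuousLinearMap.coe_restrictScalars'] at this
  rw [← this]
  refine intervalIntegral.integral_congr fun u hu => ?_
  rw [uIcc_of_le hst] at hu
  exact hQ u hu _

/-- The flow property of the mild convolution. -/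
theorem mildConv_flow (C : Coeffs L γ f g M m) (hP : Plain L w P B) (hc : Continuous P.1)
    {s r t : ℝ} (hs : 0 ≤ s) (hsr : s ≤ r) (hrt : r ≤ t) (ht : t ≤ 1) :
    mildConv L f g w P L.S t s t
      = L.S (t - r) (mildConv L f g w P L.S r s r) + mildConv L f g w P L.S t r t := by
  have hQ : ∀ u ∈ Icc s r, ∀ x, L.S (t - u) x = L.S (t - r) (L.S (r - u) x) := fun u hu x => by
    rw [L.S_comm (by linarith) (by linarith [hu.2])]; congr 2; ring
  have h1 := C.mildConv_comp hP hc hs hsr le_rfl (hrt.trans ht) (T := L.S (t - r)) (Q := L.S)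
    (r := t) (C.semigroup.nrm_S _ (by linarith) (by linarith)) hQ
  obtain ⟨⟨i1, I₁, hI₁⟩, e1⟩ := h1
  obtain ⟨i2, I₂, hI₂⟩ := C.exists_mildConv hP hc (hs.trans hsr) hrt le_rfl ht
  obtain ⟨i3, I₃, hI₃⟩ := C.exists_mildConv hP hc hs (hsr.trans hrt) le_rfl ht
  rw [← e1, mildConv, mildConv, mildConv, hI₁.roughIntegral_eq C.nonpos hsr,
    hI₂.roughIntegral_eq C.nonpos hrt, hI₃.roughIntegral_eq C.nonpos (hsr.trans hrt),
    hI₁.concat C.nonpos hsr hrt hI₂ hI₃,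
    ← intervalIntegral.integral_add_adjacent_intervals i1 i2]
  abel

theorem mildConv_self (C : Coeffs L γ f g M m) (hP : Plain L w P B) (hc : Continuous P.1)
    {s : ℝ} (hs : 0 ≤ s) (hs1 : s ≤ 1) : mildConv L f g w P L.S s s s = 0 := by
  have := C.mildConv_flow hP hc hs le_rfl le_rfl hs1
  rw [sub_self, L.S_zero] at this
  simpa using this

/-- The constant in the estimates of the rough convolution. -/
def roughConst (γ : ℝ) (d : ℕ) : ℝ := (singConst γ + sewConst (3 * γ) + 1) * ((d : ℝ) ^ 2 + 1) + 1

theorem roughConst_ge (C : Coeffs L γ f g M m) :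
    1 ≤ roughConst γ d ∧ ∀ b : ℝ, 0 ≤ b → ∀ w : RoughPath γ d,
      (singConst γ + 1) * Ctrl.size w b ≤ roughConst γ d * b * (1 + w.norm1 + w.norm2) ∧
      (sewConst (3 * γ) + 1) * Ctrl.size w b ≤ roughConst γ d * b * (1 + w.norm1 + w.norm2) ∧
      b * (1 + w.norm1) ≤ roughConst γ d * b * (1 + w.norm1 + w.norm2) := by
  have h1 := singConst_pos C.lt_γ
  have h2 := sewConst_pos (a := 3 * γ) (by linarith [C.lt_γ])
  have hd : (0 : ℝ) ≤ (d : ℝ) ^ 2 := sq_nonneg _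
  have hge : 1 ≤ roughConst γ d := by
    rw [roughConst]
    have : 0 ≤ (singConst γ + sewConst (3 * γ) + 1) * ((d : ℝ) ^ 2 + 1) := by positivity
    linarith
  refine ⟨hge, fun b hb w => ?_⟩
  have n1 := w.norm1_nonneg
  have n2 := w.norm2_nonneg
  have hx : Ctrl.size w b ≤ ((d : ℝ) ^ 2 + 1) * b * (1 + w.norm1 + w.norm2) := by
    rw [Ctrl.size]
    exact mul_le_mul_of_nonneg_left (by linarith) (by positivity)
  have hkey : ∀ c : ℝ, 0 ≤ c → c ≤ singConst γ + sewConst (3 * γ) + 1 →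
      c * Ctrl.size w b ≤ roughConst γ d * b * (1 + w.norm1 + w.norm2) := fun c hc hc' => by
    calc c * Ctrl.size w b ≤ (singConst γ + sewConst (3 * γ) + 1)
          * (((d : ℝ) ^ 2 + 1) * b * (1 + w.norm1 + w.norm2)) :=
          mul_le_mul hc' hx (Ctrl.size_nonneg w hb) (by positivity)
      _ = ((singConst γ + sewConst (3 * γ) + 1) * ((d : ℝ) ^ 2 + 1)) * b
            * (1 + w.norm1 + w.norm2) := by ring
      _ ≤ _ := by
          rw [roughConst]
          have hb' : 0 ≤ b * (1 + w.norm1 + w.norm2) := by positivity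
          nlinarith
  refine ⟨hkey _ (by linarith) (by linarith), hkey _ (by linarith) (by linarith), ?_⟩
  calc b * (1 + w.norm1) ≤ b * (1 + w.norm1 + w.norm2) :=
        mul_le_mul_of_nonneg_left (by linarith) hb
    _ ≤ roughConst γ d * (b * (1 + w.norm1 + w.norm2)) :=
        le_mul_of_one_le_left (by positivity) hge
    _ = _ := by ring

/-- The difference of two mild convolutions. -/
theorem mildConv_sub (C : Coeffs L γ f g M m) (hP : Plain L w P B) (hc : Continuous P.1)
    (hP₁ : Plain L w P₁ B) (hc₁ : Continuous P₁.1) (hPP : Plain L w (P - P₁) E) {bf : ℝ}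
    (hf : ∀ t, ‖f (P.1 t) - f (P₁.1 t)‖ ≤ bf) {s t : ℝ} (hs : 0 ≤ s) (hst : s ≤ t) (ht : t ≤ 1) :
    let b := ctrlConst w M m B E
    let N := M ^ 2 * bf + M ^ 2 * (roughConst γ d * b * (1 + w.norm1 + w.norm2))
    let D := mildConv L f g w P L.S t s t - mildConv L f g w P₁ L.S t s t
    ‖D‖ ≤ N * (t - s) ^ γ ∧
      L.nrm (-2 * γ) (D - L.S (t - s) ((ext01 ((fun t => g (P.1 t)) - fun t => g (P₁.1 t)) s)
        (w.path t - w.path s))) ≤ N * (t - s) ^ (2 * γ) := by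
  intro b N D
  have hθ := C.nonpos
  have hγ := C.pos
  have hγ2 := C.γ_le
  have hM := C.semigroup
  have hM1 := hM.one_le
  have hctrl := C.ctrl_sub hP hP₁ hPP
  have hb : 0 ≤ b := hctrl.nonneg
  have hbf : 0 ≤ bf := (norm_nonneg _).trans (hf 0)
  have hts : 0 ≤ t - s := by linarith
  have hts1 : t - s ≤ 1 := by linarith
  obtain ⟨hR1, hR⟩ := C.roughConst_ge
  obtain ⟨hRa, hRb, -⟩ := hR b hb w
  set X := roughConst γ d * b * (1 + w.norm1 + w.norm2) with hX
  have hMM : M ≤ M ^ 2 := by nlinarith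
  have hX0 : 0 ≤ X := by
    have := w.norm1_nonneg
    have := w.norm2_nonneg
    positivity
  obtain ⟨i1, I₁, hI₁⟩ := C.exists_mildConv hP hc hs hst le_rfl ht
  obtain ⟨i2, I₂, hI₂⟩ := C.exists_mildConv hP₁ hc₁ hs hst le_rfl ht
  obtain ⟨I, hI, hIH, hIV⟩ := hctrl.exists_isRoughIntegral hM C.lt_γ C.γ_le hs hst ht
  have hgerm := hctrl.norm_germ_le hM hγ hs hst ht
  -- By uniqueness, the integral of the difference integrand is the difference of the integrals, so
  -- the bounds for the difference apply and no cancellation is lost.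
  have hIe : I = I₁ - I₂ := hI.unique hθ hst (hI₁.sub hθ hI₂)
  set A := ∫ u in s..t, L.S (t - u) (ext01 (fun t => f (P.1 t) - f (P₁.1 t)) u) with hA
  have hDe : D = A + I := by
    simp only [D, mildConv]
    rw [hI₁.roughIntegral_eq hθ hst, hI₂.roughIntegral_eq hθ hst, hIe, add_sub_add_comm,
      ← intervalIntegral.integral_sub i1 i2, hA]
    congr 1
    refine intervalIntegral.integral_congr fun u _ => ?_
    simp only [← map_sub]
    rfl
  have hAb : ‖A‖ ≤ M * bf * (t - s) := norm_drift_conv_le hM hf hs hst ht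
  have hp : ∀ a : ℝ, 0 ≤ a → a ≤ 1 → t - s ≤ (t - s) ^ a := fun a ha ha1 => by
    rcases eq_or_lt_of_le hts with h0 | h0
    · rw [← h0]; exact Real.rpow_nonneg le_rfl _
    · have := Real.rpow_le_rpow_of_exponent_ge h0 hts1 ha1
      rwa [Real.rpow_one] at this
  set k := (t - s) ^ γ with hk
  set k2 := (t - s) ^ (2 * γ) with hk2
  have hk0 : 0 ≤ k := Real.rpow_nonneg hts _
  have hk20 : 0 ≤ k2 := Real.rpow_nonneg hts _
  have hk3 : (t - s) ^ (3 * γ) ≤ k2 := by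
    rcases eq_or_lt_of_le hts with h0 | h0
    · rw [← h0, Real.zero_rpow (by linarith)]; exact hk20
    · exact Real.rpow_le_rpow_of_exponent_ge h0 hts1 (by linarith)
  have hMbf : M * bf ≤ M ^ 2 * bf := mul_le_mul_of_nonneg_right hMM hbf
  have hMX : M * X ≤ M ^ 2 * X := mul_le_mul_of_nonneg_right hMM hX0
  have hMM0 : 0 ≤ M := by linarith
  constructor
  · have e : D = A + ((I - germ L w ((fun t => g (P.1 t)) - fun t => g (P₁.1 t))
        (compDeriv g P - compDeriv g P₁) t s t)
        + germ L w ((fun t => g (P.1 t)) - fun t => g (P₁.1 t))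
        (compDeriv g P - compDeriv g P₁) t s t) := by rw [hDe]; abel
    rw [e]
    calc _ ≤ M * bf * k + (singConst γ * (M * Ctrl.size w b) * k + M * Ctrl.size w b * k) := by
          refine (norm_add_le _ _).trans (add_le_add (hAb.trans ?_)
            ((norm_add_le _ _).trans (add_le_add hIH hgerm)))
          exact mul_le_mul_of_nonneg_left (hp γ hγ.le (by linarith)) (by positivity)
      _ = (M * bf + M * ((singConst γ + 1) * Ctrl.size w b)) * k := by ring
      _ ≤ N * k := by
          refine mul_le_mul_of_nonneg_right ?_ hk0
          have := mul_le_mul_of_nonneg_left hRa hMM0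
          simp only [N]
          linarith
  · have hsm : s ∈ Icc (0 : ℝ) 1 := ⟨hs, by linarith⟩
    have e' : ext01 (compDeriv g P - compDeriv g P₁) s = (compDeriv g P - compDeriv g P₁) ⟨s, hsm⟩ :=
      IccExtend_of_mem _ _ hsm
    set zz := ext01 ((fun t => g (P.1 t)) - fun t => g (P₁.1 t)) s (w.path t - w.path s) with hzz
    set cc := contract (ext01 (compDeriv g P - compDeriv g P₁) s) (w.area t s) with hcc
    have hccn : ‖cc‖ ≤ Ctrl.size w b * k2 := by
      have h1 := norm_contract_le _ (hctrl.bdd' ⟨s, hsm⟩) (w.area t s)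
      have h2 := w.norm_area_le hγ hs hst ht
      rw [hcc, e']
      calc _ ≤ (d : ℝ) ^ 2 * b * (w.norm2 * k2) := h1.trans (by gcongr)
        _ = ((d : ℝ) ^ 2 * b * w.norm2) * k2 := by ring
        _ ≤ _ := by
            refine mul_le_mul_of_nonneg_right ?_ hk20
            have := Ctrl.size_ge w hb
            have := mul_nonneg hb w.norm1_nonneg
            linarith
    have hScc : L.nrm (-2 * γ) (L.S (t - s) cc) ≤ M ^ 2 * (Ctrl.size w b * k2) := by
      refine (hM.nrm_le _).trans ?_
      calc M * ‖L.S (t - s) cc‖ ≤ M * (M * ‖cc‖) :=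
            mul_le_mul_of_nonneg_left (hM.norm_S _ hts hts1 _) hMM0
        _ ≤ M * (M * (Ctrl.size w b * k2)) := by gcongr
        _ = _ := by ring
    have hAV : L.nrm (-2 * γ) A ≤ M ^ 2 * bf * k2 := by
      refine (hM.nrm_le _).trans ?_
      calc M * ‖A‖ ≤ M * (M * bf * (t - s)) := by gcongr
        _ ≤ M * (M * bf * k2) := by
            have := hp (2 * γ) (by linarith) (by linarith)
            gcongr
        _ = _ := by ring
    have hgs : germ L w ((fun t => g (P.1 t)) - fun t => g (P₁.1 t))
        (compDeriv g P - compDeriv g P₁) t s t = L.S (t - s) zz + L.S (t - s) cc := by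
      rw [germ, ← map_add]
    -- Removing the first order term leaves the drift of order `1 ≥ 2γ`, the sewing error of order
    -- `3γ`, and the area term of order `2γ`.
    have e : D - L.S (t - s) zz = A + ((I - germ L w ((fun t => g (P.1 t)) - fun t => g (P₁.1 t))
        (compDeriv g P - compDeriv g P₁) t s t) + L.S (t - s) cc) := by
      rw [hDe, hgs]; abel
    rw [e]
    have hK := sewConst_pos (a := 3 * γ) (by linarith [C.lt_γ])
    have hsz := Ctrl.size_nonneg w hb
    calc _ ≤ M ^ 2 * bf * k2 + (sewConst (3 * γ) * (M * Ctrl.size w b) * k2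
          + M ^ 2 * (Ctrl.size w b * k2)) := by
          refine (L.nrm_add_le hθ _ _).trans (add_le_add hAV
            ((L.nrm_add_le hθ _ _).trans (add_le_add (hIV.trans ?_) hScc)))
          exact mul_le_mul_of_nonneg_left hk3 (by positivity)
      _ ≤ M ^ 2 * bf * k2 + (sewConst (3 * γ) * (M ^ 2 * Ctrl.size w b) * k2
          + M ^ 2 * (Ctrl.size w b * k2)) := by gcongr
      _ = (M ^ 2 * bf + M ^ 2 * ((sewConst (3 * γ) + 1) * Ctrl.size w b)) * k2 := by ring
      _ ≤ N * k2 := by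
          refine mul_le_mul_of_nonneg_right ?_ hk20
          simp only [N]
          gcongr

/-- The mild solution map. -/
def _root_.REE.solMap (L : LinearPart 𝕜 H) (f : H → H) (g : H → EuclideanSpace ℝ (Fin d) →L[ℝ] H)
    (w : RoughPath γ d) (P : Pair H d) : Pair H d :=
  (fun t => mildConv L f g w P L.S t 0 t, fun t => g (P.1 t))

/-- By the flow property a mild increment of the solution map sees the interval `[s,t]` only. Mild
increments are therefore estimated by local convolutions. -/
theorem hatDelta_solMap (C : Coeffs L γ f g M m) (hP : Plain L w P B) (hc : Continuous P.1)
    {s t : I01} (hst : s ≤ t) :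
    (solMap L f g w P).1 t - L.S ((t : ℝ) - s) ((solMap L f g w P).1 s)
      = mildConv L f g w P L.S t s t := by
  simp only [solMap]
  rw [C.mildConv_flow hP hc le_rfl s.2.1 hst t.2.2]
  abel

/-- The Lipschitz estimate of the mild solution map, on all components of the norm. -/
theorem pointwise_solMap_sub (C : Coeffs L γ f g M m) (hηγ : η ≤ γ) (hP : Plain L w P B)
    (hc : Continuous P.1) (hP₁ : Plain L w P₁ B) (hc₁ : Continuous P₁.1)
    (hPP : Plain L w (P - P₁) E) {bf : ℝ} (hf : ∀ t, ‖f (P.1 t) - f (P₁.1 t)‖ ≤ bf) :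
    Pointwise L w η (solMap L f g w P - solMap L f g w P₁) (M ^ 2 * bf + M ^ 2 *
      (roughConst γ d * ctrlConst w M m B E * (1 + w.norm1 + w.norm2))) ∧
    ∃ K, ∀ s t : I01, s ≤ t → ‖(solMap L f g w P - solMap L f g w P₁).1 t
      - L.S ((t : ℝ) - s) ((solMap L f g w P - solMap L f g w P₁).1 s)‖ ≤ K * ((t : ℝ) - s) ^ γ := by
  have hθ := C.nonpos
  have hγ := C.pos
  have hM := C.semigroup
  have hM1 := hM.one_le
  have hctrl := C.ctrl_sub hP hP₁ hPP
  set b := ctrlConst w M m B E with hbdef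
  have hb : 0 ≤ b := hctrl.nonneg
  have hbf : 0 ≤ bf := (norm_nonneg _).trans (hf 0)
  obtain ⟨hR1, hR⟩ := C.roughConst_ge
  obtain ⟨-, -, hRc⟩ := hR b hb w
  set N := M ^ 2 * bf + M ^ 2 * (roughConst γ d * b * (1 + w.norm1 + w.norm2)) with hN
  have hρ := w.norm1_nonneg
  have hM2 : 1 ≤ M ^ 2 := one_le_pow₀ hM1
  have hbX : M ^ 2 * (b * (1 + w.norm1)) ≤ N := by
    have : 0 ≤ M ^ 2 * bf := by positivity
    have := mul_le_mul_of_nonneg_left hRc (by linarith : (0 : ℝ) ≤ M ^ 2)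
    linarith
  have hN0 : 0 ≤ N := le_trans (by positivity) hbX
  have hbN : b ≤ N := by
    refine le_trans ?_ hbX
    have : b ≤ b * (1 + w.norm1) := le_mul_of_one_le_right hb (by linarith)
    have := le_mul_of_one_le_left (by positivity : 0 ≤ b * (1 + w.norm1)) hM2
    linarith
  have hMb : M * b ≤ N := by
    refine le_trans ?_ hbX
    have : b ≤ b * (1 + w.norm1) := le_mul_of_one_le_right hb (by linarith)
    have : M * b ≤ M ^ 2 * b := mul_le_mul_of_nonneg_right (by nlinarith) hb
    nlinarith
  have hδ : ∀ s t : I01, s ≤ t → (solMap L f g w P - solMap L f g w P₁).1 t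
      - L.S ((t : ℝ) - s) ((solMap L f g w P - solMap L f g w P₁).1 s)
      = mildConv L f g w P L.S t s t - mildConv L f g w P₁ L.S t s t := fun s t hst => by
    rw [← C.hatDelta_solMap hP hc hst, ← C.hatDelta_solMap hP₁ hc₁ hst]
    simp only [Prod.fst_sub, Pi.sub_apply, map_sub]
    abel
  have hmain : ∀ s t : I01, s ≤ t → _ := fun s t hst =>
    C.mildConv_sub hP hc hP₁ hc₁ hPP hf s.2.1 (Subtype.coe_le_coe.2 hst) t.2.2
  have hsnd : (solMap L f g w P - solMap L f g w P₁).2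
    = (fun t => g (P.1 t)) - fun t => g (P₁.1 t) := rfl
  refine ⟨⟨?_, fun a => ?_, fun s t hst => ?_, fun t => ?_, fun s t hst a => ?_,
    fun s t hst => ?_⟩, N, fun s t hst => ?_⟩
  · have e1 := C.mildConv_self hP hc le_rfl zero_le_one
    have e2 := C.mildConv_self hP₁ hc₁ le_rfl zero_le_one
    have : (solMap L f g w P - solMap L f g w P₁).1 0
      = mildConv L f g w P L.S 0 0 0 - mildConv L f g w P₁ L.S 0 0 0 := rfl
    rw [this, e1, e2, sub_zero, norm_zero]
    exact hN0
  · rw [hsnd]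
    refine (hM.nrm_le _).trans ?_
    have := ContinuousLinearMap.le_of_opNorm_le _ (hctrl.bdd 0) a
    calc _ ≤ M * (b * ‖a‖) := by gcongr
      _ = M * b * ‖a‖ := by ring
      _ ≤ _ := by gcongr
  · rw [hδ s t hst]
    refine (hmain s t hst).1.trans ?_
    refine mul_le_mul_of_nonneg_left ?_ hN0
    have hts : 0 ≤ (t : ℝ) - s := sub_nonneg.2 (Subtype.coe_le_coe.2 hst)
    rcases eq_or_lt_of_le hts with h0 | h0
    · rw [← h0, Real.zero_rpow hγ.ne']; exact Real.rpow_nonneg le_rfl _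
    · exact Real.rpow_le_rpow_of_exponent_ge h0 (by linarith [t.2.2, s.2.1]) hηγ
  · rw [hsnd]
    exact (hctrl.bdd t).trans hbN
  · rw [hsnd]
    have hts : 0 ≤ (t : ℝ) - s := sub_nonneg.2 (Subtype.coe_le_coe.2 hst)
    have hts1 : (t : ℝ) - s ≤ 1 := by linarith [t.2.2, s.2.1]
    set z := (fun t => g (P.1 t)) - fun t => g (P₁.1 t)
    set z' := compDeriv g P - compDeriv g P₁
    have b1 := hctrl.rem s t hst a
    have b2 : ‖z' s (w.path t - w.path s) a‖ ≤ b * (w.norm1 * ((t : ℝ) - s) ^ γ) * ‖a‖ :=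
      ContinuousLinearMap.le_of_opNorm_le _ ((z' s).le_of_opNorm_le_of_le (hctrl.bdd' s)
        (w.norm_path_sub_le s.2.1 hst t.2.2)) a
    have b3 := hM.nrm_le (L.S ((t : ℝ) - s) (z' s (w.path t - w.path s) a))
    have b4 := hM.norm_S _ hts hts1 (z' s (w.path t - w.path s) a)
    have hk : ((t : ℝ) - s) ^ (2 * γ) ≤ ((t : ℝ) - s) ^ γ := by
      rcases eq_or_lt_of_le hts with h0 | h0
      · rw [← h0, Real.zero_rpow (by linarith), Real.zero_rpow hγ.ne']
      · exact Real.rpow_le_rpow_of_exponent_ge h0 hts1 (by linarith)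
    set k := ((t : ℝ) - s) ^ γ
    have hk0 : 0 ≤ k := Real.rpow_nonneg hts _
    -- The mild increment of `g(y)`, the derivative component here, is its remainder plus its own
    -- derivative applied to the path increment.
    have e : z t a - L.S ((t : ℝ) - s) (z s a)
        = (z t a - L.S ((t : ℝ) - s) (z s a) - L.S ((t : ℝ) - s) (z' s (w.path t - w.path s) a))
          + L.S ((t : ℝ) - s) (z' s (w.path t - w.path s) a) := by abel
    rw [e]
    calc _ ≤ b * k * ‖a‖ + M * (M * (b * (w.norm1 * k) * ‖a‖)) := by
          refine (L.nrm_add_le hθ _ _).trans (add_le_add (b1.trans (by gcongr)) (b3.trans ?_))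
          exact mul_le_mul_of_nonneg_left (b4.trans (by gcongr)) (by linarith)
      _ = (b + M ^ 2 * (b * w.norm1)) * (k * ‖a‖) := by ring
      _ ≤ N * (k * ‖a‖) := by
          refine mul_le_mul_of_nonneg_right (le_trans ?_ hbX) (by positivity)
          have := le_mul_of_one_le_left hb hM2
          linarith
      _ = _ := by ring
  · rw [hδ s t hst, hsnd]
    have := (hmain s t hst).2
    have e : ext01 ((fun t => g (P.1 t)) - fun t => g (P₁.1 t)) (s : ℝ)
      = ((fun t => g (P.1 t)) - fun t => g (P₁.1 t)) s := IccExtend_of_mem _ _ s.2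
    rw [e] at this
    exact this
  -- The exponent `γ` is recorded separately because `η` may be `0`, which would give no continuity
  -- in `H`.
  · rw [hδ s t hst]
    exact (hmain s t hst).1

theorem solMap_zero (C : Coeffs L γ f g M m) : solMap L f g w (0 : Pair H d) = 0 := by
  have hg : (fun t : I01 => g ((0 : Pair H d).1 t)) = 0 := by
    funext t; simp [C.g_flat.map_zero]
  have hf : (fun t : I01 => f ((0 : Pair H d).1 t)) = 0 := by
    funext t; simp [C.f_zero]
  have hI : ∀ t : I01, IsRoughIntegral L w (fun u => L.S ((t : ℝ) - u))
      (0 : I01 → EuclideanSpace ℝ (Fin d) →L[ℝ] H) 0 0 t 0 := fun t ε hε =>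
    ⟨1, one_pos, fun n τ _ _ _ _ => by
      simp only [IccExtend, Function.comp, Pi.zero_apply, zero_apply]
      simpa [contract, ← neg_mul, L.nrm_zero C.nonpos] using hε⟩
  refine Prod.ext (funext fun t => ?_) hg
  simp only [solMap, mildConv]
  rw [hg, hf, compDeriv_zero, (hI t).roughIntegral_eq C.nonpos t.2.1]
  simp [IccExtend]

/-- Again a comparison with the zero path. A bound for the drift difference comes from compactness
of `[0,1]`, and continuity in `H` from the mild `γ`-Hölder bound. -/
theorem memD_solMap (C : Coeffs L γ f g M m) (hηγ : η ≤ γ) (hP : Plain L w P B)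
    (hc : Continuous P.1) : MemD L η w (solMap L f g w P) := by
  have hθ := C.nonpos
  obtain ⟨K, hK⟩ : ∃ K, ∀ t, ‖f (P.1 t) - f ((0 : Pair H d).1 t)‖ ≤ K := by
    have h1 : Continuous fun t => ‖f (P.1 t) - f ((0 : Pair H d).1 t)‖ := by
      have h0 : Continuous fun t : I01 => f ((0 : Pair H d).1 t) :=
        continuous_const (y := f (0 : H))
      exact ((C.f_cont.comp hc).sub h0).norm
    obtain ⟨K, hK⟩ := (isCompact_range h1).bddAbove
    exact ⟨K, fun t => hK ⟨t, rfl⟩⟩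
  have hz : Plain L w (P - 0) B := by rwa [sub_zero]
  have h := C.pointwise_solMap_sub hηγ hP hc (C.plain_zero hP.nonneg) continuous_zero hz hK
  rw [C.solMap_zero, sub_zero] at h
  obtain ⟨h1, K', h2⟩ := h
  refine memD_of_pointwise ⟨M, C.semigroup⟩ C.pos hθ h1 (continuous_of_mild_holder C.pos h2) ?_
  have : Continuous fun t => g (P.1 t) := C.g_flat.contDiff.continuous.comp hc
  have hL : Continuous fun T : EuclideanSpace ℝ (Fin d) →L[ℝ] H => (L.emb (-2 * γ) hθ).comp T :=
    (ContinuousLinearMap.compL ℝ (EuclideanSpace ℝ (Fin d)) H (L.Hs (-2 * γ))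
      (L.emb _ hθ)).continuous
  exact hL.comp this

end Coeffs

end Mild

/-! ## Radius functions -/

namespace IsRadiusConst

variable {h k : ℝ → ℝ}

theorem nonneg (hh : IsRadiusConst h) {r : ℝ} (hr : 0 ≤ r) : 0 ≤ h r := by
  rw [← hh.zero]
  exact hh.mono.monotoneOn (mem_Ici.2 le_rfl) hr hr

theorem add (hh : IsRadiusConst h) (hk : IsRadiusConst k) : IsRadiusConst fun r => h r + k r :=
  ⟨hh.cont.add hk.cont, fun _ ha _ hb hab => add_lt_add (hh.mono ha hb hab) (hk.mono ha hb hab),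
    by simp [hh.zero, hk.zero], hh.top.atTop_add_atTop hk.top⟩

theorem const_mul (hh : IsRadiusConst h) {c : ℝ} (hc : 0 < c) : IsRadiusConst fun r => c * h r :=
  ⟨hh.cont.const_mul c, fun _ ha _ hb hab => mul_lt_mul_of_pos_left (hh.mono ha hb hab) hc,
    by simp [hh.zero], hh.top.const_mul_atTop hc⟩

theorem comp_mul (hh : IsRadiusConst h) {c : ℝ} (hc : 0 < c) : IsRadiusConst fun r => h (c * r) := by
  have hm : ∀ r ∈ Ici (0 : ℝ), c * r ∈ Ici (0 : ℝ) := fun r hr => mul_nonneg hc.le hr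
  exact ⟨hh.cont.comp (by fun_prop) hm, fun a ha b hb hab =>
    hh.mono (hm a ha) (hm b hb) (mul_lt_mul_of_pos_left hab hc), by simp [hh.zero],
    hh.top.comp (tendsto_id.const_mul_atTop hc)⟩

theorem id : IsRadiusConst fun r => r :=
  ⟨continuousOn_id, fun _ _ _ _ h => h, rfl, tendsto_id⟩

theorem exists_unique_root (hh : IsRadiusConst h) {K : ℝ} (hK : 0 < K) :
    ∃ r₀, ∀ r, (0 < r ∧ h r = K) ↔ r = r₀ := by
  obtain ⟨b, hb⟩ := ((hh.top.eventually_ge_atTop K).and (eventually_ge_atTop 0)).exists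
  obtain ⟨r₀, hr₀, he⟩ := intermediate_value_Icc hb.2
    (hh.cont.mono fun x hx => hx.1) ⟨by rw [hh.zero]; exact hK.le, hb.1⟩
  have h0 : 0 < r₀ := by
    refine lt_of_le_of_ne hr₀.1 fun h => ?_
    rw [← h, hh.zero] at he
    exact hK.ne he
  refine ⟨r₀, fun r => ⟨fun hr => ?_, ?_⟩⟩
  · exact hh.mono.injOn hr.1.le h0.le (hr.2.trans he.symm)
  · rintro rfl
    exact ⟨h0, he⟩

end IsRadiusConst

/-- A bounded monotone modulus that tends to zero at zero has a majorant that is continuous and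
strictly increasing. -/
theorem exists_isRadiusConst_ge {ω : ℝ → ℝ} (hmono : Monotone ω) (h0 : ∀ r, 0 ≤ ω r)
    (hlim : ∀ ε : ℝ, 0 < ε → ∃ δ : ℝ, 0 < δ ∧ ω δ ≤ ε) :
    ∃ h, IsRadiusConst h ∧ ∀ r, 0 < r → ω r ≤ h r := by
  have hint : ∀ a b : ℝ, IntervalIntegrable ω MeasureTheory.volume a b := fun a b =>
    hmono.intervalIntegrable
  -- The average of `ω` over `[r, 2r]`: continuous even where `ω` jumps, monotone, and between
  -- `ω(r)` and `ω(2r)`.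
  set k : ℝ → ℝ := fun r => r⁻¹ * ∫ u in r..2 * r, ω u with hk
  have hk1 : ∀ r, 0 < r → k r = ∫ t in (1 : ℝ)..2, ω (r * t) := fun r hr => by
    rw [intervalIntegral.integral_comp_mul_left _ hr.ne', smul_eq_mul, mul_one, mul_comm r 2]
  have hmr : ∀ r, 0 < r → Monotone fun t => ω (r * t) := fun r hr a b hab =>
    hmono (mul_le_mul_of_nonneg_left hab hr.le)
  have hge : ∀ r, 0 < r → ω r ≤ k r := fun r hr => by
    rw [hk1 r hr]
    have : (∫ _ in (1 : ℝ)..2, ω r) ≤ ∫ t in (1 : ℝ)..2, ω (r * t) :=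
      intervalIntegral.integral_mono_on one_le_two (by simp) (hmr r hr).intervalIntegrable
        fun t ht => hmono (le_mul_of_one_le_right hr.le ht.1)
    simp only [intervalIntegral.integral_const, smul_eq_mul] at this
    linarith
  have hle : ∀ r, 0 < r → k r ≤ ω (2 * r) := fun r hr => by
    rw [hk1 r hr]
    have : (∫ t in (1 : ℝ)..2, ω (r * t)) ≤ ∫ _ in (1 : ℝ)..2, ω (2 * r) :=
      intervalIntegral.integral_mono_on one_le_two (hmr r hr).intervalIntegrable (by simp)
        fun t ht => hmono (by rw [mul_comm]; exact mul_le_mul_of_nonneg_right ht.2 hr.le)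
    simp only [intervalIntegral.integral_const, smul_eq_mul] at this
    linarith
  have hk0 : k 0 = 0 := by simp [hk]
  have hkn : ∀ r, 0 ≤ r → 0 ≤ k r := fun r hr => by
    rcases hr.eq_or_lt with rfl | hr
    · exact hk0.ge
    · exact (h0 r).trans (hge r hr)
  have hkm : MonotoneOn k (Ici 0) := fun a ha b hb hab => by
    rcases (mem_Ici.1 ha).eq_or_lt with rfl | ha
    · rw [hk0]; exact hkn b hb
    · have hb := ha.trans_le hab
      rw [hk1 a ha, hk1 b hb]
      exact intervalIntegral.integral_mono_on one_le_two (hmr a ha).intervalIntegrable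
        (hmr b hb).intervalIntegrable fun t ht =>
          hmono (mul_le_mul_of_nonneg_right hab (by linarith [ht.1]))
  have hkc : ContinuousOn k (Ici 0) := by
    intro r hr
    rcases (mem_Ici.1 hr).eq_or_lt with rfl | hr
    · rw [ContinuousWithinAt, hk0, Metric.tendsto_nhds]
      intro ε hε
      obtain ⟨δ, hδ, hωδ⟩ := hlim (ε / 2) (by linarith)
      have h1 : ∀ᶠ r in 𝓝[Ici 0] (0 : ℝ), r < δ / 2 :=
        nhdsWithin_le_nhds (gt_mem_nhds (by linarith))
      filter_upwards [h1, self_mem_nhdsWithin] with r hr hr0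
      rw [Real.dist_0_eq_abs, abs_of_nonneg (hkn r hr0)]
      rcases (mem_Ici.1 hr0).eq_or_lt with rfl | hr0
      · rwa [hk0]
      · have := hmono (show 2 * r ≤ δ by linarith)
        linarith [hle r hr0]
    · refine ContinuousAt.continuousWithinAt ((continuousAt_inv₀ hr.ne').mul ?_)
      have hc : Continuous fun r => ∫ u in (0 : ℝ)..r, ω u :=
        intervalIntegral.continuous_primitive hint 0
      have : (fun r => ∫ u in r..2 * r, ω u)
          = fun r => (∫ u in (0 : ℝ)..2 * r, ω u) - ∫ u in (0 : ℝ)..r, ω u := by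
        funext r
        rw [intervalIntegral.integral_interval_sub_left (hint _ _) (hint _ _)]
      rw [this]
      exact ((hc.comp (continuous_const.mul continuous_id)).sub hc).continuousAt
  -- Adding `r` makes the majorant strictly increasing and unbounded.
  refine ⟨fun r => r + k r, ⟨continuousOn_id.add hkc, fun a ha b hb hab => ?_, by simp [hk0], ?_⟩,
    fun r hr => by linarith [hge r hr]⟩
  · exact add_lt_add_of_lt_of_le hab (hkm ha hb hab.le)
  · refine tendsto_atTop_mono' atTop ?_ tendsto_id
    filter_upwards [eventually_ge_atTop 0] with r hr
    simpa using hkn r hr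

/-- A `C¹` map with bounded derivative that vanishes at the origin is Lipschitz on balls, with a
constant that vanishes with the radius. -/
theorem exists_isRadiusConst_lipschitz {V W : Type*} [NormedAddCommGroup V] [NormedSpace ℝ V]
    [NormedAddCommGroup W] [NormedSpace ℝ W] {f : V → W} (hf : ContDiff ℝ 1 f)
    (hb : ∃ M : ℝ, ∀ x, ‖fderiv ℝ f x‖ ≤ M) (h0 : fderiv ℝ f 0 = 0) :
    ∃ h, IsRadiusConst h ∧ ∀ r, 0 < r → ∀ x y, ‖x‖ ≤ r → ‖y‖ ≤ r →
      ‖f x - f y‖ ≤ h r * ‖x - y‖ := by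
  obtain ⟨M, hM⟩ := hb
  set ω : ℝ → ℝ := fun r => sSup ((fun x => ‖fderiv ℝ f x‖) '' Metric.closedBall 0 r) with hω
  have hbdd : ∀ r, BddAbove ((fun x => ‖fderiv ℝ f x‖) '' Metric.closedBall (0 : V) r) := fun r =>
    ⟨M, by rintro _ ⟨x, -, rfl⟩; exact hM x⟩
  have hle : ∀ r (x : V), ‖x‖ ≤ r → ‖fderiv ℝ f x‖ ≤ ω r := fun r x hx =>
    le_csSup (hbdd r) ⟨x, by simpa using hx, rfl⟩
  have hn : ∀ r, 0 ≤ ω r := fun r => Real.sSup_nonneg (by rintro _ ⟨x, -, rfl⟩; exact norm_nonneg _)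
  have hmono : Monotone ω := fun a b hab => Real.sSup_le
    (by rintro _ ⟨x, hx, rfl⟩; exact hle b x ((by simpa using hx : ‖x‖ ≤ a).trans hab)) (hn b)
  obtain ⟨h, hh, hge⟩ := exists_isRadiusConst_ge hmono hn fun ε hε => by
    have hc : Continuous (fderiv ℝ f) := hf.continuous_fderiv one_ne_zero
    obtain ⟨δ, hδ, h1⟩ := Metric.continuous_iff.1 hc 0 ε hε
    refine ⟨δ / 2, by linarith, Real.sSup_le ?_ hε.le⟩
    rintro _ ⟨x, hx, rfl⟩
    have hx : ‖x‖ ≤ δ / 2 := by simpa using hx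
    have := h1 x (by rw [dist_zero_right]; linarith)
    rw [h0, dist_zero_right] at this
    exact this.le
  refine ⟨h, hh, fun r hr x y hx hy => ?_⟩
  have := (convex_closedBall (0 : V) r).norm_image_sub_le_of_norm_fderiv_le (𝕜 := ℝ) (f := f)
    (C := ω r) (fun z _ => hf.differentiable one_ne_zero z)
    (fun z hz => hle r z (by simpa using hz)) (x := y) (y := x) (by simpa using hy)
    (by simpa using hx)
  exact this.trans (mul_le_mul_of_nonneg_right (hge r hr) (norm_nonneg _))

/-- `φ` is Lipschitz on the compact interval `[0,1]` and constant beyond it, so its argument may be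
replaced by `min a 1`. -/
theorem IsCutoff.exists_lipschitz {φ : ℝ → ℝ} (hφ : IsCutoff φ) :
    ∃ l : ℝ, 0 ≤ l ∧ ∀ a b, 0 ≤ a → 0 ≤ b → |φ a - φ b| ≤ l * |a - b| := by
  have hc : ContDiffOn ℝ 3 φ (Icc 0 1) := hφ.contDiff.mono fun x hx => hx.1
  obtain ⟨K, hK⟩ := hc.exists_lipschitzOnWith (by norm_num) (convex_Icc 0 1) isCompact_Icc
  have hmin : ∀ a : ℝ, φ a = φ (min a 1) := fun a => by
    rcases le_total a 1 with h | h
    · rw [min_eq_left h]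
    · rw [min_eq_right h, hφ.eq_zero a h, hφ.eq_zero 1 le_rfl]
  refine ⟨K, K.2, fun a b ha hb => ?_⟩
  rw [hmin a, hmin b]
  have h1 := hK.dist_le_mul (min a 1) ⟨le_min ha zero_le_one, min_le_right _ _⟩ (min b 1)
    ⟨le_min hb zero_le_one, min_le_right _ _⟩
  rw [Real.dist_eq, Real.dist_eq] at h1
  refine h1.trans (mul_le_mul_of_nonneg_left ?_ K.2)
  have := abs_min_sub_min_le_max a 1 b 1
  simpa using this

/-! ## The truncated solution map -/

section Truncation

variable {𝕜 H : Type*} [RCLike 𝕜] [NormedAddCommGroup H] [InnerProductSpace 𝕜 H]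
  [CompleteSpace H] [NormedSpace ℝ H] [IsScalarTower ℝ 𝕜 H] {d : ℕ}
  {γ : ℝ} {w : RoughPath γ d} {D : Data 𝕜 H d} {p q : Pair H d} {R : ℝ}

theorem memD_χ (hM : ∃ M, D.L.SemigroupBounds γ M) (hγ : 0 < γ) (hp : MemD D.L D.η w p) :
    MemD D.L D.η w (D.χ w R p) := hp.smul hM hγ _

theorem normD_χ_le (hγ : 0 < γ) (hφ : IsCutoff D.φ) (hR : 0 < R) :
    normD D.L D.η w (D.χ w R p) ≤ R := by
  have hθ : -2 * γ ≤ 0 := by linarith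
  have hN := normD_nonneg (L := D.L) (w := w) (η := D.η) hθ p
  have h1 := hφ.mem_Icc _ (div_nonneg hN hR.le)
  rw [Data.χ, normD_smul hθ, abs_of_nonneg h1.1]
  rcases le_total (normD D.L D.η w p) R with h | h
  · calc _ ≤ 1 * R := mul_le_mul h1.2 h hN zero_le_one
      _ = R := one_mul R
  · rw [hφ.eq_zero _ ((one_le_div hR).2 h), zero_mul]
    exact hR.le

/-- `φ(a) p - φ(b) q` is `φ(a)(p - q) + (φ(a) - φ(b)) q`. The factor `l / R` of the second term is
compensated by `‖q‖ ≤ R`, so the constant does not depend on `R`. By symmetry one of the norms may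
be assumed at most `R`; otherwise both truncations vanish. -/
theorem normD_χ_sub_le (hM : ∃ M, D.L.SemigroupBounds γ M) (hγ : 0 < γ) (hφ : IsCutoff D.φ)
    {l : ℝ} (hl0 : 0 ≤ l) (hl : ∀ a b, 0 ≤ a → 0 ≤ b → |D.φ a - D.φ b| ≤ l * |a - b|) (hR : 0 < R)
    (hp : MemD D.L D.η w p) (hq : MemD D.L D.η w q) :
    normD D.L D.η w (D.χ w R p - D.χ w R q) ≤ (1 + l) * normD D.L D.η w (p - q) := by
  have hθ : -2 * γ ≤ 0 := by linarith
  have hnn : ∀ p : Pair H d, 0 ≤ normD D.L D.η w p := normD_nonneg hθ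
  have key : ∀ p q : Pair H d, MemD D.L D.η w p → MemD D.L D.η w q → normD D.L D.η w q ≤ R →
      normD D.L D.η w (D.χ w R p - D.χ w R q) ≤ (1 + l) * normD D.L D.η w (p - q) := by
    intro p q hp hq hqR
    have hpq := hp.sub hM hγ hq
    have htri : |normD D.L D.η w p - normD D.L D.η w q| ≤ normD D.L D.η w (p - q) := by
      have a1 := hpq.normD_add_le hγ.le hq
      have a2 := hp.normD_sub_le hM hγ hpq
      rw [sub_add_cancel] at a1
      rw [sub_sub_cancel] at a2
      exact abs_le.2 ⟨by linarith, by linarith⟩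
    have hc := hφ.mem_Icc _ (div_nonneg (hnn p) hR.le)
    have hcc := hl _ _ (div_nonneg (hnn p) hR.le) (div_nonneg (hnn q) hR.le)
    rw [← sub_div, abs_div, abs_of_pos hR] at hcc
    have e : D.χ w R p - D.χ w R q = D.φ (normD D.L D.η w p / R) • (p - q)
        + (D.φ (normD D.L D.η w p / R) - D.φ (normD D.L D.η w q / R)) • q := by
      simp only [Data.χ, smul_sub, sub_smul]; abel
    rw [e]
    refine ((hpq.smul hM hγ _).normD_add_le hγ.le (hq.smul hM hγ _)).trans ?_
    rw [normD_smul hθ, normD_smul hθ, abs_of_nonneg hc.1]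
    have b1 := mul_le_mul_of_nonneg_right hc.2 (hnn (p - q))
    have b2 : |D.φ (normD D.L D.η w p / R) - D.φ (normD D.L D.η w q / R)| * normD D.L D.η w q
        ≤ l * (normD D.L D.η w (p - q) / R) * R := by
      refine mul_le_mul (hcc.trans ?_) hqR (hnn q) ?_
      · exact mul_le_mul_of_nonneg_left (div_le_div_of_nonneg_right htri hR.le) hl0
      · exact mul_nonneg hl0 (div_nonneg (hnn _) hR.le)
    rw [mul_assoc, div_mul_cancel₀ _ hR.ne'] at b2
    linarith
  rcases le_total (normD D.L D.η w q) R with h | h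
  · exact key p q hp hq h
  rcases le_total (normD D.L D.η w p) R with h' | h'
  · have := key q p hq hp h'
    rwa [← neg_sub, normD_neg hθ, ← neg_sub q p, normD_neg hθ]
  · rw [Data.χ, Data.χ, hφ.eq_zero _ ((one_le_div hR).2 h), hφ.eq_zero _ ((one_le_div hR).2 h'),
      zero_smul, zero_smul, sub_zero, normD_zero hθ]
    exact mul_nonneg (by linarith) (hnn _)

theorem TR_eq_solMap (w : RoughPath γ d) (R : ℝ) (p : Pair H d) :
    D.TR w R p = solMap D.L D.f D.g w (D.χ w R p) := rfl

variable {M m l : ℝ} {h : ℝ → ℝ}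

theorem memD_TR (C : Coeffs D.L γ D.f D.g M m) (hη : 0 ≤ D.η) (hηγ : D.η ≤ γ)
    (hp : MemD D.L D.η w p) : MemD D.L D.η w (D.TR w R p) := by
  have hM : ∃ M, D.L.SemigroupBounds γ M := ⟨M, C.semigroup⟩
  have hχ := memD_χ (R := R) hM C.pos hp
  exact C.memD_solMap hηγ ((hχ.pointwise C.pos.le).plain C.semigroup C.pos hη) hχ.cont

/-- The truncated paths stay in the ball of radius `2MR` of `H`, which gives the drift constant
`h(2MR)`. For the noise, `B = 4M²(1+|w|_γ)R` and `E` has the analogous form, so `m B² E` carries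
`R²` and `(1+|w|_γ)³`; the composition estimate adds one more such factor. Two of the four go into
`C_g`. For `R ≤ 1`, `R²` is replaced by `R`, and the summand `1` keeps the coefficient positive even
if `m = 0`. -/
theorem normD_TR_sub_le (C : Coeffs D.L γ D.f D.g M m) (hη : 0 ≤ D.η) (hηγ : D.η ≤ γ)
    (hφ : IsCutoff D.φ) (hl0 : 0 ≤ l)
    (hl : ∀ a b, 0 ≤ a → 0 ≤ b → |D.φ a - D.φ b| ≤ l * |a - b|) (hh : IsRadiusConst h)
    (hf : ∀ r, 0 < r → ∀ x y, ‖x‖ ≤ r → ‖y‖ ≤ r → ‖D.f x - D.f y‖ ≤ h r * ‖x - y‖)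
    (hR : 0 < R) (hR1 : R ≤ 1) (hp : MemD D.L D.η w p) (hq : MemD D.L D.η w q) :
    normD D.L D.η w (D.TR w R p - D.TR w R q) ≤
      (12 * M ^ 3 * (1 + l) * h (2 * M * R)
        + (6 * M ^ 2 * Coeffs.roughConst γ d * (9 * M * m) * (64 * M ^ 6) * (1 + l) + 1)
          * (1 + w.norm1) ^ 2 * R * (1 + w.norm1 + w.norm2) * (1 + w.norm1) ^ 2)
      * normD D.L D.η w (p - q) := by
  have hM := C.semigroup
  have hM' : ∃ M, D.L.SemigroupBounds γ M := ⟨M, hM⟩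
  have hM1 := hM.one_le
  have hγ := C.pos
  have hθ := C.nonpos
  have hχp := memD_χ (R := R) hM' hγ hp
  have hχq := memD_χ (R := R) hM' hγ hq
  have wp := (hχp.pointwise hγ.le).mono (normD_χ_le hγ hφ hR)
  have wq := (hχq.pointwise hγ.le).mono (normD_χ_le hγ hφ hR)
  have wpq := ((hχp.sub hM' hγ hχq).pointwise hγ.le).mono
    (normD_χ_sub_le hM' hγ hφ hl0 hl hR hp hq)
  set ε := normD D.L D.η w (p - q) with hε
  have hε0 : 0 ≤ ε := normD_nonneg hθ _
  have hρ := w.norm1_nonneg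
  have hσ := w.norm2_nonneg
  have hr : 0 < 2 * M * R := by positivity
  have hh0 := hh.nonneg hr.le
  have hbf : ∀ t, ‖D.f ((D.χ w R p).1 t) - D.f ((D.χ w R q).1 t)‖
      ≤ h (2 * M * R) * (2 * M * ((1 + l) * ε)) := fun t =>
    (hf _ hr _ _ (wp.norm_le hM hη t) (wq.norm_le hM hη t)).trans
      (mul_le_mul_of_nonneg_left (wpq.norm_le hM hη t) hh0)
  have main := (C.pointwise_solMap_sub hηγ (wp.plain hM hγ hη) hχp.cont (wq.plain hM hγ hη)
    hχq.cont (wpq.plain hM hγ hη) hbf).1.normD_le hθ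
  rw [TR_eq_solMap, TR_eq_solMap]
  refine main.trans ?_
  have hm := C.g_flat.nonneg
  have hr1 : (1 : ℝ) ≤ Coeffs.roughConst γ d := C.roughConst_ge.1
  have hR2 : R ^ 2 ≤ R := by nlinarith
  rw [Coeffs.ctrlConst]
  set X := 6 * M ^ 2 * Coeffs.roughConst γ d * (9 * M * m) * (64 * M ^ 6) * (1 + l) with hX
  have hX0 : 0 ≤ X := by positivity
  have hY : X * R ^ 2 * ((1 + w.norm1) ^ 2 * (1 + w.norm1 + w.norm2) * (1 + w.norm1) ^ 2 * ε)
      ≤ (X + 1) * R * ((1 + w.norm1) ^ 2 * (1 + w.norm1 + w.norm2) * (1 + w.norm1) ^ 2 * ε) := by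
    gcongr
    linarith
  calc _ = 12 * M ^ 3 * (1 + l) * h (2 * M * R) * ε
        + X * R ^ 2 * ((1 + w.norm1) ^ 2 * (1 + w.norm1 + w.norm2) * (1 + w.norm1) ^ 2 * ε) := by
        rw [hX]; ring
    _ ≤ 12 * M ^ 3 * (1 + l) * h (2 * M * R) * ε
        + (X + 1) * R * ((1 + w.norm1) ^ 2 * (1 + w.norm1 + w.norm2) * (1 + w.norm1) ^ 2 * ε) := by
        linarith
    _ = _ := by ring

end Truncation

/-- The Lipschitz constants of the truncated solution map. -/
theorem exists_lipschitz_constants {𝕜 H : Type*} [RCLike 𝕜] [NormedAddCommGroup H]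
    [InnerProductSpace 𝕜 H] [CompleteSpace H] [NormedSpace ℝ H] [IsScalarTower ℝ 𝕜 H] (d : ℕ)
    (L : LinearPart 𝕜 H) (γ η : ℝ) (hγ : 1 / 3 < γ) (hγ' : γ ≤ 1 / 2)
    (hη : 0 ≤ η) (hηγ : η < γ) (φ : ℝ → ℝ) (hφ : IsCutoff φ) :
    ∃ (Cf : (H → H) → ℝ → ℝ → ℝ)
      (Cg : (H → EuclideanSpace ℝ (Fin d) →L[ℝ] H) → ℝ → ℝ → ℝ),
      (∀ f, IsDrift L γ f → ∀ ρ, 0 ≤ ρ → IsRadiusConst (Cf f ρ)) ∧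
      (∀ g, IsDiffusion L γ g → ∀ ρ, 0 ≤ ρ → IsRadiusConst (Cg g ρ)) ∧
      ∀ (f : H → H) (g : H → EuclideanSpace ℝ (Fin d) →L[ℝ] H),
        IsDrift L γ f → IsDiffusion L γ g →
        (∃ M m, Coeffs L γ f g M m) ∧
        ∀ (w : RoughPath γ d) (R : ℝ), 0 < R → R ≤ 1 →
          ∀ p q : Pair H d, MemD L η w p → MemD L η w q →
            normD L η w ((⟨L, η, φ, f, g⟩ : Data 𝕜 H d).TR w R p
                - (⟨L, η, φ, f, g⟩ : Data 𝕜 H d).TR w R q)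
              ≤ cutoffBound (Cf f) (Cg g) w R * normD L η w (p - q) := by
  have hγ0 : 0 < γ := by linarith
  have hθ : -2 * γ ≤ 0 := by linarith
  obtain ⟨M, hM⟩ := L.exists_semigroupBounds hγ0 hγ'
  have hM1 := hM.one_le
  obtain ⟨l, hl0, hl⟩ := hφ.exists_lipschitz
  -- A modulus is chosen for every `f` on its own, and below a constant for every `g`, so that
  -- neither depends on the other. The values at maps that are not admissible are irrelevant.
  have hF : ∀ f : H → H, ∃ h, IsDrift L γ f → IsRadiusConst h ∧ ∀ r, 0 < r → ∀ x y, ‖x‖ ≤ r →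
      ‖y‖ ≤ r → ‖f x - f y‖ ≤ h r * ‖x - y‖ := fun f => by
    by_cases hf : IsDrift L γ f
    · obtain ⟨h1, h2⟩ := hf.exists_contDiff hγ0.le
      obtain ⟨h, hh⟩ := exists_isRadiusConst_lipschitz h1 h2 hf.fderiv_zero
      exact ⟨h, fun _ => hh⟩
    · exact ⟨0, fun h => absurd h hf⟩
  have hG : ∀ g : H → EuclideanSpace ℝ (Fin d) →L[ℝ] H, ∃ m : ℝ, IsDiffusion L γ g →
      FlatCubic g m ∧
      ∃ G : L.Hs (-2 * γ) → EuclideanSpace ℝ (Fin d) →L[ℝ] L.Hs (-2 * γ), FlatCubic G m ∧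
        ∀ x, G (L.emb _ hθ x) = (L.emb _ hθ).comp (g x) := fun g => by
    by_cases hg : IsDiffusion L γ g
    · obtain ⟨m, h⟩ := hg.exists_flatCubic hγ0.le hθ
      exact ⟨m, fun _ => h⟩
    · exact ⟨0, fun h => absurd h hg⟩
  choose h hh using hF
  choose m hm using hG
  set X : ℝ → ℝ := fun m =>
    6 * M ^ 2 * Coeffs.roughConst γ d * (9 * M * m) * (64 * M ^ 6) * (1 + l) + 1 with hX
  refine ⟨fun f _ R => 12 * M ^ 3 * (1 + l) * h f (2 * M * R),
    fun g ρ R => X (m g) * (1 + ρ) ^ 2 * R, fun f hf ρ _ => ?_, fun g hg ρ hρ => ?_,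
    fun f g hf hg => ?_⟩
  · exact ((hh f hf).1.comp_mul (by linarith)).const_mul (by positivity)
  · refine IsRadiusConst.id.const_mul ?_
    have h1 := (hm g hg).1.nonneg
    have h2 := singConst_pos hγ
    have h3 := sewConst_pos (a := 3 * γ) (by linarith)
    have h4 : 0 ≤ Coeffs.roughConst γ d := by
      rw [Coeffs.roughConst]; positivity
    have : 0 < X (m g) := by rw [hX]; positivity
    positivity
  · have C : Coeffs L γ f g M (m g) := ⟨hγ, hγ', hM, (hf.exists_contDiff hγ0.le).1.continuous,
      hf.map_zero, (hm g hg).1, hθ, (hm g hg).2⟩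
    refine ⟨⟨M, m g, C⟩, fun w R hR hR1 p q hp hq => ?_⟩
    exact normD_TR_sub_le (D := ⟨L, η, φ, f, g⟩) C hη hηγ.le hφ hl0 hl (hh f hf).1 (hh f hf).2
      hR hR1 hp hq

theorem isRadiusConst_cutoffBound {Cf Cg : ℝ → ℝ → ℝ} {γ : ℝ} {d : ℕ}
    (hf : ∀ ρ, 0 ≤ ρ → IsRadiusConst (Cf ρ)) (hg : ∀ ρ, 0 ≤ ρ → IsRadiusConst (Cg ρ))
    (w : RoughPath γ d) : IsRadiusConst (cutoffBound Cf Cg w) := by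
  have h1 := w.norm1_nonneg
  have h2 := w.norm2_nonneg
  have := (hf _ h1).add ((hg _ h1).const_mul
    (c := (1 + w.norm1 + w.norm2) * (1 + w.norm1) ^ 2) (by positivity))
  convert this using 2 with r
  rw [cutoffBound]; ring

/-! ## The Lyapunov–Perron map -/

section LyapunovPerron

variable {𝕜 H : Type*} [RCLike 𝕜] [NormedAddCommGroup H] [InnerProductSpace 𝕜 H]

namespace LinearPart

variable (L : LinearPart 𝕜 H)

theorem δ_pos : 0 < L.δ := by
  have := L.β_lt_α
  rw [LinearPart.δ]; linarith

theorem α_sub_δ_pos : 0 < L.α - L.δ := by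
  have := L.β_lt_α
  have := L.β_pos
  rw [LinearPart.δ]; linarith

/-- The choice of `δ` balances the two rates, so the stable and unstable sums share the ratio
`e^{-(α-δ)}`. -/
theorem β_add_δ : L.β + L.δ = L.α - L.δ := by
  rw [LinearPart.δ]; ring

theorem exp_gap_lt_one : Real.exp (-(L.α - L.δ)) < 1 :=
  Real.exp_lt_one_iff.2 (neg_lt_zero.2 L.α_sub_δ_pos)

/-- The constant of the discrete Lyapunov–Perron estimate. -/
def perronConst : ℝ :=
  (Real.exp (-L.δ) + Real.exp (-L.δ) * Real.exp (-(L.α - L.δ))) / (1 - Real.exp (-(L.α - L.δ)))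

/-- The gap condition controls the constant of the Lyapunov–Perron estimate. -/
theorem gap_le {K C : ℝ} (hK : 0 < K) (hC : 1 ≤ C) (h : GapCondition L K C) :
    K + K * L.perronConst ≤ 1 / 2 := by
  rw [GapCondition, L.β_add_δ] at h
  refine le_trans ?_ h
  have hu := L.exp_gap_lt_one
  have hv : Real.exp (-L.δ) ≤ 1 := Real.exp_le_one_iff.2 (neg_nonpos.2 L.δ_pos.le)
  have he : Real.exp (L.α - L.δ) = (Real.exp (-(L.α - L.δ)))⁻¹ := by rw [Real.exp_neg, inv_inv]
  rw [perronConst, he]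
  set u := Real.exp (-(L.α - L.δ))
  set v := Real.exp (-L.δ)
  have hu0 : 0 < u := Real.exp_pos _
  have hv0 : 0 < v := Real.exp_pos _
  have h1 : 0 < 1 - u := by linarith
  -- In the variables `u` and `v` the second fraction of the gap condition collapses to `u C v + 1`.
  -- The summand `1` pays for the local term `K`.
  have e : (u - 1) * (C * v + u⁻¹) / (1 - u⁻¹) = u * (C * v) + 1 := by
    have h2 : 1 - u⁻¹ ≠ 0 := by
      intro h
      have := sub_eq_zero.1 h
      have := (inv_eq_one.1 this.symm)
      linarith
    have h3 : u - 1 ≠ 0 := by linarith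
    rw [div_eq_iff h2]
    field_simp
  rw [e, show K + K * ((v + v * u) / (1 - u)) = K * (1 + (v + v * u) / (1 - u)) by ring]
  refine mul_le_mul_of_nonneg_left ?_ hK.le
  have hCv : v ≤ C * v := le_mul_of_one_le_left hv0.le hC
  -- The first fraction alone dominates the geometric constant, since `v u + v u² ≤ v + 1` and `v ≤
  -- C v`.
  have h2 : (v + v * u) / (1 - u) ≤ u⁻¹ * (C * v + 1) / (1 - u) := by
    refine div_le_div_of_nonneg_right ?_ h1.le
    rw [inv_mul_eq_div, le_div_iff₀ hu0]
    have a1 : v * u ≤ v := mul_le_of_le_one_right hv0.le hu.le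
    have a2 : v * u * u ≤ 1 := by
      have := mul_le_of_le_one_right (by positivity : 0 ≤ v * u) hu.le
      linarith
    nlinarith
  have h3 : 0 ≤ u * (C * v) := by positivity
  linarith

section Sequences

variable [CompleteSpace H] [NormedSpace ℝ H] [IsScalarTower ℝ 𝕜 H] {y z : ℕ → H} {B : ℝ}

/-- The decay `e^{-βm}` of the stable semigroup and the weight `e^{-δm}` of the sequence combine to
the ratio `e^{-(β+δ)} = e^{-(α-δ)}`. -/
theorem norm_Ss_seq_le (hy : ∀ m : ℕ, ‖y m‖ ≤ B * Real.exp (-L.δ * (m + 1))) (n m : ℕ) :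
    ‖L.Ss m (y (n + 1 + m))‖
      ≤ B * Real.exp (-L.δ * (n + 1)) * Real.exp (-L.δ) * Real.exp (-(L.α - L.δ)) ^ m := by
  refine (L.norm_Ss_le (Nat.cast_nonneg m) _).trans ?_
  refine (mul_le_mul_of_nonneg_left (hy _) (Real.exp_nonneg _)).trans (le_of_eq ?_)
  rw [← Real.exp_nat_mul, mul_left_comm, ← Real.exp_add, mul_assoc, mul_assoc, ← Real.exp_add,
    ← Real.exp_add, ← L.β_add_δ]
  push_cast
  congr 2
  ring

theorem summable_Ss_seq (hy : ∀ m : ℕ, ‖y m‖ ≤ B * Real.exp (-L.δ * (m + 1))) (n : ℕ) :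
    Summable fun m : ℕ => L.Ss m (y (n + 1 + m)) :=
  Summable.of_norm_bounded ((summable_geometric_of_lt_one (Real.exp_nonneg _)
    L.exp_gap_lt_one).mul_left _) (L.norm_Ss_seq_le hy n)

/-- The initial values of the Lyapunov–Perron map on the unit intervals. -/
def perronInit (L : LinearPart 𝕜 H) (ξ : H) (y : ℕ → H) (n : ℕ) : H :=
  L.Su (-((n : ℝ) + 1)) ξ - ∑ m ∈ Finset.range (n + 1), L.Su ((m : ℝ) - (n + 1)) (y m)
    + ∑' m : ℕ, L.Ss m (y (n + 1 + m))

theorem perronInit_sub {B' : ℝ} (hy : ∀ m : ℕ, ‖y m‖ ≤ B * Real.exp (-L.δ * (m + 1)))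
    (hz : ∀ m : ℕ, ‖z m‖ ≤ B' * Real.exp (-L.δ * (m + 1))) (ξ ζ : H) (n : ℕ) :
    L.perronInit (ξ - ζ) (fun m => y m - z m) n = L.perronInit ξ y n - L.perronInit ζ z n := by
  simp only [perronInit, map_sub, Finset.sum_sub_distrib]
  rw [(L.summable_Ss_seq hy n).tsum_sub (L.summable_Ss_seq hz n)]
  abel

/-- After weighting, the term of `ξ` keeps the factor `e^{-(α-δ)(n+1)} ≤ 1`, the unstable terms form
`e^{-δ} u ∑ u^{n-m}`, and the stable ones `e^{-δ} ∑ u^m`. The two geometric sums add up to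
`perronConst`. -/
theorem norm_perronInit_le (hy : ∀ m : ℕ, ‖y m‖ ≤ B * Real.exp (-L.δ * (m + 1))) (ξ : H) (n : ℕ) :
    Real.exp (L.δ * (n + 1)) * ‖L.perronInit ξ y n‖ ≤ ‖ξ‖ + B * L.perronConst := by
  have hB : 0 ≤ B := by
    have := (norm_nonneg _).trans (hy 0)
    exact nonneg_of_mul_nonneg_left this (Real.exp_pos _)
  set u := Real.exp (-(L.α - L.δ)) with hu
  set E := Real.exp (L.δ * (n + 1)) with hE
  have hE0 : 0 < E := Real.exp_pos _
  have hu0 : 0 ≤ u := Real.exp_nonneg _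
  have hgeo : HasSum (fun m : ℕ => u ^ m) (1 - u)⁻¹ := hasSum_geometric_of_lt_one hu0 L.exp_gap_lt_one
  have b1 : E * ‖L.Su (-((n : ℝ) + 1)) ξ‖ ≤ ‖ξ‖ := by
    have h1 := L.norm_Su_le (t := -((n : ℝ) + 1)) (by
      have : (0 : ℝ) ≤ n := Nat.cast_nonneg n
      linarith) ξ
    calc _ ≤ E * (Real.exp (L.α * -((n : ℝ) + 1)) * ‖ξ‖) := by gcongr
      _ = Real.exp (-(L.α - L.δ) * (n + 1)) * ‖ξ‖ := by
          rw [hE, ← mul_assoc, ← Real.exp_add]; congr 2; ring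
      _ ≤ 1 * ‖ξ‖ := by
          refine mul_le_mul_of_nonneg_right (Real.exp_le_one_iff.2 ?_) (norm_nonneg _)
          exact mul_nonpos_of_nonpos_of_nonneg (neg_nonpos.2 L.α_sub_δ_pos.le) (by positivity)
      _ = _ := one_mul _
  have b2 : E * ‖∑ m ∈ Finset.range (n + 1), L.Su ((m : ℝ) - (n + 1)) (y m)‖
      ≤ B * (Real.exp (-L.δ) * u) * (1 - u)⁻¹ := by
    calc _ ≤ E * ∑ m ∈ Finset.range (n + 1), ‖L.Su ((m : ℝ) - (n + 1)) (y m)‖ := by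
          gcongr; exact norm_sum_le _ _
      _ = ∑ m ∈ Finset.range (n + 1), E * ‖L.Su ((m : ℝ) - (n + 1)) (y m)‖ := Finset.mul_sum _ _ _
      _ ≤ ∑ m ∈ Finset.range (n + 1), B * (Real.exp (-L.δ) * u) * u ^ (n - m) := by
          refine Finset.sum_le_sum fun m hm => ?_
          have hmn : m ≤ n := Nat.lt_succ_iff.1 (Finset.mem_range.1 hm)
          have hmn' : (m : ℝ) ≤ n := Nat.cast_le.2 hmn
          calc _ ≤ E * (Real.exp (L.α * ((m : ℝ) - (n + 1))) * (B * Real.exp (-L.δ * (m + 1)))) := by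
                gcongr
                exact (L.norm_Su_le (by linarith) _).trans
                  (mul_le_mul_of_nonneg_left (hy m) (Real.exp_nonneg _))
            _ = B * (E * Real.exp (L.α * ((m : ℝ) - (n + 1))) * Real.exp (-L.δ * (m + 1))) := by ring
            _ = _ := by
                rw [mul_assoc B, hu, hE, ← Real.exp_nat_mul, ← Real.exp_add, ← Real.exp_add,
                  ← Real.exp_add, ← Real.exp_add, Nat.cast_sub hmn]
                congr 2
                ring
      _ = B * (Real.exp (-L.δ) * u) * ∑ m ∈ Finset.range (n + 1), u ^ m := by
          rw [← Finset.mul_sum, ← Finset.sum_range_reflect (fun m => u ^ m)]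
          simp
      _ ≤ _ := by
          refine mul_le_mul_of_nonneg_left ?_ (by positivity)
          exact sum_le_hasSum _ (fun m _ => pow_nonneg hu0 m) hgeo
  have b3 : E * ‖∑' m : ℕ, L.Ss m (y (n + 1 + m))‖ ≤ B * Real.exp (-L.δ) * (1 - u)⁻¹ := by
    have h1 := tsum_of_norm_bounded (hgeo.mul_left (B * Real.exp (-L.δ * (n + 1)) * Real.exp (-L.δ)))
      (L.norm_Ss_seq_le hy n)
    calc _ ≤ E * (B * Real.exp (-L.δ * (n + 1)) * Real.exp (-L.δ) * (1 - u)⁻¹) := by gcongr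
      _ = (E * Real.exp (-L.δ * (n + 1))) * (B * Real.exp (-L.δ) * (1 - u)⁻¹) := by ring
      _ = _ := by rw [hE, ← Real.exp_add, neg_mul, add_neg_cancel, Real.exp_zero, one_mul]
  calc _ ≤ E * (‖L.Su (-((n : ℝ) + 1)) ξ‖
        + ‖∑ m ∈ Finset.range (n + 1), L.Su ((m : ℝ) - (n + 1)) (y m)‖
        + ‖∑' m : ℕ, L.Ss m (y (n + 1 + m))‖) := by
        refine mul_le_mul_of_nonneg_left ?_ hE0.le
        exact (norm_add_le _ _).trans (add_le_add_left (norm_sub_le _ _) _)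
    _ ≤ ‖ξ‖ + B * (Real.exp (-L.δ) * u) * (1 - u)⁻¹ + B * Real.exp (-L.δ) * (1 - u)⁻¹ := by
        rw [mul_add, mul_add]; linarith
    _ = _ := by rw [perronConst, div_eq_mul_inv]; ring

/-- The gluing condition: index `n + 1` is the earlier interval, and its end value is the initial
value at `n`. `S_1` shifts both sums by one. The unstable sum loses `π^u y_{n+1}`, the stable series
gains `(1 - π^u) y_{n+1}`, and the two restore `y_{n+1}`. -/
theorem perronInit_succ (hy : ∀ m : ℕ, ‖y m‖ ≤ B * Real.exp (-L.δ * (m + 1))) (ξ : H) (n : ℕ) :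
    y (n + 1) + L.S 1 (L.perronInit ξ y (n + 1)) = L.perronInit ξ y n := by
  have hs := L.summable_Ss_seq hy
  have e1 : L.S 1 (L.Su (-(((n + 1 : ℕ) : ℝ) + 1)) ξ) = L.Su (-((n : ℝ) + 1)) ξ := by
    rw [L.S_Su zero_le_one]; congr 2; push_cast; ring
  have e2 : L.S 1 (∑ m ∈ Finset.range (n + 1 + 1), L.Su ((m : ℝ) - ((n + 1 : ℕ) + 1)) (y m))
      = ∑ m ∈ Finset.range (n + 1), L.Su ((m : ℝ) - (n + 1)) (y m) + L.πu (y (n + 1)) := by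
    rw [map_sum, Finset.sum_range_succ, L.S_Su zero_le_one, ← L.Su_zero]
    congr 1
    · refine Finset.sum_congr rfl fun m _ => ?_
      rw [L.S_Su zero_le_one]; congr 2; push_cast; ring
    · congr 2; push_cast; ring
  have e3 : ∑' m : ℕ, L.Ss m (y (n + 1 + m)) = (y (n + 1) - L.πu (y (n + 1)))
      + L.S 1 (∑' m : ℕ, L.Ss m (y (n + 1 + 1 + m))) := by
    rw [(hs n).tsum_eq_zero_add, (L.S 1).map_tsum (hs (n + 1))]
    congr 1
    · rw [L.Ss_apply, Nat.cast_zero, L.S_zero]; rfl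
    · refine tsum_congr fun m => ?_
      rw [L.Ss_apply, L.Ss_apply, L.S_comm zero_le_one (Nat.cast_nonneg m), Nat.cast_succ,
        add_comm (m : ℝ) 1, show n + 1 + (m + 1) = n + 1 + 1 + m by ring]
  rw [perronInit, perronInit, map_add, map_sub, e1, e2, e3]
  abel

end Sequences

end LinearPart

variable [CompleteSpace H] [NormedSpace ℝ H] [IsScalarTower ℝ 𝕜 H] {d : ℕ}
  {L : LinearPart 𝕜 H} {γ η : ℝ} {w : RoughPath γ d}

/-- A family of controlled paths on the unit intervals that start at zero and are bounded with
the weight of the sequence space. -/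
structure LocalForcing (L : LinearPart 𝕜 H) (η : ℝ) (w : RoughPath γ d) (Z : LPSeq H d) (B : ℝ) :
    Prop where
  memD : ∀ n, MemD L η (noise w n) (Z n)
  zero : ∀ n, (Z n).1 0 = 0
  bdd : ∀ n : ℕ, Real.exp (L.δ * (n + 1)) * normD L η (noise w n) (Z n) ≤ B

/-- The sequence obtained from local contributions by adding the orbits of the initial values. -/
def perronSeq (L : LinearPart 𝕜 H) (ξ : H) (Z : LPSeq H d) : LPSeq H d := fun n =>
  Z n + ((fun t : I01 => L.S t (L.perronInit ξ (fun m => (Z m).1 1) n)), 0)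

namespace LocalForcing

variable {Z Z' : LPSeq H d} {B B' : ℝ}

theorem norm_one_le (h : LocalForcing L η w Z B) (hγ : 0 ≤ γ) (m : ℕ) :
    ‖(Z m).1 1‖ ≤ B * Real.exp (-L.δ * (m + 1)) := by
  refine ((h.memD m).norm_one_le hγ (h.zero m)).trans ?_
  rw [neg_mul, Real.exp_neg, ← div_eq_mul_inv, le_div_iff₀ (Real.exp_pos _), mul_comm]
  exact h.bdd m

/-- Joint linearity in `(ξ, Z)`, once the series converge: the contraction estimate becomes the norm
bound for one sequence. -/
theorem perronSeq_sub (h : LocalForcing L η w Z B) (h' : LocalForcing L η w Z' B') (hγ : 0 ≤ γ)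
    (ξ ζ : H) : perronSeq L ξ Z - perronSeq L ζ Z' = perronSeq L (ξ - ζ) (Z - Z') := by
  funext n
  have := L.perronInit_sub (h.norm_one_le hγ) (h'.norm_one_le hγ) ξ ζ n
  have e : (fun m => ((Z - Z') m).1 1) = fun m => (Z m).1 1 - (Z' m).1 1 := rfl
  rw [Pi.sub_apply, perronSeq, perronSeq, perronSeq, e, this, Pi.sub_apply]
  refine Prod.ext (funext fun t => ?_) (funext fun t => ?_)
  · simp only [Prod.fst_sub, Prod.fst_add, Pi.sub_apply, Pi.add_apply, map_sub]
    abel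
  · simp

theorem weighted_normD_le (h : LocalForcing L η w Z B) (hM : ∃ M, L.SemigroupBounds γ M)
    (hγ : 0 < γ) (ξ : H) (n : ℕ) :
    Real.exp (L.δ * (n + 1)) * normD L η (noise w n) (perronSeq L ξ Z n)
      ≤ ‖ξ‖ + (B + B * L.perronConst) := by
  have h1 := L.norm_perronInit_le (h.norm_one_le hγ.le) ξ n
  have h2 := (h.memD n).normD_add_le hγ.le
    (memD_orbit (η := η) hM hγ (L.perronInit ξ (fun m => (Z m).1 1) n))
  have h3 := (normD_orbit_le (L := L) (w := noise w n) (η := η) hγ.le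
    (L.perronInit ξ (fun m => (Z m).1 1) n)).2
  have h4 := mul_le_mul_of_nonneg_left (h2.trans (add_le_add_right h3 _))
    (Real.exp_nonneg (L.δ * (n + 1)))
  have h5 := h.bdd n
  refine h4.trans ?_
  rw [mul_add (Real.exp _)]
  linarith

theorem memBC (h : LocalForcing L η w Z B) (hM : ∃ M, L.SemigroupBounds γ M) (hγ : 0 < γ) (ξ : H) :
    MemBC L η w (perronSeq L ξ Z) := by
  refine ⟨fun n => (h.memD n).add hM hγ (memD_orbit hM hγ _), fun n => ?_,
    ⟨_, by rintro _ ⟨n, rfl⟩; exact h.weighted_normD_le hM hγ ξ n⟩⟩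
  have e := L.perronInit_succ (h.norm_one_le hγ.le) ξ n
  simp only [perronSeq, Prod.fst_add, Pi.add_apply, h.zero n, zero_add]
  rw [show ((0 : I01) : ℝ) = 0 from rfl, show ((1 : I01) : ℝ) = 1 from rfl, L.S_zero, e]
  rfl

end LocalForcing

/-! ### The integrals on the unit interval -/

namespace Coeffs

variable {f : H → H} {g : H → EuclideanSpace ℝ (Fin d) →L[ℝ] H} {M m B : ℝ} {P : Pair H d}

theorem mildConv_stable (C : Coeffs L γ f g M m) (hP : Plain L w P B) (hc : Continuous P.1)
    (t : I01) : MildConvExists L f g w P L.Ss t 0 t ∧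
      mildConv L f g w P L.Ss t 0 t = (1 - L.πu) ((solMap L f g w P).1 t) :=
  C.mildConv_comp hP hc le_rfl t.2.1 le_rfl t.2.2 (T := 1 - L.πu) (c := 1)
    (fun x => by rw [one_mul]; exact L.nrm_sub_πu_le C.nonpos x)
    fun u hu x => L.Ss_apply' (sub_nonneg.2 hu.2) x

/-- On `[t,1]` the kernel factors as `S^u_{t-u} = S^u_{t-1} S_{1-u}`, so the backward integral is
`S^u_{t-1}` of the mild increment `Y_1 - S_{1-t} Y_t` of the solution map `Y`. -/
theorem mildConv_unstable (C : Coeffs L γ f g M m) (hP : Plain L w P B) (hc : Continuous P.1)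
    (t : I01) : MildConvExists L f g w P L.Su t t 1 ∧
      mildConv L f g w P L.Su t t 1
        = L.Su ((t : ℝ) - 1) ((solMap L f g w P).1 1) - L.πu ((solMap L f g w P).1 t) := by
  obtain ⟨c, -, hcc⟩ := L.exists_nrm_Su_le C.nonpos ((t : ℝ) - 1)
  obtain ⟨h1, h2⟩ := C.mildConv_comp hP hc t.2.1 t.2.2 le_rfl le_rfl (T := L.Su ((t : ℝ) - 1))
    (Q := L.Su) (r := t) hcc fun u hu x => by
      rw [L.Su_S (sub_nonneg.2 hu.2)]; congr 2; ring
  refine ⟨h1, ?_⟩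
  have h3 := C.hatDelta_solMap hP hc (s := t) (t := 1) t.2.2
  rw [show ((1 : I01) : ℝ) = 1 from rfl] at h3
  rw [h2, ← h3, map_sub, L.Su_S (sub_nonneg.2 t.2.2), sub_add_sub_cancel', sub_self, L.Su_zero]

theorem solMap_fst_zero (C : Coeffs L γ f g M m) (hP : Plain L w P B) (hc : Continuous P.1) :
    (solMap L f g w P).1 0 = 0 := C.mildConv_self hP hc le_rfl zero_le_one

end Coeffs

section Map

variable {D : Data 𝕜 H d} {M m : ℝ} {R : RoughPath γ d → ℝ} {p : LPSeq H d}

/-- The local contributions of a sequence. -/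
def forcing (D : Data 𝕜 H d) (R : RoughPath γ d → ℝ) (w : RoughPath γ d) (p : LPSeq H d) :
    LPSeq H d := fun n => D.TR (noise w n) (R (noise w n)) (p n)

/-- With `Y = T_R` on the current interval, the local stable integral minus the local unstable one
is `(1 - π^u) Y_t + π^u Y_t - S^u_{t-1} Y_1 = Y_t - S^u_{t-1} Y_1`. So the full local solution
reappears, and all other terms are `S_t` applied to one initial value. -/
theorem jConverges_and_eq (C : Coeffs D.L γ D.f D.g M m) (hη : 0 ≤ D.η)
    (hp : ∀ n, MemD D.L D.η (noise w n) (p n)) {B : ℝ}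
    (hF : LocalForcing D.L D.η w (forcing D R w p) B) (ξ : H) :
    D.JConverges R w p ∧ D.J R w ξ p = perronSeq D.L ξ (forcing D R w p) := by
  have hM : ∃ M, D.L.SemigroupBounds γ M := ⟨M, C.semigroup⟩
  have hχ := fun n => memD_χ (R := R (noise w n)) hM C.pos (hp n)
  have hpl := fun n => ((hχ n).pointwise C.pos.le).plain C.semigroup C.pos hη
  have hs := fun n => C.mildConv_stable (hpl n) (hχ n).cont
  have hu := fun n => C.mildConv_unstable (hpl n) (hχ n).cont
  set Y : ℕ → I01 → H := fun n => (forcing D R w p n).1 with hY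
  have es : ∀ n (t : I01), D.convN R w p n D.L.Ss t 0 t = Y n t - D.L.πu (Y n t) := fun n t =>
    (hs n t).2
  have eu : ∀ n (t : I01), D.convN R w p n D.L.Su t t 1
      = D.L.Su ((t : ℝ) - 1) (Y n 1) - D.L.πu (Y n t) := fun n t => (hu n t).2
  have eu0 : ∀ n, D.convN R w p n D.L.Su 1 0 1 = D.L.πu (Y n 1) := fun n =>
    ((C.mildConv_comp (hpl n) (hχ n).cont le_rfl zero_le_one le_rfl le_rfl (T := D.L.πu) (c := 1)
      (Q := D.L.Su) (r := 1) (fun x => by rw [one_mul]; exact D.L.nrm_πu_le C.nonpos x)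
      fun u hu x => by
        rw [← D.L.Su_zero, D.L.Su_S (sub_nonneg.2 hu.2), zero_add])).2
  have xu0 : ∀ n, D.ConvExists (noise w n) (R (noise w n)) (p n) D.L.Su 1 0 1 := fun n =>
    ((C.mildConv_comp (hpl n) (hχ n).cont le_rfl zero_le_one le_rfl le_rfl (T := D.L.πu) (c := 1)
      (Q := D.L.Su) (r := 1) (fun x => by rw [one_mul]; exact D.L.nrm_πu_le C.nonpos x)
      fun u hu x => by
        rw [← D.L.Su_zero, D.L.Su_S (sub_nonneg.2 hu.2), zero_add])).1
  have hsum := D.L.summable_Ss_seq (hF.norm_one_le C.pos.le)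
  have hSs : ∀ (t : I01) (k : ℕ) (x : H), D.L.Ss ((t : ℝ) + k) (x - D.L.πu x)
      = D.L.S t (D.L.Ss k x) := fun t k x => by
    rw [D.L.Ss_apply, D.L.Ss_apply, D.L.S_comm t.2.1 (Nat.cast_nonneg k), map_sub D.L.πu,
      D.L.πu_πu, sub_self, sub_zero]
  have es1 : ∀ n, D.convN R w p n D.L.Ss 1 0 1 = Y n 1 - D.L.πu (Y n 1) := fun n => es n 1
  have hterm : ∀ (n : ℕ) (t : I01) (k : ℕ), D.L.Ss ((t : ℝ) + k)
      (D.convN R w p (n + 1 + k) D.L.Ss 1 0 1) = D.L.S t (D.L.Ss k (Y (n + 1 + k) 1)) :=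
    fun n t k => by rw [es1, hSs]
  refine ⟨⟨fun n t => ⟨xu0 n, (hu n t).1, (hs n t).1⟩, fun n t => ?_⟩, ?_⟩
  · simp only [hterm]
    exact (hsum n).mapL (D.L.S t)
  · funext n
    refine Prod.ext (funext fun t => ?_) ?_
    · simp only [Data.J, hterm, es, eu, eu0, perronSeq, Prod.fst_add, Pi.add_apply,
        LinearPart.perronInit, map_add, map_sub, map_sum, D.L.Su_πu]
      -- The unstable sum in `perronInit` has one term more than the sum in `J`. This last term, `m
      -- = n`, matches the leftover `S^u_{t-1} Y_1` of the local unstable integral.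
      rw [(D.L.S t).map_tsum (hsum n), D.L.S_Su t.2.1, Finset.sum_range_succ]
      have e1 : ∀ k : ℕ, D.L.S t (D.L.Su ((k : ℝ) - (n + 1)) ((forcing D R w p k).1 1))
          = D.L.Su ((t : ℝ) - (n + 1) + k) (Y k 1) := fun k => by
        rw [D.L.S_Su t.2.1]; congr 2; ring
      simp only [e1]
      rw [show (t : ℝ) - (n + 1) + n = t - 1 by ring, ← sub_eq_add_neg]
      abel
    · simp only [Data.J, perronSeq, Prod.snd_add, add_zero]
      rfl

end Map

end LyapunovPerron

/-! ## The sequence space -/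

section SequenceSpace

variable {𝕜 H : Type*} [RCLike 𝕜] [NormedAddCommGroup H] [InnerProductSpace 𝕜 H]
  [CompleteSpace H] [NormedSpace ℝ H] [IsScalarTower ℝ 𝕜 H] {d : ℕ}
  {L : LinearPart 𝕜 H} {γ η : ℝ} {w : RoughPath γ d} {p q r : LPSeq H d}

theorem normBC_nonneg (hγ : 0 ≤ γ) (p : LPSeq H d) : 0 ≤ normBC L η w p :=
  Real.iSup_nonneg fun _ => mul_nonneg (Real.exp_nonneg _) (normD_nonneg (by linarith) _)

theorem normBC_le {b : ℝ}
    (h : ∀ n : ℕ, Real.exp (L.δ * (n + 1)) * normD L η (noise w n) (p n) ≤ b) :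
    normBC L η w p ≤ b := ciSup_le h

theorem MemBC.weighted_le (hp : MemBC L η w p) (n : ℕ) :
    Real.exp (L.δ * (n + 1)) * normD L η (noise w n) (p n) ≤ normBC L η w p :=
  le_ciSup hp.bdd n

theorem MemBC.normD_le (hp : MemBC L η w p) (n : ℕ) :
    normD L η (noise w n) (p n) ≤ Real.exp (-(L.δ * (n + 1))) * normBC L η w p := by
  rw [Real.exp_neg, inv_mul_eq_div, le_div_iff₀ (Real.exp_pos _), mul_comm]
  exact hp.weighted_le n

theorem MemBC.of_bound {b : ℝ} (h1 : ∀ n, MemD L η (noise w n) (p n))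
    (h2 : ∀ n, (p n).1 0 = (p (n + 1)).1 1)
    (h3 : ∀ n : ℕ, Real.exp (L.δ * (n + 1)) * normD L η (noise w n) (p n) ≤ b) :
    MemBC L η w p := ⟨h1, h2, ⟨b, by rintro _ ⟨n, rfl⟩; exact h3 n⟩⟩

theorem MemBC.zero (hM : ∃ M, L.SemigroupBounds γ M) (hγ : 0 < γ) :
    MemBC L η w (0 : LPSeq H d) :=
  .of_bound (b := 0) (fun _ => MemD.zero hM hγ) (fun _ => rfl) fun n => by
    rw [Pi.zero_apply, normD_zero (by linarith), mul_zero]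

theorem weighted_add_le (hγ : 0 ≤ γ) (hp : MemBC L η w p) (hq : MemBC L η w q) (n : ℕ) :
    Real.exp (L.δ * (n + 1)) * normD L η (noise w n) ((p + q) n)
      ≤ normBC L η w p + normBC L η w q := by
  have h1 := (hp.memD n).normD_add_le hγ (hq.memD n)
  have h2 := mul_le_mul_of_nonneg_left h1 (Real.exp_nonneg (L.δ * (n + 1)))
  have := hp.weighted_le n
  have := hq.weighted_le n
  refine h2.trans ?_
  rw [mul_add (Real.exp _)]
  linarith

theorem MemBC.add (hM : ∃ M, L.SemigroupBounds γ M) (hγ : 0 < γ) (hp : MemBC L η w p)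
    (hq : MemBC L η w q) : MemBC L η w (p + q) :=
  .of_bound (fun n => (hp.memD n).add hM hγ (hq.memD n))
    (fun n => congrArg₂ (· + ·) (hp.glue n) (hq.glue n)) (weighted_add_le hγ.le hp hq)

theorem MemBC.neg (hM : ∃ M, L.SemigroupBounds γ M) (hγ : 0 < γ) (hp : MemBC L η w p) :
    MemBC L η w (-p) :=
  .of_bound (b := normBC L η w p)
    (fun n => by simpa using (hp.memD n).smul hM hγ (-1)) (fun n => congrArg Neg.neg (hp.glue n))
    fun n => by
      rw [Pi.neg_apply, normD_neg (by linarith)]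
      exact hp.weighted_le n

theorem MemBC.sub (hM : ∃ M, L.SemigroupBounds γ M) (hγ : 0 < γ) (hp : MemBC L η w p)
    (hq : MemBC L η w q) : MemBC L η w (p - q) := by
  rw [sub_eq_add_neg]
  exact hp.add hM hγ (hq.neg hM hγ)

theorem normBC_triangle (hM : ∃ M, L.SemigroupBounds γ M) (hγ : 0 < γ) (hp : MemBC L η w p)
    (hq : MemBC L η w q) (hr : MemBC L η w r) :
    normBC L η w (p - r) ≤ normBC L η w (p - q) + normBC L η w (q - r) := by
  have := normBC_le (weighted_add_le hγ.le (hp.sub hM hγ hq) (hq.sub hM hγ hr))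
  rwa [sub_add_sub_cancel] at this

theorem normBC_sub_rev (hγ : 0 ≤ γ) (p q : LPSeq H d) :
    normBC L η w (p - q) = normBC L η w (q - p) := by
  rw [normBC, normBC]
  congr 1
  funext n
  rw [Pi.sub_apply, Pi.sub_apply, ← normD_neg (by linarith), neg_sub]

theorem MemBC.eq_zero (hM : ∃ M, L.SemigroupBounds γ M) (hγ : 0 < γ) (hη : 0 ≤ η)
    (hp : MemBC L η w p) (h : normBC L η w p ≤ 0) : p = 0 := by
  obtain ⟨M, hM⟩ := hM
  have h0 : ∀ n, Pointwise L (noise w n) η (p n) 0 := fun n => by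
    refine ((hp.memD n).pointwise hγ.le).mono ((hp.normD_le n).trans ?_)
    exact mul_nonpos_of_nonneg_of_nonpos (Real.exp_nonneg _) h
  funext n
  refine Prod.ext (funext fun t => ?_) (funext fun t => ?_)
  · have := (h0 n).norm_le hM hη t
    rw [mul_zero] at this
    exact norm_le_zero_iff.1 this
  · exact norm_le_zero_iff.1 ((h0 n).op t)

theorem continuous_of_norm_sub_le {X E : Type*} [TopologicalSpace X] [SeminormedAddCommGroup E]
    {F : ℕ → X → E} {f : X → E} {b : ℕ → ℝ} (hF : ∀ k, Continuous (F k))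
    (hb : Tendsto b atTop (𝓝 0)) (h : ∀ k x, ‖f x - F k x‖ ≤ b k) : Continuous f := by
  refine TendstoUniformly.continuous (F := F) (p := atTop) (Metric.tendstoUniformly_iff.2 ?_)
    (Frequently.of_forall hF)
  intro ε hε
  filter_upwards [hb.eventually (gt_mem_nhds hε)] with k hk x
  rw [dist_eq_norm]
  exact (h k x).trans_lt hk

/-- Completeness of the space of mildly controlled rough paths. -/
theorem MemD.exists_limit (hM : ∃ M, L.SemigroupBounds γ M) (hγ : 0 < γ) (hη : 0 ≤ η)
    {P : ℕ → Pair H d} (hP : ∀ k, MemD L η w (P k)) {b : ℕ → ℝ} (hb : Tendsto b atTop (𝓝 0))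
    (h : ∀ k l, k ≤ l → normD L η w (P l - P k) ≤ b k) :
    ∃ p, MemD L η w p ∧ (∀ k, normD L η w (p - P k) ≤ 6 * b k) ∧
      ∀ t, Tendsto (fun k => (P k).1 t) atTop (𝓝 (p.1 t)) := by
  have hM' := hM
  obtain ⟨M, hMb⟩ := hM
  have hθ : -2 * γ ≤ 0 := by linarith
  have hpt : ∀ k l, k ≤ l → Pointwise L w η (P l - P k) (b k) := fun k l hkl =>
    (((hP l).sub hM' hγ (hP k)).pointwise hγ.le).mono (h k l hkl)
  have hb' : Tendsto (fun k => 2 * M * b k) atTop (𝓝 0) := by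
    simpa using hb.const_mul (2 * M)
  have h1 : ∀ t, ∃ x, Tendsto (fun k => (P k).1 t) atTop (𝓝 x) := fun t =>
    cauchySeq_tendsto_of_complete (cauchySeq_of_le_tendsto_0' _ (fun k l hkl => by
      rw [dist_comm, dist_eq_norm]
      exact (hpt k l hkl).norm_le hMb hη t) hb')
  have h2 : ∀ t, ∃ x, Tendsto (fun k => (P k).2 t) atTop (𝓝 x) := fun t =>
    cauchySeq_tendsto_of_complete (cauchySeq_of_le_tendsto_0' _ (fun k l hkl => by
      rw [dist_comm, dist_eq_norm]
      exact (hpt k l hkl).op t) hb)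
  choose y hy using h1
  choose y' hy' using h2
  set p : Pair H d := (y, y') with hp
  -- The Cauchy bound between the `l`-th and `k`-th pairs passes to the limit `l → ∞` componentwise.
  have hlim : ∀ k, Pointwise L w η (p - P k) (b k) := fun k =>
    Pointwise.of_tendsto hθ (P := fun l => P l - P k) (fun t => (hy t).sub_const _)
      (fun t => (hy' t).sub_const _) ((eventually_ge_atTop k).mono fun l hl => hpt k l hl)
  have hfin : FinD L w hθ η p := by
    have := ((hlim 0).finD hθ).add ((hP 0).finD hθ)
    rwa [sub_add_cancel] at this
  have hmem : MemD L η w p := by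
    refine memD_of_pointwise hM' hγ hθ hfin.pointwise ?_ ?_
    · exact continuous_of_norm_sub_le (fun k => (hP k).cont) hb' fun k t =>
        (hlim k).norm_le hMb hη t
    · refine continuous_of_norm_sub_le (fun k => (hP k).cont_emb hθ)
        (b := fun k => ‖L.emb (-2 * γ) hθ‖ * b k) (by simpa using hb.const_mul _) fun k t => ?_
      rw [← ContinuousLinearMap.comp_sub]
      exact (ContinuousLinearMap.opNorm_comp_le _ _).trans
        (mul_le_mul_of_nonneg_left ((hlim k).op t) (norm_nonneg _))
  exact ⟨p, hmem, fun k => (hlim k).normD_le hθ, hy⟩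

/-- Completeness of the sequence space. -/
theorem MemBC.exists_limit (hM : ∃ M, L.SemigroupBounds γ M) (hγ : 0 < γ) (hη : 0 ≤ η)
    {P : ℕ → LPSeq H d} (hP : ∀ k, MemBC L η w (P k)) {b : ℕ → ℝ} (hb : Tendsto b atTop (𝓝 0))
    (h : ∀ k l, k ≤ l → normBC L η w (P l - P k) ≤ b k) :
    ∃ p, MemBC L η w p ∧ ∀ k, normBC L η w (p - P k) ≤ 6 * b k := by
  have hn : ∀ n : ℕ, ∃ p : Pair H d, MemD L η (noise w n) p ∧
      (∀ k, normD L η (noise w n) (p - P k n) ≤ 6 * (Real.exp (-(L.δ * (n + 1))) * b k)) ∧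
      ∀ t, Tendsto (fun k => (P k n).1 t) atTop (𝓝 (p.1 t)) := fun n =>
    MemD.exists_limit hM hγ hη (fun k => (hP k).memD n) (by simpa using hb.const_mul _)
      fun k l hkl => (((hP l).sub hM hγ (hP k)).normD_le n).trans
        (mul_le_mul_of_nonneg_left (h k l hkl) (Real.exp_nonneg _))
  choose p hp hpk hpt using hn
  have hw : ∀ k (n : ℕ), Real.exp (L.δ * (n + 1)) * normD L η (noise w n) ((p - P k) n)
      ≤ 6 * b k := fun k n => by
    refine (mul_le_mul_of_nonneg_left (hpk n k) (Real.exp_nonneg _)).trans (le_of_eq ?_)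
    rw [Real.exp_neg]
    field_simp
  have hsub : MemBC L η w (p - P 0) := by
    refine .of_bound (fun n => (hp n).sub hM hγ ((hP 0).memD n)) (fun n => ?_) (hw 0)
    -- Gluing survives because the paths converge pointwise in `H`.
    have e : (p n).1 0 = (p (n + 1)).1 1 :=
      tendsto_nhds_unique (hpt n 0) ((hpt (n + 1) 1).congr fun k => ((hP k).glue n).symm)
    exact congrArg₂ (· - ·) e ((hP 0).glue n)
  refine ⟨p, ?_, fun k => normBC_le (hw k)⟩
  have := hsub.add hM hγ (hP 0)
  rwa [sub_add_cancel] at this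

/-- The contraction principle in the sequence space. -/
theorem exists_unique_fixedPoint (hM : ∃ M, L.SemigroupBounds γ M) (hγ : 0 < γ) (hη : 0 ≤ η)
    {T : LPSeq H d → LPSeq H d} (hT : ∀ p, MemBC L η w p → MemBC L η w (T p))
    (hc : ∀ p q, MemBC L η w p → MemBC L η w q →
      normBC L η w (T p - T q) ≤ 1 / 2 * normBC L η w (p - q)) :
    ∃ p, MemBC L η w p ∧ T p = p ∧ ∀ q, MemBC L η w q → T q = q → q = p := by
  set P : ℕ → LPSeq H d := fun k => T^[k] 0 with hPdef
  have hsucc : ∀ k, P (k + 1) = T (P k) := fun k => Function.iterate_succ_apply' T k 0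
  have hP : ∀ k, MemBC L η w (P k) := fun k => by
    induction k with
    | zero => exact MemBC.zero hM hγ
    | succ k ih => rw [hsucc]; exact hT _ ih
  set c := normBC L η w (P 1 - P 0) with hcdef
  have hc0 : 0 ≤ c := normBC_nonneg hγ.le _
  have hstep : ∀ k, normBC L η w (P (k + 1) - P k) ≤ (1 / 2) ^ k * c := fun k => by
    induction k with
    | zero => simp [hcdef]
    | succ k ih =>
      have := hc _ _ (hP (k + 1)) (hP k)
      rw [← hsucc, ← hsucc] at this
      refine this.trans ?_
      rw [pow_succ]
      linarith
  -- The factor `2 - 2 (1/2)^j` is the partial geometric sum, stated exactly so that the induction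
  -- closes.
  have hcauchy : ∀ k j, normBC L η w (P (k + j) - P k) ≤ (2 - 2 * (1 / 2) ^ j) * ((1 / 2) ^ k * c) :=
    fun k j => by
    induction j with
    | zero =>
      rw [add_zero, sub_self]
      refine normBC_le fun n => ?_
      rw [Pi.zero_apply, normD_zero (by linarith)]
      simp
    | succ j ih =>
      have h1 := normBC_triangle hM hγ (hP (k + (j + 1))) (hP (k + j)) (hP k)
      have h2 := hstep (k + j)
      rw [add_assoc] at h2
      refine h1.trans ((add_le_add h2 ih).trans (le_of_eq ?_))
      rw [pow_add, pow_succ]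
      ring
  obtain ⟨p, hp, hlim⟩ := MemBC.exists_limit hM hγ hη hP (b := fun k => 2 * ((1 / 2) ^ k * c)) (by
      have := ((tendsto_pow_atTop_nhds_zero_of_lt_one (r := (1 / 2 : ℝ)) (by norm_num)
        (by norm_num)).mul_const c).const_mul 2
      simpa using this) fun k l hkl => by
    obtain ⟨j, rfl⟩ := Nat.exists_eq_add_of_le hkl
    refine (hcauchy k j).trans (mul_le_mul_of_nonneg_right ?_ (by positivity))
    have : (0 : ℝ) ≤ (1 / 2) ^ j := by positivity
    linarith
  have huniq : ∀ q, MemBC L η w q → normBC L η w q ≤ 0 → q = 0 := fun q hq h =>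
    hq.eq_zero hM hγ hη h
  have hfix : T p = p := by
    refine sub_eq_zero.1 (huniq _ ((hT p hp).sub hM hγ hp) ?_)
    -- With `r = (1/2)^k c`, the distance of `p` to the `k`-th iterate is at most `12 r`.
    -- Contraction and the next iterate give `6 r + 6 r`, so `24` leaves room.
    have hb : Tendsto (fun k : ℕ => 24 * ((1 / 2 : ℝ) ^ k * c)) atTop (𝓝 0) := by
      have := ((tendsto_pow_atTop_nhds_zero_of_lt_one (r := (1 / 2 : ℝ)) (by norm_num)
        (by norm_num)).mul_const c).const_mul 24
      simpa using this
    refine ge_of_tendsto' hb fun k => ?_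
    have h1 := normBC_triangle hM hγ (hT p hp) (hP (k + 1)) hp
    have h2 := hc _ _ hp (hP k)
    rw [← hsucc] at h2
    have h3 := hlim k
    have h4 := hlim (k + 1)
    rw [normBC_sub_rev hγ.le, pow_succ] at h4
    have : (0 : ℝ) ≤ (1 / 2) ^ k * c := by positivity
    linarith
  refine ⟨p, hp, hfix, fun q hq hqT => ?_⟩
  refine sub_eq_zero.1 (huniq _ (hq.sub hM hγ hp) ?_)
  have := hc q p hq hp
  rw [hqT, hfix] at this
  linarith

end SequenceSpace

/-! ## The fixed point of the Lyapunov–Perron map -/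

section FixedPoint

variable {𝕜 H : Type*} [RCLike 𝕜] [NormedAddCommGroup H] [InnerProductSpace 𝕜 H]
  [CompleteSpace H] [NormedSpace ℝ H] [IsScalarTower ℝ 𝕜 H] {d : ℕ} {γ : ℝ}
  {D : Data 𝕜 H d} {M m K : ℝ} {R : RoughPath γ d → ℝ} {w : RoughPath γ d} {p q : LPSeq H d}

theorem TR_zero (C : Coeffs D.L γ D.f D.g M m) (w : RoughPath γ d) (R : ℝ) :
    D.TR w R (0 : Pair H d) = 0 := by
  rw [TR_eq_solMap, Data.χ, smul_zero, C.solMap_zero]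

theorem localForcing_sub (C : Coeffs D.L γ D.f D.g M m) (hη : 0 ≤ D.η) (hηγ : D.η ≤ γ)
    (hK : 0 ≤ K)
    (hLip : ∀ (n : ℕ) (p q : Pair H d), MemD D.L D.η (noise w n) p → MemD D.L D.η (noise w n) q →
      normD D.L D.η (noise w n) (D.TR (noise w n) (R (noise w n)) p
        - D.TR (noise w n) (R (noise w n)) q) ≤ K * normD D.L D.η (noise w n) (p - q))
    (hp : MemBC D.L D.η w p) (hq : MemBC D.L D.η w q) :
    LocalForcing D.L D.η w (forcing D R w p - forcing D R w q)
      (K * normBC D.L D.η w (p - q)) := by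
  have hM : ∃ M, D.L.SemigroupBounds γ M := ⟨M, C.semigroup⟩
  have hz : ∀ p, MemBC D.L D.η w p → ∀ n, (forcing D R w p n).1 0 = 0 := fun p hp n => by
    have hχ := memD_χ (R := R (noise w n)) hM C.pos (hp.memD n)
    exact C.solMap_fst_zero ((hχ.pointwise C.pos.le).plain C.semigroup C.pos hη) hχ.cont
  refine ⟨fun n => (memD_TR C hη hηγ (hp.memD n)).sub hM C.pos (memD_TR C hη hηγ (hq.memD n)),
    fun n => ?_, fun n => ?_⟩
  · have : ((forcing D R w p - forcing D R w q) n).1 0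
      = (forcing D R w p n).1 0 - (forcing D R w q n).1 0 := rfl
    rw [this, hz p hp, hz q hq, sub_zero]
  · have h1 := mul_le_mul_of_nonneg_left (hLip n _ _ (hp.memD n) (hq.memD n))
      (Real.exp_nonneg (D.L.δ * (n + 1)))
    have h2 := mul_le_mul_of_nonneg_left ((hp.sub hM C.pos hq).weighted_le n) hK
    refine h1.trans (le_trans (le_of_eq ?_) h2)
    rw [Pi.sub_apply]; ring

/-- The truncated solution map fixes zero, so its growth bound is its Lipschitz bound against the
zero sequence. -/
theorem localForcing (C : Coeffs D.L γ D.f D.g M m) (hη : 0 ≤ D.η) (hηγ : D.η ≤ γ)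
    (hK : 0 ≤ K)
    (hLip : ∀ (n : ℕ) (p q : Pair H d), MemD D.L D.η (noise w n) p → MemD D.L D.η (noise w n) q →
      normD D.L D.η (noise w n) (D.TR (noise w n) (R (noise w n)) p
        - D.TR (noise w n) (R (noise w n)) q) ≤ K * normD D.L D.η (noise w n) (p - q))
    (hp : MemBC D.L D.η w p) :
    LocalForcing D.L D.η w (forcing D R w p) (K * normBC D.L D.η w p) := by
  have h := localForcing_sub C hη hηγ hK hLip hp (MemBC.zero ⟨M, C.semigroup⟩ C.pos)
  have e : forcing D R w 0 = 0 := funext fun n => TR_zero C _ _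
  rwa [e, sub_zero, sub_zero] at h

/-- The Lyapunov–Perron map for arbitrary radii for which the truncated solution maps have a
Lipschitz constant that satisfies the gap condition. -/
theorem lyapunovPerron (C : Coeffs D.L γ D.f D.g M m) (hη : 0 ≤ D.η) (hηγ : D.η ≤ γ)
    (hK : 0 ≤ K)
    (hLip : ∀ (n : ℕ) (p q : Pair H d), MemD D.L D.η (noise w n) p → MemD D.L D.η (noise w n) q →
      normD D.L D.η (noise w n) (D.TR (noise w n) (R (noise w n)) p
        - D.TR (noise w n) (R (noise w n)) q) ≤ K * normD D.L D.η (noise w n) (p - q))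
    (hgap : K + K * D.L.perronConst ≤ 1 / 2) :
    (∀ ξ p, MemBC D.L D.η w p → D.JConverges R w p ∧ MemBC D.L D.η w (D.J R w ξ p)) ∧
    ∀ ξ ζ p q, MemBC D.L D.η w p → MemBC D.L D.η w q →
      normBC D.L D.η w (D.J R w ξ p - D.J R w ζ q)
        ≤ ‖ξ - ζ‖ + 1 / 2 * normBC D.L D.η w (p - q) := by
  have hM : ∃ M, D.L.SemigroupBounds γ M := ⟨M, C.semigroup⟩
  have hF := fun p hp => localForcing (p := p) C hη hηγ hK hLip hp
  have hJ := fun ξ p hp => jConverges_and_eq C hη (MemBC.memD hp) (hF p hp) ξ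
  refine ⟨fun ξ p hp => ⟨(hJ ξ p hp).1, ?_⟩, fun ξ ζ p q hp hq => normBC_le fun n => ?_⟩
  · rw [(hJ ξ p hp).2]
    exact (hF p hp).memBC hM C.pos ξ
  · rw [(hJ ξ p hp).2, (hJ ζ q hq).2, (hF p hp).perronSeq_sub (hF q hq) C.pos.le]
    refine ((localForcing_sub C hη hηγ hK hLip hp hq).weighted_normD_le hM C.pos (ξ - ζ) n).trans ?_
    have := mul_le_mul_of_nonneg_right hgap (normBC_nonneg (L := D.L) (η := D.η) (w := w)
      C.pos.le (p - q))
    linarith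

end FixedPoint

end REE

end

/-! ### The theorem: choice of the radius and the fixed point. -/

theorem theorem4p1 {𝕜 H : Type*} [RCLike 𝕜] [NormedAddCommGroup H] [InnerProductSpace 𝕜 H]
    [CompleteSpace H] [NormedSpace ℝ H] [IsScalarTower ℝ 𝕜 H] (d : ℕ)
    (L : REE.LinearPart 𝕜 H) (γ η : ℝ) (hγ : 1 / 3 < γ) (hγ' : γ ≤ 1 / 2)
    (hη : 0 ≤ η) (hηγ : η < γ) (φ : ℝ → ℝ) (hφ : REE.IsCutoff φ) :
    -- the constants of the Lipschitz estimate, `C_f(|w|_γ, R)` and `C_g(|w|_γ, R)`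
    ∃ (Cf : (H → H) → ℝ → ℝ → ℝ)
      (Cg : (H → EuclideanSpace ℝ (Fin d) →L[ℝ] H) → ℝ → ℝ → ℝ),
      (∀ f, REE.IsDrift L γ f → ∀ ρ, 0 ≤ ρ → REE.IsRadiusConst (Cf f ρ)) ∧
      (∀ g, REE.IsDiffusion L γ g → ∀ ρ, 0 ≤ ρ → REE.IsRadiusConst (Cg g ρ)) ∧
      ∀ (f : H → H) (g : H → EuclideanSpace ℝ (Fin d) →L[ℝ] H),
        REE.IsDrift L γ f → REE.IsDiffusion L γ g →
        -- they are Lipschitz constants of the truncated solution map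
        (∀ (w : REE.RoughPath γ d) (R : ℝ), 0 < R → R ≤ 1 →
          ∀ p q : REE.Pair H d, REE.MemD L η w p → REE.MemD L η w q →
            REE.MemD L η w ((⟨L, η, φ, f, g⟩ : REE.Data 𝕜 H d).TR w R p) ∧
            REE.normD L η w ((⟨L, η, φ, f, g⟩ : REE.Data 𝕜 H d).TR w R p
                - (⟨L, η, φ, f, g⟩ : REE.Data 𝕜 H d).TR w R q)
              ≤ REE.cutoffBound (Cf f) (Cg g) w R * REE.normD L η w (p - q)) ∧
        ∀ K : ℝ, 0 < K →
          -- the cut-off radius `R̃(w)` is the unique solution of `cutoffBound = K`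
          ∃ Rt : REE.RoughPath γ d → ℝ,
            (∀ w r, (0 < r ∧ REE.cutoffBound (Cf f) (Cg g) w r = K) ↔ r = Rt w) ∧
            ∀ J : REE.RoughPath γ d → H → REE.LPSeq H d → REE.LPSeq H d,
              -- `J` is the Lyapunov–Perron map for the random radius `R(w) = min (R̃(w)) 1`
              J = (⟨L, η, φ, f, g⟩ : REE.Data 𝕜 H d).J (fun w => min (Rt w) 1) →
              ∀ C : ℝ, 1 ≤ C → REE.GapCondition L K C →
                ∀ w : REE.RoughPath γ d,
                  (∀ ξ ∈ L.Hu, ∀ p, REE.MemBC L η w p →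
                    (⟨L, η, φ, f, g⟩ : REE.Data 𝕜 H d).JConverges (fun w => min (Rt w) 1) w p ∧
                    REE.MemBC L η w (J w ξ p)) ∧
                  (∀ ξ ∈ L.Hu, ∀ p q, REE.MemBC L η w p → REE.MemBC L η w q →
                    REE.normBC L η w (J w ξ p - J w ξ q)
                      ≤ 1 / 2 * REE.normBC L η w (p - q)) ∧
                  ∃ Γ : L.Hu → REE.LPSeq H d,
                    (∀ ξ : L.Hu, REE.MemBC L η w (Γ ξ) ∧ J w ξ (Γ ξ) = Γ ξ ∧
                      ∀ p, REE.MemBC L η w p → J w ξ p = p → p = Γ ξ) ∧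
                    ∃ l : ℝ, 0 ≤ l ∧ ∀ ξ₁ ξ₂ : L.Hu,
                      REE.normBC L η w (Γ ξ₁ - Γ ξ₂) ≤ l * ‖ξ₁ - ξ₂‖ := by
  obtain ⟨Cf, Cg, hCf, hCg, hmain⟩ :=
    REE.exists_lipschitz_constants d L γ η hγ hγ' hη hηγ φ hφ
  refine ⟨Cf, Cg, hCf, hCg, fun f g hf hg => ?_⟩
  obtain ⟨⟨M, m, hC⟩, hLip⟩ := hmain f g hf hg
  have hγ0 : 0 < γ := hC.pos
  have hM : ∃ M, L.SemigroupBounds γ M := ⟨M, hC.semigroup⟩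
  have hrad : ∀ w : REE.RoughPath γ d, REE.IsRadiusConst (REE.cutoffBound (Cf f) (Cg g) w) :=
    REE.isRadiusConst_cutoffBound (hCf f hf) (hCg g hg)
  refine ⟨fun w R hR hR1 p q hp hq => ⟨?_, hLip w R hR hR1 p q hp hq⟩, fun K hK => ?_⟩
  · exact REE.memD_TR (D := ⟨L, η, φ, f, g⟩) hC hη hηγ.le hp
  choose Rt hRt using fun w => (hrad w).exists_unique_root hK
  refine ⟨Rt, hRt, ?_⟩
  rintro _ rfl C hC1 hgap w
  have hRtK : ∀ w, 0 < Rt w ∧ REE.cutoffBound (Cf f) (Cg g) w (Rt w) = K := fun w =>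
    (hRt w (Rt w)).2 rfl
  have hRpos : ∀ w, 0 < min (Rt w) 1 := fun w => lt_min (hRtK w).1 one_pos
  obtain ⟨hJ, hJ'⟩ := REE.lyapunovPerron (D := ⟨L, η, φ, f, g⟩) (w := w)
    (R := fun w => min (Rt w) 1) hC hη hηγ.le hK.le
    -- On each interval the radius is that of the shifted noise, so the constant `K` is the same for
    -- all `n`. Lowering the radius to `min (Rt ·) 1` only decreases the Lipschitz bound, by
    -- monotonicity.
    (fun n p q hp hq => (hLip _ _ (hRpos _) (min_le_right _ _) p q hp hq).trans <|
      mul_le_mul_of_nonneg_right (by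
        rw [← (hRtK (REE.noise w n)).2]
        exact (hrad _).mono.monotoneOn (hRpos _).le (hRtK _).1.le (min_le_left _ _))
        (REE.normD_nonneg (by linarith) _))
    (L.gap_le hK hC1 hgap)
  have hcontr : ∀ ξ p q, REE.MemBC L η w p → REE.MemBC L η w q → _ := fun ξ p q hp hq =>
    hJ' ξ ξ p q hp hq
  simp only [sub_self, norm_zero, zero_add] at hcontr
  refine ⟨fun ξ _ p hp => hJ ξ p hp, fun ξ _ p q hp hq => hcontr ξ p q hp hq, ?_⟩
  choose Γ hΓ using fun ξ : L.Hu => REE.exists_unique_fixedPoint hM hγ0 hη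
    (fun p hp => (hJ ξ p hp).2) (hcontr ξ)
  -- The distance of two fixed points is at most `‖ξ₁ - ξ₂‖` plus half of itself, hence the constant
  -- `2`.
  refine ⟨Γ, hΓ, 2, zero_le_two, fun ξ₁ ξ₂ => ?_⟩
  have h := hJ' ξ₁ ξ₂ _ _ (hΓ ξ₁).1 (hΓ ξ₂).1
  rw [(hΓ ξ₁).2.1, (hΓ ξ₂).2.1] at h
  have e : ‖(ξ₁ : H) - ξ₂‖ = ‖ξ₁ - ξ₂‖ := rfl
  linarith
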